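/- **Setting.** Let $m_e,m_\mu,e,B>0$. Let $\Gamma_1=\{-1,1\}\times\mathbb N\times\mathbb R^2$ with counting measure times Lebesgue measure, with points $\xi=(s,n,p^1,p^3)$, and put $E^{(\alpha)}_n(p^3)=\sqrt{m_\alpha^2+(p^3)^2+2neB}$ for $\alpha=e,\mu$. Write $\mathfrak F_a(\mathfrak h)=\bigoplus_{n\ge 0}\bigotimes_a^n\mathfrak h$ for the fermionic Fock space over $\mathfrak h$, and let $$\mathfrak F=\mathfrak F_a(L^2(\Gamma_1))\otimes\mathfrak F_a(L^2(\Gamma_1))\otimes\mathfrak F_a(L^2(\Gamma_1))\otimes\mathfrak F_a(L^2(\mathbb R^3))\otimes\mathfrak F_a(L^2(\mathbb R^3))$$ be the state space of electrons, muons, antimuons, neutrinos $\nu_\mu$ and antineutrinos $\bar\nu_e$, with annihilation operators $b_+(\xi_1)$, $b_+(\xi_2)$, $b_-(\xi_2)$, $b_+(\xi_4)$, $b_-(\xi_3)$ respectively, where $\xi_1,\xi_2\in\Gamma_1$ and $\xi_3=\mathbf p_3,\ \xi_4=\mathbf p_4\in\mathbb R^3$. They satisfy the canonical anticommutation relations,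 and operators of different species anticommute. The free Hamiltonian $H_0$ is the self-adjoint operator $$H_0=\int\! E^{(e)}_n(p^3)\,b_+^*(\xi_1)b_+(\xi_1)\,d\xi_1+\sum_{\epsilon=\pm}\int\! E^{(\mu)}_n(p^3)\,b_\epsilon^*(\xi_2)b_\epsilon(\xi_2)\,d\xi_2+\int|\mathbf p_3|\,b_-^*(\xi_3)b_-(\xi_3)\,d\xi_3+\int|\mathbf p_4|\,b_+^*(\xi_4)b_+(\xi_4)\,d\xi_4 ,$$ that is, multiplication by the total energy of the particles on its maximal domain. *Spinors.* Let $\gamma^\alpha$, $\gamma_5=i\gamma^0\gamma^1\gamma^2\gamma^3$ be the Dirac matrices in the standard representation, $\gamma_0=\gamma^0$, $\gamma_j=-\gamma^j$, $\overline U=U^\dagger\gamma^0$. Let $$I_n=\Big(\tfrac{\sqrt{eB}}{n!\,2^n\sqrt\pi}\Big)^{1/2}e^{-\zeta^2/2}H_n(\zeta),\qquad \zeta=\sqrt{eB}\Big(x^2-\tfrac{p^1}{eB}\Big),\qquad I_{-1}=0,$$ where $x^2\in\mathbb R$ is the second space coordinate and $H_n$ is the Hermite polynomial with leading coefficient $2^n$.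 For a mass $m_\alpha$ put $E=E_n^{(\alpha)}(p^3)$, $N=\big(\tfrac{E+m_\alpha}{2E}\big)^{1/2}$, $a=\tfrac{p^3}{E+m_\alpha}$, $k=\tfrac{\sqrt{2neB}}{E+m_\alpha}$ and $$U_{+1}=N(I_{n-1},0,aI_{n-1},-kI_n)^T\ (n\ge1),\qquad U_{-1}=N(0,I_n,-kI_{n-1},-aI_n)^T\ (n\ge 0),$$ $$V_{+1}=N(-aI_{n-1},kI_n,I_{n-1},0)^T\ (n\ge1),\qquad V_{-1}=N(kI_{n-1},aI_n,0,I_n)^T\ (n\ge 0),$$ with $U_{+1}=V_{+1}=0$ for $n=0$. Put $U^{(\alpha)}(x^2,\xi)=U_s(x^2,n,p^1,p^3)$ for $\alpha=e,\mu$ and, with $m_\alpha=m_\mu$, $W^{(\mu)}(x^2,\xi)=V_{-s}(x^2,n,-p^1,-p^3)$. For $\mathbf p\in\mathbb R^3$ put $$U^{(\nu_\mu)}(\mathbf p)=\tfrac1{\sqrt2}\big(h_-(\mathbf p),-h_-(\mathbf p)\big)^T,\qquad W^{(\bar\nu_e)}(\mathbf p)=\tfrac1{\sqrt2}\big(-h_+(-\mathbf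 p),h_+(-\mathbf p)\big)^T,$$ $$h_-(\mathbf p)=\frac{(p^3-|\mathbf p|,\;p^1+ip^2)}{\sqrt{2|\mathbf p|(|\mathbf p|-p^3)}},\qquad h_+(-\mathbf p)=\frac{(-p^1+ip^2,\;|\mathbf p|+p^3)}{\sqrt{2|\mathbf p|(|\mathbf p|+p^3)}},$$ with $h_-(\mathbf p)=(0,1)$ if $|\mathbf p|=p^3$ and $h_+(-\mathbf p)=(1,0)$ if $|\mathbf p|=-p^3$. *Interaction.* Let $F(\xi_2,\xi_4)$ and $G(\xi_1,\xi_3)$ belong to $L^2(\Gamma_1\times\mathbb R^3)$, with norms $\|F\|,\|G\|$. With summation over the repeated index $\alpha=0,1,2,3$, with $\mathbf r=\mathbf p_3+\mathbf p_4$, and with $r^2$ the second component of $\mathbf r$, put $$K_1=\int dx^2\,e^{-ix^2r^2}\big(\overline U^{(\nu_\mu)}(\xi_4)\gamma^\alpha(1-\gamma_5)U^{(\mu)}(x^2,\xi_2)\big)\big(\overline U^{(e)}(x^2,\xi_1)\gamma_\alpha(1-\gamma_5)W^{(\bar\nu_e)}(\xi_3)\big)F(\xi_2,\xi_4)G(\xi_1,\xi_3),$$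 $$K_2=\int dx^2\,e^{-ix^2r^2}\big(\overline U^{(\nu_\mu)}(\xi_4)\gamma_\alpha(1-\gamma_5)W^{(\mu)}(x^2,\xi_2)\big)\big(\overline U^{(e)}(x^2,\xi_1)\gamma^\alpha(1-\gamma_5)W^{(\bar\nu_e)}(\xi_3)\big)F(\xi_2,\xi_4)G(\xi_1,\xi_3),$$ $$H_I^{(1)}=\int K_1\,b_+^*(\xi_4)b_+^*(\xi_1)b_-^*(\xi_3)b_+(\xi_2)\,d\xi_1d\xi_2d\xi_3d\xi_4,\qquad H_I^{(2)}=\int K_2\,b_+^*(\xi_4)b_-^*(\xi_2)b_+^*(\xi_1)b_-^*(\xi_3)\,d\xi_1d\xi_2d\xi_3d\xi_4 .$$ $H_I$ is the closed operator in $\mathfrak F$ associated with the sesquilinear form of $H_I^{(1)}+(H_I^{(1)})^*+H_I^{(2)}+(H_I^{(2)})^*$: $\varphi$ is in its domain, with $H_I\varphi=\eta$, if for all finite particle vectors $\psi\in\mathfrak F$ the integrals defining the form $(\psi,H_I\varphi)$ converge absolutely and the form equals $(\psi,\eta)$. For $g\in\mathbb R$ let $H=H_0+gH_I$ with domain $D(H)=D(H_0)\cap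 D(H_I)$. Finally put $$C=\sum_{\alpha=0}^3\|\gamma^0\gamma_\alpha(1-\gamma_5)\|_{\mathbb C^4}\,\|\gamma^0\gamma^\alpha(1-\gamma_5)\|_{\mathbb C^4},\qquad \frac1M=\frac1{m_e}+\frac1{m_\mu},$$ with operator norms on $\mathbb C^4$. **Theorem (Self-adjointness).** Let $g_0>0$ satisfy $$4g_0\,\frac CM\,\|F\|\,\|G\|<1 .$$ Then for every $g\in\mathbb R$ with $|g|\le g_0$ one has $D(H)=D(H_0)$ and $H$ is self-adjoint in $\mathfrak F$. Moreover every core for $H_0$ is a core for $H$. -/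

import Mathlib

/-!
The model for the weak decay of muons in a uniform magnetic field: one-particle spaces,
fermionic Fock spaces, the free Hamiltonian, the interaction with square integrable kernels
and the total Hamiltonian, as unbounded operators (`LinearPMap`) on a Hilbert space.
-/

noncomputable section

namespace MuonDecay

open MeasureTheory Matrix

/-! ### Measure spaces of quantum numbers -/

instance instMeasureSpaceBool : MeasureSpace Bool := ⟨Measure.count⟩

instance instMeasureSpaceNat : MeasureSpace ℕ := ⟨Measure.count⟩

instance instSigmaFiniteBool : SigmaFinite (volume : Measure Bool) :=
  inferInstanceAs (SigmaFinite (Measure.count : Measure Bool))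

instance instSigmaFiniteNat : SigmaFinite (volume : Measure ℕ) :=
  inferInstanceAs (SigmaFinite (Measure.count : Measure ℕ))

/-- `Γ₁ = {-1, 1} × ℕ × ℝ²`: the quantum variables `(s, n, p¹, p³)` of an electron, a muon or an
antimuon in a uniform magnetic field. The spin label is a Boolean, `true` for `s = 1` and
`false` for `s = -1`. Its measure is counting measure times Lebesgue measure. -/
abbrev Gamma1 : Type := Bool × ℕ × ℝ × ℝ

/-- The momentum space `ℝ³` of the neutrinos and antineutrinos. The coordinates `p 0`, `p 1`,
`p 2` are `p¹`, `p²`, `p³`. -/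
abbrev Momentum : Type := EuclideanSpace ℝ (Fin 3)

/-! ### Configurations and the Fock space -/

/-- Configurations of finitely many particles: a particle number `n` and `n` points of `X`. -/
abbrev Conf (X : Type) : Type := Σ n : ℕ, (Fin n → X)

/-- The measure on configurations which on the `n`-particle sector is the product measure, so
that `L²(Conf X)` is the Hilbert sum over `n` of `L²(Xⁿ)`. -/
instance instMeasureSpaceConf (X : Type) [MeasureSpace X] : MeasureSpace (Conf X) :=
  ⟨Measure.sum fun n => (volume : Measure (Fin n → X)).map fun x => (⟨n, x⟩ : Conf X)⟩

instance instSFiniteConf (X : Type) [MeasureSpace X] [SigmaFinite (volume : Measure X)] :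
    SFinite (volume : Measure (Conf X)) :=
  inferInstanceAs
    (SFinite (Measure.sum fun n =>
      (volume : Measure (Fin n → X)).map fun x => (⟨n, x⟩ : Conf X)))

/-- Put a further particle `ξ` in front of a configuration. -/
def Conf.insert {X : Type} (ξ : X) (c : Conf X) : Conf X := ⟨c.1 + 1, Fin.cons ξ c.2⟩

/-- Permute the particles, with the permutation `σ n` in the `n`-particle sector. -/
def Conf.perm {X : Type} (σ : ∀ n : ℕ, Equiv.Perm (Fin n)) (c : Conf X) : Conf X :=
  ⟨c.1, c.2 ∘ σ c.1⟩

/-- Configurations of electrons, muons, antimuons, neutrinos `ν_μ` and antineutrinos `ν̄_e`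
(in this order). The space `L²(State)` is the Hilbert tensor product of the spaces `L²(Conf X)`
of the five species. -/
abbrev State : Type :=
  Conf Gamma1 × Conf Gamma1 × Conf Gamma1 × Conf Momentum × Conf Momentum

/-- Permute the particles within each of the five species. -/
def permState (σ : Fin 5 → ∀ n : ℕ, Equiv.Perm (Fin n)) (c : State) : State :=
  (c.1.perm (σ 0), c.2.1.perm (σ 1), c.2.2.1.perm (σ 2), c.2.2.2.1.perm (σ 3),
    c.2.2.2.2.perm (σ 4))

/-- The product of the signatures of the permutations applied by `permState` at `c`. -/
def signState (σ : Fin 5 → ∀ n : ℕ, Equiv.Perm (Fin n)) (c : State) : ℂ :=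
  ((Equiv.Perm.sign (σ 0 c.1.1) * Equiv.Perm.sign (σ 1 c.2.1.1) *
    Equiv.Perm.sign (σ 2 c.2.2.1.1) * Equiv.Perm.sign (σ 3 c.2.2.2.1.1) *
    Equiv.Perm.sign (σ 4 c.2.2.2.2.1) : ℤˣ) : ℤ)

/-- Antisymmetry (almost everywhere) under permutations of the particles of each species. -/
def IsAntisymm (f : State → ℂ) : Prop :=
  ∀ σ : Fin 5 → ∀ n : ℕ, Equiv.Perm (Fin n),
    ∀ᵐ c : State, f (permState σ c) = signState σ c * f c

set_option synthInstance.maxSize 1000 in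
instance instSFiniteState : SFinite (volume : Measure State) :=
  inferInstanceAs (SFinite (Measure.prod _ _))

/-! ### Null sets under permutations and insertions -/

lemma measurable_sector {X : Type} [MeasurableSpace X] (n : ℕ) :
    Measurable (fun x : Fin n → X => (⟨n, x⟩ : Conf X)) := by
  intro s hs
  exact (MeasurableSpace.measurableSet_iInf.1 hs) n

lemma measurableEmbedding_sector {X : Type} [MeasurableSpace X] (n : ℕ) :
    MeasurableEmbedding (fun x : Fin n → X => (⟨n, x⟩ : Conf X)) := by
  refine ⟨fun x y h => eq_of_heq (Sigma.mk.inj h).2, measurable_sector n, fun {s} hs => ?_⟩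
  refine MeasurableSpace.measurableSet_iInf.2 fun m => ?_
  change MeasurableSet ((fun x : Fin m → X => (⟨m, x⟩ : Conf X)) ⁻¹' _)
  by_cases hmn : m = n
  · subst hmn
    have hinj : Function.Injective (fun x : Fin m → X => (⟨m, x⟩ : Conf X)) :=
      fun x y h => eq_of_heq (Sigma.mk.inj h).2
    rwa [hinj.preimage_image]
  · convert MeasurableSet.empty
    ext x
    simp only [Set.mem_preimage, Set.mem_image, Set.mem_empty_iff_false, iff_false]
    rintro ⟨y, -, hy⟩
    exact hmn (congrArg Sigma.fst hy).symm

lemma measurable_of_sectors {X β : Type*} [MeasurableSpace X] [MeasurableSpace β]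
    {f : (Σ n : ℕ, (Fin n → X)) → β}
    (h : ∀ n, Measurable fun x : Fin n → X => f ⟨n, x⟩) : Measurable f := by
  intro s hs
  exact MeasurableSpace.measurableSet_iInf.2 fun n => h n hs

lemma volume_conf_eq_zero {X : Type} [MeasureSpace X] {s : Set (Conf X)}
    (hs : MeasurableSet s) :
    volume s = 0 ↔ ∀ n : ℕ, volume {x : Fin n → X | (⟨n, x⟩ : Conf X) ∈ s} = 0 := by
  change (Measure.sum fun n =>
    (volume : Measure (Fin n → X)).map fun x => (⟨n, x⟩ : Conf X)) s = 0 ↔ _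
  rw [Measure.sum_apply _ hs, ENNReal.tsum_eq_zero]
  refine forall_congr' fun n => ?_
  rw [Measure.map_apply (measurable_sector n) hs]
  rfl

lemma quasiMeasurePreserving_perm {X : Type} [MeasureSpace X]
    [SigmaFinite (volume : Measure X)] (σ : ∀ n : ℕ, Equiv.Perm (Fin n)) :
    Measure.QuasiMeasurePreserving (Conf.perm (X := X) σ) volume volume := by
  have hp : ∀ n, MeasurePreserving (fun x : Fin n → X => x ∘ σ n) volume volume := by
    intro n
    have h := volume_measurePreserving_piCongrLeft (fun _ : Fin n => X) (σ n).symm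
    convert h using 1
    ext x i
    obtain ⟨j, rfl⟩ := (σ n).symm.surjective i
    simp [MeasurableEquiv.coe_piCongrLeft, Equiv.piCongrLeft_apply]
  have hm : Measurable (Conf.perm (X := X) σ) :=
    measurable_of_sectors fun n => (measurable_sector n).comp (hp n).measurable
  refine ⟨hm, Measure.AbsolutelyContinuous.mk fun s hs h0 => ?_⟩
  rw [Measure.map_apply hm hs, volume_conf_eq_zero (hm hs)]
  intro n
  have h1 := (volume_conf_eq_zero hs).1 h0 n
  exact ((hp n).quasiMeasurePreserving).preimage_null h1

lemma quasiMeasurePreserving_insert {X : Type} [MeasureSpace X]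
    [SigmaFinite (volume : Measure X)] :
    Measure.QuasiMeasurePreserving (fun y : X × Conf X => Conf.insert y.1 y.2)
      volume volume := by
  have hp : ∀ n, MeasurePreserving
      (fun y : X × (Fin n → X) => (Fin.cons y.1 y.2 : Fin (n + 1) → X)) volume volume := by
    intro n
    have h := (volume_preserving_piFinSuccAbove (fun _ : Fin (n + 1) => X) 0).symm
    have he : (fun y : X × (Fin n → X) => (Fin.cons y.1 y.2 : Fin (n + 1) → X)) =
        (MeasurableEquiv.piFinSuccAbove (fun _ : Fin (n + 1) => X) 0).symm := by
      funext y
      exact (Fin.insertNth_zero (α := fun _ : Fin (n + 1) => X) y.1 y.2).symm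
    rw [he]
    exact h
  have hemb : ∀ n : ℕ, MeasurableEmbedding
      (Prod.map id (fun x : Fin n → X => (⟨n, x⟩ : Conf X)) : X × (Fin n → X) → X × Conf X) :=
    fun n => MeasurableEmbedding.id.prodMap (measurableEmbedding_sector n)
  have hm : Measurable (fun y : X × Conf X => Conf.insert y.1 y.2) := by
    intro s hs
    have : (fun y : X × Conf X => Conf.insert y.1 y.2) ⁻¹' s = ⋃ n : ℕ,
        (Prod.map id (fun x : Fin n → X => (⟨n, x⟩ : Conf X))) ''
          {y : X × (Fin n → X) | (⟨n + 1, Fin.cons y.1 y.2⟩ : Conf X) ∈ s} := by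
      ext ⟨ξ, n, x⟩
      simp only [Set.mem_preimage, Set.mem_iUnion, Set.mem_image]
      constructor
      · intro h
        exact ⟨n, (ξ, x), h, rfl⟩
      · rintro ⟨m, ⟨ξ', x'⟩, h, he⟩
        obtain ⟨rfl, he2⟩ := Prod.mk.inj he
        change Conf.insert ξ' ⟨n, x⟩ ∈ s
        rw [← he2]
        exact h
    rw [this]
    exact MeasurableSet.iUnion fun n => (hemb n).measurableSet_image.2
      (((measurable_sector (n + 1)).comp (hp n).measurable) hs)
  refine ⟨hm, Measure.AbsolutelyContinuous.mk fun s hs h0 => ?_⟩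
  rw [Measure.map_apply hm hs]
  change (volume.prod (Measure.sum fun n =>
    (volume : Measure (Fin n → X)).map fun x => (⟨n, x⟩ : Conf X))) _ = 0
  rw [Measure.prod_sum_right, Measure.sum_apply _ (hm hs), ENNReal.tsum_eq_zero]
  intro n
  have h2 := Measure.map_prod_map (volume : Measure X) (volume : Measure (Fin n → X))
    measurable_id (measurable_sector (X := X) n)
  rw [Measure.map_id] at h2
  rw [h2, Measure.map_apply (hemb n).measurable (hm hs)]
  exact ((hp n).quasiMeasurePreserving).preimage_null
    ((volume_conf_eq_zero hs).1 h0 (n + 1))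

set_option synthInstance.maxSize 1000 in
lemma quasiMeasurePreserving_permState (σ : Fin 5 → ∀ n : ℕ, Equiv.Perm (Fin n)) :
    Measure.QuasiMeasurePreserving (permState σ) volume volume :=
  QuasiMeasurePreserving.prodMap (quasiMeasurePreserving_perm (σ 0)) <|
    QuasiMeasurePreserving.prodMap (quasiMeasurePreserving_perm (σ 1)) <|
    QuasiMeasurePreserving.prodMap (quasiMeasurePreserving_perm (σ 2)) <|
    QuasiMeasurePreserving.prodMap (quasiMeasurePreserving_perm (σ 3))
      (quasiMeasurePreserving_perm (σ 4))

/-- The subspace of antisymmetric functions in `L²(State)`. -/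
def fockSubmodule : Submodule ℂ (Lp ℂ 2 (volume : Measure State)) where
  carrier := {φ | IsAntisymm φ}
  zero_mem' := by
    intro σ
    have h0 := Lp.coeFn_zero ℂ 2 (volume : Measure State)
    filter_upwards [h0, (quasiMeasurePreserving_permState σ).ae h0] with c h1 h2
    rw [h1, h2, Pi.zero_apply, Pi.zero_apply, mul_zero]
  add_mem' := by
    intro φ ψ hφ hψ σ
    have h0 := Lp.coeFn_add φ ψ
    filter_upwards [h0, (quasiMeasurePreserving_permState σ).ae h0, hφ σ, hψ σ]
      with c h1 h2 h3 h4
    rw [h1, h2, Pi.add_apply, Pi.add_apply, h3, h4, mul_add]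
  smul_mem' := by
    intro a φ hφ σ
    have h0 := Lp.coeFn_smul a φ
    filter_upwards [h0, (quasiMeasurePreserving_permState σ).ae h0, hφ σ] with c h1 h2 h3
    rw [h1, h2, Pi.smul_apply, Pi.smul_apply, h3, smul_eq_mul, smul_eq_mul]
    ring

lemma isClosed_fockSubmodule : IsClosed (fockSubmodule : Set (Lp ℂ 2 (volume : Measure State))) := by
  refine IsSeqClosed.isClosed fun u φ hu hlim σ => ?_
  obtain ⟨ns, -, hns⟩ := (tendstoInMeasure_of_tendsto_Lp hlim).exists_seq_tendsto_ae
  have hanti : ∀ᵐ c : State, ∀ k, u (ns k) (permState σ c) = signState σ c * u (ns k) c :=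
    ae_all_iff.2 fun k => hu (ns k) σ
  filter_upwards [hns, (quasiMeasurePreserving_permState σ).ae hns, hanti] with c h1 h2 h3
  refine tendsto_nhds_unique h2 ?_
  simp_rw [h3]
  exact h1.const_mul _

/-- The Fock space `𝔉 = 𝔉_e ⊗ 𝔉_μ ⊗ 𝔉_μ ⊗ 𝔉_{ν_μ} ⊗ 𝔉_{ν̄_e}`: the square integrable functions on
configurations of the five species which are antisymmetric in the particles of each species,
with the `L²` inner product. -/
def Fock : Type := fockSubmodule

instance instNormedAddCommGroupFock : NormedAddCommGroup Fock :=
  inferInstanceAs (NormedAddCommGroup fockSubmodule)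

instance instInnerProductSpaceFock : InnerProductSpace ℂ Fock :=
  inferInstanceAs (InnerProductSpace ℂ fockSubmodule)

instance instCompleteSpaceFock : CompleteSpace Fock :=
  isClosed_fockSubmodule.completeSpace_coe

/-- A vector of `𝔉` as a function on configurations. -/
def Fock.fn (φ : Fock) : State → ℂ := φ.1

/-- The vector of `𝔉` given by a square integrable antisymmetric function. -/
def Fock.mk (f : State → ℂ) (hf : MemLp f 2 volume) (ha : IsAntisymm (hf.toLp f)) : Fock :=
  ⟨hf.toLp f, ha⟩

lemma Fock.fn_mk (f : State → ℂ) (hf : MemLp f 2 volume) (ha : IsAntisymm (hf.toLp f)) :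
    (Fock.mk f hf ha).fn =ᵐ[volume] f :=
  hf.coeFn_toLp

lemma Fock.memLp (φ : Fock) : MemLp φ.fn 2 volume := Lp.memLp φ.1

lemma Fock.antisymm (φ : Fock) : IsAntisymm φ.fn := φ.2

lemma Fock.ext_ae {φ ψ : Fock} (h : φ.fn =ᵐ[volume] ψ.fn) : φ = ψ :=
  Subtype.ext (Lp.ext h)

lemma Fock.fn_zero : (0 : Fock).fn =ᵐ[volume] 0 := Lp.coeFn_zero ℂ 2 (volume : Measure State)

lemma Fock.fn_add (φ ψ : Fock) : (φ + ψ).fn =ᵐ[volume] φ.fn + ψ.fn := Lp.coeFn_add φ.1 ψ.1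

lemma Fock.fn_smul (a : ℂ) (φ : Fock) : (a • φ).fn =ᵐ[volume] a • φ.fn := Lp.coeFn_smul a φ.1

lemma Fock.inner_eq (φ ψ : Fock) : inner ℂ φ ψ = ∫ c, inner ℂ (φ.fn c) (ψ.fn c) :=
  L2.inner_def φ.1 ψ.1

/-! ### The free Hamiltonian -/

/-- `E_n(p³) = √(m² + (p³)² + 2 n e B)`, the energy of a particle of mass `m` with quantum
variables `(s, n, p¹, p³)`. -/
def landauEnergy (m e B : ℝ) (ξ : Gamma1) : ℝ :=
  Real.sqrt (m ^ 2 + ξ.2.2.2 ^ 2 + 2 * ξ.2.1 * e * B)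

/-- The sum of the energies of all particles: `ω(ξ₁)` for the electrons, `ω(ξ₂)` for the muons
and the antimuons, `|𝐩|` for the neutrinos and the antineutrinos. -/
def totalEnergy (mₑ mμ e B : ℝ) (c : State) : ℝ :=
  ∑ i, landauEnergy mₑ e B (c.1.2 i) + ∑ i, landauEnergy mμ e B (c.2.1.2 i) +
    ∑ i, landauEnergy mμ e B (c.2.2.1.2 i) + ∑ i, ‖c.2.2.2.1.2 i‖ + ∑ i, ‖c.2.2.2.2.2 i‖

/-- The graph of the free Hamiltonian: the pairs `(φ, χ)` in `𝔉 × 𝔉` such that `χ` is the product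
of the total energy and `φ`. -/
def freeGraph (mₑ mμ e B : ℝ) : Submodule ℂ (Fock × Fock) where
  carrier := {y | ∀ᵐ c : State, y.2.fn c = totalEnergy mₑ mμ e B c * y.1.fn c}
  zero_mem' := by
    filter_upwards [Fock.fn_zero] with c h1
    rw [Prod.fst_zero, Prod.snd_zero, h1, Pi.zero_apply, mul_zero]
  add_mem' := by
    intro y z hy hz
    filter_upwards [hy, hz, Fock.fn_add y.1 z.1, Fock.fn_add y.2 z.2] with c h1 h2 h3 h4
    rw [Prod.fst_add, Prod.snd_add, h3, h4, Pi.add_apply, Pi.add_apply, h1, h2, mul_add]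
  smul_mem' := by
    intro a y hy
    filter_upwards [hy, Fock.fn_smul a y.1, Fock.fn_smul a y.2] with c h1 h2 h3
    rw [Prod.smul_fst, Prod.smul_snd, h2, h3, Pi.smul_apply, Pi.smul_apply, h1, smul_eq_mul,
      smul_eq_mul]
    ring

/-- The free Hamiltonian `H₀`, the sum over the five species of the operators
`∫ ω(ξ) b*(ξ) b(ξ) dξ`: multiplication by the total energy, on its maximal domain. -/
def freeHamiltonian (mₑ mμ e B : ℝ) : Fock →ₗ.[ℂ] Fock := (freeGraph mₑ mμ e B).toLinearPMap

/-- The graph of `H₀` is single valued, so that `freeHamiltonian` has exactly this graph. -/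
lemma freeGraph_functional (mₑ mμ e B : ℝ) (y : Fock × Fock) (hy : y ∈ freeGraph mₑ mμ e B)
    (h0 : y.1 = 0) : y.2 = 0 := by
  refine Fock.ext_ae ?_
  have hy' : ∀ᵐ c : State, y.2.fn c = totalEnergy mₑ mμ e B c * y.1.fn c := hy
  rw [h0] at hy'
  filter_upwards [hy', Fock.fn_zero] with c h1 h2
  rw [h1, h2, Pi.zero_apply, mul_zero]

/-! ### Dirac matrices and spinors -/

/-- The Dirac matrices `γ^0, γ^1, γ^2, γ^3` in the standard representation: `γ^0` is diagonal with
blocks `1, -1`, and `γ^j` has the off-diagonal blocks `σ_j, -σ_j` with the Pauli matrices `σ_j`. -/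
def gammaUp : Fin 4 → Matrix (Fin 4) (Fin 4) ℂ
  | 0 => !![1, 0, 0, 0; 0, 1, 0, 0; 0, 0, -1, 0; 0, 0, 0, -1]
  | 1 => !![0, 0, 0, 1; 0, 0, 1, 0; 0, -1, 0, 0; -1, 0, 0, 0]
  | 2 => !![0, 0, 0, -Complex.I; 0, 0, Complex.I, 0; 0, Complex.I, 0, 0; -Complex.I, 0, 0, 0]
  | 3 => !![0, 0, 1, 0; 0, 0, 0, -1; -1, 0, 0, 0; 0, 1, 0, 0]

/-- The Dirac matrices with lower index, `γ_0 = γ^0` and `γ_j = -γ^j`. -/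
def gammaDown (α : Fin 4) : Matrix (Fin 4) (Fin 4) ℂ :=
  if α = 0 then gammaUp α else -gammaUp α

/-- `γ₅ = i γ^0 γ^1 γ^2 γ^3`. -/
def gamma5 : Matrix (Fin 4) (Fin 4) ℂ :=
  Complex.I • (gammaUp 0 * gammaUp 1 * gammaUp 2 * gammaUp 3)

/-- `Ū Γ (1 - γ₅) V` with `Ū = U† γ^0`. -/
def bracket (U : Fin 4 → ℂ) (Γ : Matrix (Fin 4) (Fin 4) ℂ) (V : Fin 4 → ℂ) : ℂ :=
  star U ⬝ᵥ ((gammaUp 0 * Γ * (1 - gamma5)) *ᵥ V)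

/-- The operator norm of a `4 × 4` matrix on `ℂ⁴` with the Hermitian norm. -/
def opNorm (A : Matrix (Fin 4) (Fin 4) ℂ) : ℝ := ‖Matrix.toEuclideanCLM (𝕜 := ℂ) A‖

/-- The constant `C = ∑_α ‖γ^0 γ_α (1 - γ₅)‖ ‖γ^0 γ^α (1 - γ₅)‖`, with the operator norms on
`ℂ⁴` and the sum over the repeated index `α` that the summation convention prescribes. -/
def constC : ℝ :=
  ∑ α : Fin 4, opNorm (gammaUp 0 * gammaDown α * (1 - gamma5)) *
    opNorm (gammaUp 0 * gammaUp α * (1 - gamma5))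

/-- The Hermite polynomials `H_n` with leading coefficient `2ⁿ`. -/
def physHermite : ℕ → Polynomial ℝ
  | 0 => 1
  | n + 1 => 2 * Polynomial.X * physHermite n - Polynomial.derivative (physHermite n)

/-- `I_n` as a function of `x²` and `p¹`, that is at `ξ = √(eB) (x² - p¹ / (eB))`. -/
def landauI (e B : ℝ) (n : ℕ) (x p₁ : ℝ) : ℝ :=
  let ξ := Real.sqrt (e * B) * (x - p₁ / (e * B))
  Real.sqrt (Real.sqrt (e * B) / (n.factorial * 2 ^ n * Real.sqrt Real.pi)) *
    Real.exp (-ξ ^ 2 / 2) * (physHermite n).eval ξ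

/-- `I_{n-1}`, with `I_{-1} = 0`. -/
def landauIPred (e B : ℝ) (n : ℕ) (x p₁ : ℝ) : ℝ :=
  match n with
  | 0 => 0
  | k + 1 => landauI e B k x p₁

/-- The spinors `U_s(x², n, p¹, p³)` of a particle of mass `m`. -/
def spinorU (m e B : ℝ) (x : ℝ) (ξ : Gamma1) : Fin 4 → ℂ :=
  let n := ξ.2.1
  let p₁ := ξ.2.2.1
  let p₃ := ξ.2.2.2
  let E := landauEnergy m e B ξ
  let N := Real.sqrt ((E + m) / (2 * E))
  let I₁ := landauI e B n x p₁
  let I₀ := landauIPred e B n x p₁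
  let k := Real.sqrt (2 * n * e * B)
  if ξ.1 then
    if n = 0 then 0
    else fun i => ((N * ![I₀, 0, p₃ / (E + m) * I₀, -(k / (E + m)) * I₁] i : ℝ) : ℂ)
  else fun i => ((N * ![0, I₁, -(k / (E + m)) * I₀, -(p₃ / (E + m)) * I₁] i : ℝ) : ℂ)

/-- The spinors `V_s(x², n, p¹, p³)` of a particle of mass `m`. -/
def spinorV (m e B : ℝ) (x : ℝ) (ξ : Gamma1) : Fin 4 → ℂ :=
  let n := ξ.2.1
  let p₁ := ξ.2.2.1
  let p₃ := ξ.2.2.2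
  let E := landauEnergy m e B ξ
  let N := Real.sqrt ((E + m) / (2 * E))
  let I₁ := landauI e B n x p₁
  let I₀ := landauIPred e B n x p₁
  let k := Real.sqrt (2 * n * e * B)
  if ξ.1 then
    if n = 0 then 0
    else fun i => ((N * ![-(p₃ / (E + m)) * I₀, k / (E + m) * I₁, I₀, 0] i : ℝ) : ℂ)
  else fun i => ((N * ![k / (E + m) * I₀, p₃ / (E + m) * I₁, 0, I₁] i : ℝ) : ℂ)

/-- `W(x², (s, n, p¹, p³)) = V_{-s}(x², n, -p¹, -p³)`. It vanishes for `(s, n) = (-1, 0)`. -/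
def spinorW (m e B : ℝ) (x : ℝ) (ξ : Gamma1) : Fin 4 → ℂ :=
  spinorV m e B x (!ξ.1, ξ.2.1, -ξ.2.2.1, -ξ.2.2.2)

/-- `h_-(𝐩)`. -/
def hMinus (p : Momentum) : Fin 2 → ℂ :=
  if ‖p‖ = p 2 then ![0, 1]
  else ((1 / Real.sqrt (2 * ‖p‖ * (‖p‖ - p 2)) : ℝ) : ℂ) •
    ![((p 2 - ‖p‖ : ℝ) : ℂ), (p 0 : ℂ) + Complex.I * (p 1 : ℂ)]

/-- `h_+(-𝐩)` as a function of `𝐩`. -/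
def hPlusNeg (p : Momentum) : Fin 2 → ℂ :=
  if ‖p‖ = -p 2 then ![1, 0]
  else ((1 / Real.sqrt (2 * ‖p‖ * (‖p‖ + p 2)) : ℝ) : ℂ) •
    ![-(p 0 : ℂ) + Complex.I * (p 1 : ℂ), ((‖p‖ + p 2 : ℝ) : ℂ)]

/-- The neutrino spinor `U^{(ν_μ)}(ξ₄) = (h_-(𝐩), -h_-(𝐩)) / √2`. -/
def spinorNu (p : Momentum) : Fin 4 → ℂ :=
  ((1 / Real.sqrt 2 : ℝ) : ℂ) • ![hMinus p 0, hMinus p 1, -hMinus p 0, -hMinus p 1]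

/-- The antineutrino spinor `W^{(ν̄_e)}(ξ₃) = (-h_+(-𝐩), h_+(-𝐩)) / √2`. -/
def spinorAntiNu (p : Momentum) : Fin 4 → ℂ :=
  ((1 / Real.sqrt 2 : ℝ) : ℂ) • ![-hPlusNeg p 0, -hPlusNeg p 1, hPlusNeg p 0, hPlusNeg p 1]

/-! ### Annihilation operators

`b(ξ)` acts on functions of the configuration by `(b(ξ) f)(c) = √(n + 1) f(ξ, c)`, where `n` is the
number of particles in `c` of the species concerned, with the sign `(-1)^k`, `k` being the number of
particles in `c` of the preceding species, which makes the operators of different species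
anticommute. -/

/-- Insert an electron. -/
def addE (ξ : Gamma1) (c : State) : State := (c.1.insert ξ, c.2)

/-- Insert a muon. -/
def addM (ξ : Gamma1) (c : State) : State := (c.1, c.2.1.insert ξ, c.2.2)

/-- Insert an antimuon. -/
def addP (ξ : Gamma1) (c : State) : State := (c.1, c.2.1, c.2.2.1.insert ξ, c.2.2.2)

/-- Insert a neutrino `ν_μ`. -/
def addN (p : Momentum) (c : State) : State :=
  (c.1, c.2.1, c.2.2.1, c.2.2.2.1.insert p, c.2.2.2.2)

/-- Insert an antineutrino `ν̄_e`. -/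
def addA (p : Momentum) (c : State) : State :=
  (c.1, c.2.1, c.2.2.1, c.2.2.2.1, c.2.2.2.2.insert p)

/-- `b_+(ξ₁)`, annihilation of an electron. -/
def annE (ξ : Gamma1) (f : State → ℂ) (c : State) : ℂ :=
  (Real.sqrt (c.1.1 + 1) : ℂ) * f (addE ξ c)

/-- `b_+(ξ₂)`, annihilation of a muon. -/
def annM (ξ : Gamma1) (f : State → ℂ) (c : State) : ℂ :=
  (-1) ^ c.1.1 * (Real.sqrt (c.2.1.1 + 1) : ℂ) * f (addM ξ c)

/-- `b_-(ξ₂)`, annihilation of an antimuon. -/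
def annP (ξ : Gamma1) (f : State → ℂ) (c : State) : ℂ :=
  (-1) ^ (c.1.1 + c.2.1.1) * (Real.sqrt (c.2.2.1.1 + 1) : ℂ) * f (addP ξ c)

/-- `b_+(ξ₄)`, annihilation of a neutrino `ν_μ`. -/
def annN (p : Momentum) (f : State → ℂ) (c : State) : ℂ :=
  (-1) ^ (c.1.1 + c.2.1.1 + c.2.2.1.1) * (Real.sqrt (c.2.2.2.1.1 + 1) : ℂ) * f (addN p c)

/-- `b_-(ξ₃)`, annihilation of an antineutrino `ν̄_e`. -/
def annA (p : Momentum) (f : State → ℂ) (c : State) : ℂ :=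
  (-1) ^ (c.1.1 + c.2.1.1 + c.2.2.1.1 + c.2.2.2.1.1) *
    (Real.sqrt (c.2.2.2.2.1 + 1) : ℂ) * f (addA p c)

/-! ### The interaction -/

/-- The coefficient functions `F(ξ₂, ξ₄)` and `G(ξ₁, ξ₃)` belong to this space. -/
abbrev Cutoff : Type := Lp ℂ 2 (volume : Measure (Gamma1 × Momentum))

/-- The kernel of `H_I^{(1)}` at `(ξ₁, ξ₂, ξ₃, ξ₄)`. -/
def kernel₁ (mₑ mμ e B : ℝ) (F G : Cutoff) (ξ₁ ξ₂ : Gamma1) (p₃ p₄ : Momentum) : ℂ :=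
  (∫ x : ℝ, Complex.exp (-(Complex.I * ((x * (p₃ 1 + p₄ 1) : ℝ) : ℂ))) *
    ∑ α : Fin 4, bracket (spinorNu p₄) (gammaUp α) (spinorU mμ e B x ξ₂) *
      bracket (spinorU mₑ e B x ξ₁) (gammaDown α) (spinorAntiNu p₃)) *
    F (ξ₂, p₄) * G (ξ₁, p₃)

/-- The kernel of `H_I^{(2)}` at `(ξ₁, ξ₂, ξ₃, ξ₄)`. -/
def kernel₂ (mₑ mμ e B : ℝ) (F G : Cutoff) (ξ₁ ξ₂ : Gamma1) (p₃ p₄ : Momentum) : ℂ :=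
  (∫ x : ℝ, Complex.exp (-(Complex.I * ((x * (p₃ 1 + p₄ 1) : ℝ) : ℂ))) *
    ∑ α : Fin 4, bracket (spinorNu p₄) (gammaDown α) (spinorW mμ e B x ξ₂) *
      bracket (spinorU mₑ e B x ξ₁) (gammaUp α) (spinorAntiNu p₃)) *
    F (ξ₂, p₄) * G (ξ₁, p₃)

/-- The integration variables `(ξ₁, ξ₂, ξ₃, ξ₄, c)` of the sesquilinear forms, `c` being the
configuration over which the inner product of `𝔉` integrates. -/
abbrev FormVar : Type := Gamma1 × Gamma1 × Momentum × Momentum × State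

set_option synthInstance.maxSize 1000 in
/-- The product measure on the integration variables. -/
instance instMeasureSpaceFormVar : MeasureSpace FormVar := Measure.prod.measureSpace

set_option synthInstance.maxSize 1000 in
instance instSFiniteFormVar : SFinite (volume : Measure FormVar) :=
  inferInstanceAs (SFinite (Measure.prod _ _))

/-- The integrand of `(ψ, H_I^{(1)} φ)`, that is of
`∫ dξ₁ dξ₂ dξ₃ dξ₄ K₁(ξ₁, ξ₂, ξ₃, ξ₄) (b_-(ξ₃) b_+(ξ₁) b_+(ξ₄) ψ, b_+(ξ₂) φ)`. -/
def integrand₁ (mₑ mμ e B : ℝ) (F G : Cutoff) (ψ φ : State → ℂ) (y : FormVar) : ℂ :=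
  kernel₁ mₑ mμ e B F G y.1 y.2.1 y.2.2.1 y.2.2.2.1 *
    (star (annA y.2.2.1 (annE y.1 (annN y.2.2.2.1 ψ)) y.2.2.2.2) *
      annM y.2.1 φ y.2.2.2.2)

/-- The integrand of `(ψ, H_I^{(2)} φ)`, that is of
`∫ dξ₁ dξ₂ dξ₃ dξ₄ K₂(ξ₁, ξ₂, ξ₃, ξ₄) (b_-(ξ₃) b_+(ξ₁) b_-(ξ₂) b_+(ξ₄) ψ, φ)`. -/
def integrand₂ (mₑ mμ e B : ℝ) (F G : Cutoff) (ψ φ : State → ℂ) (y : FormVar) : ℂ :=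
  kernel₂ mₑ mμ e B F G y.1 y.2.1 y.2.2.1 y.2.2.2.1 *
    (star (annA y.2.2.1 (annE y.1 (annP y.2.1 (annN y.2.2.2.1 ψ))) y.2.2.2.2) *
      φ y.2.2.2.2)

/-- Absolute convergence of the four integrals which make up `(ψ, H_I φ)`. -/
def FormConverges (mₑ mμ e B : ℝ) (F G : Cutoff) (ψ φ : State → ℂ) : Prop :=
  Integrable (integrand₁ mₑ mμ e B F G ψ φ) ∧ Integrable (integrand₁ mₑ mμ e B F G φ ψ) ∧
  Integrable (integrand₂ mₑ mμ e B F G ψ φ) ∧ Integrable (integrand₂ mₑ mμ e B F G φ ψ)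

/-- The sesquilinear form `(ψ, H_I φ)` of
`H_I = H_I^{(1)} + (H_I^{(1)})* + H_I^{(2)} + (H_I^{(2)})*`. -/
def interactionForm (mₑ mμ e B : ℝ) (F G : Cutoff) (ψ φ : State → ℂ) : ℂ :=
  (∫ y, integrand₁ mₑ mμ e B F G ψ φ y) + star (∫ y, integrand₁ mₑ mμ e B F G φ ψ y) +
    (∫ y, integrand₂ mₑ mμ e B F G ψ φ y) + star (∫ y, integrand₂ mₑ mμ e B F G φ ψ y)

/-- The total number of particles of a configuration. -/
def particleNumber (c : State) : ℕ := c.1.1 + c.2.1.1 + c.2.2.1.1 + c.2.2.2.1.1 + c.2.2.2.2.1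

/-- The vectors with boundedly many particles. -/
def IsFiniteParticle (ψ : State → ℂ) : Prop :=
  ∃ N : ℕ, ∀ᵐ c : State, N < particleNumber c → ψ c = 0

set_option synthInstance.maxSize 1000 in
/-- Successive insertions, as needed for the products of annihilation operators. -/
lemma quasiMeasurePreserving_chain {s₁ s₂ : Gamma1 × State → State}
    {s₃ s₄ : Momentum × State → State}
    (h₁ : Measure.QuasiMeasurePreserving s₁ volume volume)
    (h₂ : Measure.QuasiMeasurePreserving s₂ volume volume)
    (h₃ : Measure.QuasiMeasurePreserving s₃ volume volume)
    (h₄ : Measure.QuasiMeasurePreserving s₄ volume volume) :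
    Measure.QuasiMeasurePreserving (fun y : FormVar =>
      s₁ (y.1, s₂ (y.2.1, s₃ (y.2.2.1, s₄ (y.2.2.2.1, y.2.2.2.2))))) volume volume := by
  have i₁ := Measure.QuasiMeasurePreserving.id (volume : Measure Gamma1)
  have i₃ := Measure.QuasiMeasurePreserving.id (volume : Measure Momentum)
  have k₃ := h₃.comp (QuasiMeasurePreserving.prodMap i₃ h₄)
  have k₂ := h₂.comp (QuasiMeasurePreserving.prodMap i₁ k₃)
  exact h₁.comp (QuasiMeasurePreserving.prodMap i₁ k₂)

lemma quasiMeasurePreserving_insert_fst {X R : Type} [MeasureSpace X] [MeasureSpace R]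
    [SigmaFinite (volume : Measure X)] [SFinite (volume : Measure R)] :
    Measure.QuasiMeasurePreserving
      (fun y : X × (Conf X × R) => (y.2.1.insert y.1, y.2.2)) volume volume := by
  have h := (measurePreserving_prodAssoc (volume : Measure X) (volume : Measure (Conf X))
    (volume : Measure R)).symm
  exact (QuasiMeasurePreserving.prodMap (quasiMeasurePreserving_insert (X := X))
    (Measure.QuasiMeasurePreserving.id (volume : Measure R))).comp h.quasiMeasurePreserving

lemma quasiMeasurePreserving_skip {X A R : Type} [MeasureSpace X] [MeasureSpace A]
    [MeasureSpace R] [SFinite (volume : Measure X)] [SFinite (volume : Measure A)]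
    [SFinite (volume : Measure R)] {t : X × R → R}
    (ht : Measure.QuasiMeasurePreserving t volume volume) :
    Measure.QuasiMeasurePreserving
      (fun y : X × (A × R) => (y.2.1, t (y.1, y.2.2))) volume volume := by
  have h₁ := (measurePreserving_prodAssoc (volume : Measure X) (volume : Measure A)
    (volume : Measure R)).symm
  have h₂ := (Measure.measurePreserving_swap (μ := (volume : Measure X))
    (ν := (volume : Measure A))).prod (MeasurePreserving.id (volume : Measure R))
  have h₃ := measurePreserving_prodAssoc (volume : Measure A) (volume : Measure X)
    (volume : Measure R)
  exact (QuasiMeasurePreserving.prodMap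
    (Measure.QuasiMeasurePreserving.id (volume : Measure A)) ht).comp
    (h₃.comp (h₂.comp h₁)).quasiMeasurePreserving

set_option synthInstance.maxSize 1000 in
lemma quasiMeasurePreserving_addE :
    Measure.QuasiMeasurePreserving (fun y : Gamma1 × State => addE y.1 y.2) volume volume :=
  quasiMeasurePreserving_insert_fst

set_option synthInstance.maxSize 1000 in
lemma quasiMeasurePreserving_addM :
    Measure.QuasiMeasurePreserving (fun y : Gamma1 × State => addM y.1 y.2) volume volume :=
  quasiMeasurePreserving_skip quasiMeasurePreserving_insert_fst

set_option synthInstance.maxSize 1000 in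
lemma quasiMeasurePreserving_addP :
    Measure.QuasiMeasurePreserving (fun y : Gamma1 × State => addP y.1 y.2) volume volume :=
  quasiMeasurePreserving_skip (quasiMeasurePreserving_skip quasiMeasurePreserving_insert_fst)

set_option synthInstance.maxSize 1000 in
lemma quasiMeasurePreserving_addN :
    Measure.QuasiMeasurePreserving (fun y : Momentum × State => addN y.1 y.2) volume volume :=
  quasiMeasurePreserving_skip (quasiMeasurePreserving_skip (quasiMeasurePreserving_skip
    quasiMeasurePreserving_insert_fst))

set_option synthInstance.maxSize 1000 in
lemma quasiMeasurePreserving_addA :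
    Measure.QuasiMeasurePreserving (fun y : Momentum × State => addA y.1 y.2) volume volume :=
  quasiMeasurePreserving_skip (quasiMeasurePreserving_skip (quasiMeasurePreserving_skip
    (quasiMeasurePreserving_skip quasiMeasurePreserving_insert)))

set_option synthInstance.maxSize 1000 in
/-- The integrands depend only on the classes of `ψ` and `φ` modulo null sets. -/
lemma integrand₁_congr (mₑ mμ e B : ℝ) (F G : Cutoff) {ψ ψ' φ φ' : State → ℂ}
    (hψ : ψ =ᵐ[volume] ψ') (hφ : φ =ᵐ[volume] φ') :
    integrand₁ mₑ mμ e B F G ψ φ =ᵐ[volume] integrand₁ mₑ mμ e B F G ψ' φ' := by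
  have h₁ := (quasiMeasurePreserving_chain quasiMeasurePreserving_addE
    Measure.quasiMeasurePreserving_snd quasiMeasurePreserving_addA
    quasiMeasurePreserving_addN).ae hψ
  have h₂ := (quasiMeasurePreserving_chain Measure.quasiMeasurePreserving_snd
    quasiMeasurePreserving_addM Measure.quasiMeasurePreserving_snd
    Measure.quasiMeasurePreserving_snd).ae hφ
  filter_upwards [h₁, h₂] with y k₁ k₂
  have k₁' : ψ (addN y.2.2.2.1 (addE y.1 (addA y.2.2.1 y.2.2.2.2))) =
      ψ' (addN y.2.2.2.1 (addE y.1 (addA y.2.2.1 y.2.2.2.2))) := k₁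
  have k₂' : φ (addM y.2.1 y.2.2.2.2) = φ' (addM y.2.1 y.2.2.2.2) := k₂
  simp only [integrand₁, annA, annE, annN, annM, k₁', k₂']

set_option synthInstance.maxSize 1000 in
lemma integrand₂_congr (mₑ mμ e B : ℝ) (F G : Cutoff) {ψ ψ' φ φ' : State → ℂ}
    (hψ : ψ =ᵐ[volume] ψ') (hφ : φ =ᵐ[volume] φ') :
    integrand₂ mₑ mμ e B F G ψ φ =ᵐ[volume] integrand₂ mₑ mμ e B F G ψ' φ' := by
  have h₁ := (quasiMeasurePreserving_chain quasiMeasurePreserving_addE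
    quasiMeasurePreserving_addP quasiMeasurePreserving_addA
    quasiMeasurePreserving_addN).ae hψ
  have h₂ := (quasiMeasurePreserving_chain Measure.quasiMeasurePreserving_snd
    Measure.quasiMeasurePreserving_snd Measure.quasiMeasurePreserving_snd
    Measure.quasiMeasurePreserving_snd).ae hφ
  filter_upwards [h₁, h₂] with y k₁ k₂
  have k₁' : ψ (addN y.2.2.2.1 (addP y.2.1 (addE y.1 (addA y.2.2.1 y.2.2.2.2)))) =
      ψ' (addN y.2.2.2.1 (addP y.2.1 (addE y.1 (addA y.2.2.1 y.2.2.2.2)))) := k₁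
  have k₂' : φ y.2.2.2.2 = φ' y.2.2.2.2 := k₂
  simp only [integrand₂, annA, annE, annN, annP, k₁', k₂']

/-- If the form integrals converge for `(ψ, φ)` and `(ψ, φ')`, they converge for `ψ` and
`a φ + φ'`, and the form is linear in its second argument. -/
lemma interactionForm_linear (mₑ mμ e B : ℝ) (F G : Cutoff) (ψ φ φ' χ : State → ℂ) (a : ℂ)
    (hχ : χ =ᵐ[volume] a • φ + φ')
    (h : FormConverges mₑ mμ e B F G ψ φ) (h' : FormConverges mₑ mμ e B F G ψ φ') :
    FormConverges mₑ mμ e B F G ψ χ ∧ interactionForm mₑ mμ e B F G ψ χ =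
      a * interactionForm mₑ mμ e B F G ψ φ + interactionForm mₑ mμ e B F G ψ φ' := by
  obtain ⟨a₁, a₂, a₃, a₄⟩ := h
  obtain ⟨b₁, b₂, b₃, b₄⟩ := h'
  have r : ψ =ᵐ[volume] ψ := Filter.EventuallyEq.rfl
  have e₁ : integrand₁ mₑ mμ e B F G ψ χ =ᵐ[volume] fun y =>
      a * integrand₁ mₑ mμ e B F G ψ φ y + integrand₁ mₑ mμ e B F G ψ φ' y :=
    (integrand₁_congr mₑ mμ e B F G r hχ).trans <| Filter.Eventually.of_forall fun y => by
      simp only [integrand₁, annM, Pi.add_apply, Pi.smul_apply, smul_eq_mul]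
      ring
  have e₂ : integrand₁ mₑ mμ e B F G χ ψ =ᵐ[volume] fun y =>
      star a * integrand₁ mₑ mμ e B F G φ ψ y + integrand₁ mₑ mμ e B F G φ' ψ y :=
    (integrand₁_congr mₑ mμ e B F G hχ r).trans <| Filter.Eventually.of_forall fun y => by
      simp only [integrand₁, annA, annE, annN, Pi.add_apply, Pi.smul_apply, smul_eq_mul,
        star_mul', star_add]
      ring
  have e₃ : integrand₂ mₑ mμ e B F G ψ χ =ᵐ[volume] fun y =>
      a * integrand₂ mₑ mμ e B F G ψ φ y + integrand₂ mₑ mμ e B F G ψ φ' y :=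
    (integrand₂_congr mₑ mμ e B F G r hχ).trans <| Filter.Eventually.of_forall fun y => by
      simp only [integrand₂, Pi.add_apply, Pi.smul_apply, smul_eq_mul]
      ring
  have e₄ : integrand₂ mₑ mμ e B F G χ ψ =ᵐ[volume] fun y =>
      star a * integrand₂ mₑ mμ e B F G φ ψ y + integrand₂ mₑ mμ e B F G φ' ψ y :=
    (integrand₂_congr mₑ mμ e B F G hχ r).trans <| Filter.Eventually.of_forall fun y => by
      simp only [integrand₂, annA, annE, annN, annP, Pi.add_apply, Pi.smul_apply, smul_eq_mul,
        star_mul', star_add]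
      ring
  refine ⟨⟨((a₁.const_mul a).add b₁).congr e₁.symm,
    ((a₂.const_mul (star a)).add b₂).congr e₂.symm,
    ((a₃.const_mul a).add b₃).congr e₃.symm,
    ((a₄.const_mul (star a)).add b₄).congr e₄.symm⟩, ?_⟩
  unfold interactionForm
  rw [integral_congr_ae e₁, integral_congr_ae e₂, integral_congr_ae e₃, integral_congr_ae e₄,
    integral_add (a₁.const_mul a) b₁, integral_add (a₂.const_mul (star a)) b₂,
    integral_add (a₃.const_mul a) b₃, integral_add (a₄.const_mul (star a)) b₄,
    integral_const_mul, integral_const_mul, integral_const_mul, integral_const_mul]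
  simp only [star_add, star_mul', star_star]
  ring

/-- `H_I φ = η`, in the sense that the form integrals `(ψ, H_I φ)` converge absolutely and equal
`(ψ, η)`, for all finite particle vectors `ψ` in `𝔉`. -/
def RepresentsForm (mₑ mμ e B : ℝ) (F G : Cutoff) (φ η : Fock) : Prop :=
  ∀ ψ : Fock, IsFiniteParticle ψ.fn →
    FormConverges mₑ mμ e B F G ψ.fn φ.fn ∧ interactionForm mₑ mμ e B F G ψ.fn φ.fn = inner ℂ ψ η

lemma representsForm_zero (mₑ mμ e B : ℝ) (F G : Cutoff) :
    RepresentsForm mₑ mμ e B F G 0 0 := by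
  intro ψ hψ
  have h0 : ((0 : Fock).fn : State → ℂ) =ᵐ[volume] (0 : State → ℂ) :=
    Fock.fn_zero
  have z₁ : integrand₁ mₑ mμ e B F G ψ.fn 0 = 0 := by
    funext y; simp [integrand₁, annM]
  have z₂ : integrand₁ mₑ mμ e B F G 0 ψ.fn = 0 := by
    funext y; simp [integrand₁, annA, annE, annN]
  have z₃ : integrand₂ mₑ mμ e B F G ψ.fn 0 = 0 := by
    funext y; simp [integrand₂]
  have z₄ : integrand₂ mₑ mμ e B F G 0 ψ.fn = 0 := by
    funext y; simp [integrand₂, annA, annE, annN, annP]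
  have hz : FormConverges mₑ mμ e B F G ψ.fn 0 := by
    refine ⟨?_, ?_, ?_, ?_⟩
    · rw [z₁]; exact integrable_zero _ _ _
    · rw [z₂]; exact integrable_zero _ _ _
    · rw [z₃]; exact integrable_zero _ _ _
    · rw [z₄]; exact integrable_zero _ _ _
  have hv : interactionForm mₑ mμ e B F G ψ.fn 0 = 0 := by
    simp [interactionForm, z₁, z₂, z₃, z₄]
  obtain ⟨k₁, k₂⟩ := interactionForm_linear mₑ mμ e B F G ψ.fn 0 0 _ 0
    (h0.trans (by simp)) hz hz
  refine ⟨k₁, k₂.trans ?_⟩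
  rw [hv, inner_zero_right]
  simp

lemma representsForm_add (mₑ mμ e B : ℝ) (F G : Cutoff) {φ φ' η η' : Fock}
    (h : RepresentsForm mₑ mμ e B F G φ η) (h' : RepresentsForm mₑ mμ e B F G φ' η') :
    RepresentsForm mₑ mμ e B F G (φ + φ') (η + η') := by
  intro ψ hψ
  have hc : ((φ + φ' : Fock).fn : State → ℂ) =ᵐ[volume] (1 : ℂ) • φ.fn + φ'.fn := by
    rw [one_smul]
    exact Fock.fn_add φ φ'
  obtain ⟨k₁, k₂⟩ := interactionForm_linear mₑ mμ e B F G ψ.fn φ.fn φ'.fn _ 1 hc (h ψ hψ).1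
    (h' ψ hψ).1
  refine ⟨k₁, k₂.trans ?_⟩
  rw [(h ψ hψ).2, (h' ψ hψ).2, one_mul, inner_add_right]

lemma representsForm_smul (mₑ mμ e B : ℝ) (F G : Cutoff) (a : ℂ) {φ η : Fock}
    (h : RepresentsForm mₑ mμ e B F G φ η) : RepresentsForm mₑ mμ e B F G (a • φ) (a • η) := by
  intro ψ hψ
  have hc : ((a • φ : Fock).fn : State → ℂ) =ᵐ[volume] (a - 1) • φ.fn + φ.fn := by
    filter_upwards [Fock.fn_smul a φ] with c h1
    rw [h1, Pi.smul_apply, smul_eq_mul, Pi.add_apply, Pi.smul_apply, smul_eq_mul]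
    ring
  obtain ⟨k₁, k₂⟩ := interactionForm_linear mₑ mμ e B F G ψ.fn φ.fn φ.fn _ (a - 1) hc (h ψ hψ).1
    (h ψ hψ).1
  refine ⟨k₁, k₂.trans ?_⟩
  rw [(h ψ hψ).2, inner_smul_right]
  ring

/-- The graph of the interaction: the pairs `(φ, η)` in `𝔉 × 𝔉` with `H_I φ = η`. -/
def interactionGraph (mₑ mμ e B : ℝ) (F G : Cutoff) : Submodule ℂ (Fock × Fock) where
  carrier := {y | RepresentsForm mₑ mμ e B F G y.1 y.2}
  zero_mem' := representsForm_zero mₑ mμ e B F G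
  add_mem' := fun hy hz => representsForm_add mₑ mμ e B F G hy hz
  smul_mem' := fun a _ hy => representsForm_smul mₑ mμ e B F G a hy

/-- The interaction `H_I`, the closed operator associated with the form `(ψ, H_I φ)`. -/
def interaction (mₑ mμ e B : ℝ) (F G : Cutoff) : Fock →ₗ.[ℂ] Fock :=
  (interactionGraph mₑ mμ e B F G).toLinearPMap

lemma measurable_particleNumber : Measurable particleNumber := by
  have h : ∀ X : Type, ∀ [MeasurableSpace X], Measurable (fun c : Conf X => c.1) := by
    intro X _
    exact measurable_of_sectors fun n => measurable_const
  unfold particleNumber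
  exact (((((h _).comp measurable_fst).add ((h _).comp (by fun_prop))).add
    ((h _).comp (by fun_prop))).add ((h _).comp (by fun_prop))).add ((h _).comp (by fun_prop))

/-- A vector of `𝔉` which is orthogonal to all finite particle vectors vanishes. -/
lemma eq_zero_of_inner_finiteParticle (η : Fock)
    (h : ∀ ψ : Fock, IsFiniteParticle ψ.fn → inner ℂ ψ η = 0) : η = 0 := by
  have key : ∀ N : ℕ, ∀ᵐ c : State, particleNumber c ≤ N → η.fn c = 0 := by
    intro N
    have hs : MeasurableSet {c : State | particleNumber c ≤ N} :=
      measurable_particleNumber measurableSet_Iic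
    have hm := η.memLp.indicator hs
    have hcoe := hm.coeFn_toLp
    have hanti : IsAntisymm (hm.toLp _) := by
      intro σ
      filter_upwards [hcoe, (quasiMeasurePreserving_permState σ).ae hcoe, η.antisymm σ]
        with c h1 h2 h3
      rw [h1, h2]
      by_cases hc : c ∈ {c : State | particleNumber c ≤ N}
      · have hc' : permState σ c ∈ {c : State | particleNumber c ≤ N} := hc
        rw [Set.indicator_of_mem hc, Set.indicator_of_mem hc', h3]
      · have hc' : permState σ c ∉ {c : State | particleNumber c ≤ N} := hc
        rw [Set.indicator_of_notMem hc, Set.indicator_of_notMem hc', mul_zero]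
    obtain ⟨ψ, hψ⟩ : ∃ ψ : Fock, ψ.fn =ᵐ[volume]
        {c : State | particleNumber c ≤ N}.indicator η.fn := ⟨_, Fock.fn_mk _ hm hanti⟩
    have h0 := h ψ ⟨N, by
      filter_upwards [hψ] with c h1 hc
      rw [h1]
      have hc' : c ∉ {c : State | particleNumber c ≤ N} := not_le.2 hc
      rw [Set.indicator_of_notMem hc']⟩
    have h1 : inner ℂ ψ ψ = (0 : ℂ) := by
      rw [← h0, Fock.inner_eq, Fock.inner_eq]
      refine integral_congr_ae ?_
      filter_upwards [hψ] with c h1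
      rw [h1]
      by_cases hc : c ∈ {c : State | particleNumber c ≤ N}
      · rw [Set.indicator_of_mem hc]
      · rw [Set.indicator_of_notMem hc, inner_zero_left, inner_zero_left]
    rw [inner_self_eq_zero] at h1
    rw [h1] at hψ
    filter_upwards [hψ, Fock.fn_zero] with c k1 k2 hc
    rw [k2, Set.indicator_of_mem (show c ∈ {c : State | particleNumber c ≤ N} from hc)] at k1
    exact k1.symm
  refine Fock.ext_ae ?_
  filter_upwards [ae_all_iff.2 key, Fock.fn_zero] with c k1 k2
  rw [k2, k1 _ le_rfl, Pi.zero_apply]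

/-- The graph of `H_I` is single valued, so that `interaction` has exactly this graph. -/
lemma interactionGraph_functional (mₑ mμ e B : ℝ) (F G : Cutoff) (y : Fock × Fock)
    (hy : y ∈ interactionGraph mₑ mμ e B F G) (h0 : y.1 = 0) : y.2 = 0 := by
  refine eq_zero_of_inner_finiteParticle y.2 fun ψ hψ => ?_
  have hy' : RepresentsForm mₑ mμ e B F G y.1 y.2 := hy
  rw [← (hy' ψ hψ).2, h0, (representsForm_zero mₑ mμ e B F G ψ hψ).2, inner_zero_right]

/-- The total Hamiltonian `H = H₀ + g H_I`, on the intersection of the domains of `H₀` and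
`H_I`. -/
def hamiltonian (mₑ mμ e B : ℝ) (F G : Cutoff) (g : ℝ) : Fock →ₗ.[ℂ] Fock :=
  freeHamiltonian mₑ mμ e B + (g : ℂ) • interaction mₑ mμ e B F G

end MuonDecay

end

/-!
# Self-adjointness of the Hamiltonian for the decay of muons

The theorem is an instance of the Kato–Rellich theorem (`LinearPMap.katoRellich`), which is proved
here for `LinearPMap`s together with the statement on cores. Its hypotheses are that `H₀` is
symmetric with `H₀ + it` onto for all real `t ≠ 0`, which is clear for a multiplication operator,
and that on the domain of `H₀` the interaction is symmetric and satisfies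

`‖H_I φ‖ ≤ 4 C ‖F‖ ‖G‖ ((1 / mₑ + 1 / mμ) ‖H₀ φ‖ + ‖φ‖)`.

This relative bound comes from an estimate of the form `(ψ, H_I φ)` for `ψ` with boundedly many
particles (`MuonDecay.form_estimate`), from which the vector `H_I φ` is obtained by the theorems of
Hahn–Banach and Riesz. The form is a sum of four integrals, and each of them is treated as follows.

* The neutrinos have no mass, so that their number is not controlled by `H₀`. What saves the
  estimate is that they are fermions: `‖b(f) θ‖ ≤ ‖f‖ ‖θ‖` for square integrable `f`
  (`MuonDecay.pauli_sector`, `MuonDecay.lintegral_annihilate_le`), and therefore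
  `|∫ f(p₄) g(p₃) (b(p₃) b(p₄) θ, η) dp₃ dp₄| ≤ ‖f‖ ‖g‖ ‖θ‖ ‖η‖`
  (`MuonDecay.enorm_integral_annPair_le`).
* The kernels are not products `f(p₄) g(p₃)`, but integrals over `x²` of sums of four such products.
  The Landau spinors have norm at most one in `L²` as functions of `x²`, so that by the
  Cauchy–Schwarz inequality the integral over `x²` contributes only the constant `C`
  (`MuonDecay.enorm_integral_superposition_le`).
* The estimates so far are for fixed quantum numbers of the charged leptons. The integral over
  these is again estimated by the Cauchy–Schwarz inequality
  (`MuonDecay.integrable_superposition_annPair`). The factors `√n` that come with the annihilation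
  of charged leptons are all attributed to the vector `φ` in the domain of `H₀`, where they are at
  most `(1 / mₑ + 1 / mμ) H₀ + 1`, each charged lepton having at least the energy `mₑ` or `mμ`.

Absolute convergence of the integrals is needed to reorder them, and holds as one of the two vectors
has boundedly many particles (`MuonDecay.lintegral_annPair_le`). The Pauli principle is applied for
each value of the other variables, and therefore to representatives of the vectors which are
antisymmetric everywhere (`MuonDecay.Fock.exists_representative`).
-/

open MeasureTheory Matrix Filter Topology
open scoped ENNReal

noncomputable section

/-! ### The Kato–Rellich theorem -/

namespace LinearPMap

variable {E : Type*} [NormedAddCommGroup E] [InnerProductSpace ℂ E]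

/-- A symmetric operator is self-adjoint if `A + z` and `A + z̄` are onto for some `z`. -/
theorem isSelfAdjoint_of_surjective [CompleteSpace E] {A : E →ₗ.[ℂ] E}
    (hd : Dense (A.domain : Set E)) (hA : A.IsFormalAdjoint A) (z : ℂ)
    (h₁ : ∀ y, ∃ x : A.domain, A x + z • (x : E) = y)
    (h₂ : ∀ y, ∃ x : A.domain, A x + star z • (x : E) = y) : IsSelfAdjoint A := by
  rw [isSelfAdjoint_def]
  have hle : A ≤ A† := hA.le_adjoint hd
  refine le_antisymm ?_ hle
  have hdom : ∀ φ : A†.domain, ∃ χ : A.domain, (φ : E) = χ := by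
    intro φ
    obtain ⟨χ, hχ⟩ := h₁ (A† φ + z • (φ : E))
    refine ⟨χ, ?_⟩
    refine ext_inner_left ℂ fun v => ?_
    obtain ⟨ψ, rfl⟩ := h₂ v
    have e₁ : inner ℂ (A ψ) (φ : E) = inner ℂ (ψ : E) (A† φ) := by
      have h := adjoint_isFormalAdjoint hd φ ψ
      rw [← inner_conj_symm, ← h, inner_conj_symm]
    have e₂ : inner ℂ (A ψ) (χ : E) = inner ℂ (ψ : E) (A χ) := hA ψ χ
    rw [inner_add_left, inner_add_left, inner_smul_left, inner_smul_left, e₁, e₂]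
    have h := congrArg (inner ℂ (ψ : E)) hχ
    rw [inner_add_right, inner_add_right, inner_smul_right, inner_smul_right] at h
    simpa using h.symm
  refine le_of_le_graph fun p hp => ?_
  obtain ⟨φ, h1, h2⟩ := (mem_graph_iff _).1 hp
  obtain ⟨χ, h3⟩ := hdom φ
  refine (mem_graph_iff _).2 ⟨χ, h3.symm.trans h1, ?_⟩
  rw [← h2]
  exact hle.2 h3.symm

/-- For symmetric `A` and real `t`, `‖A x + i t x‖² = ‖A x‖² + t² ‖x‖²`. -/
theorem IsFormalAdjoint.norm_sq_add_smul {A : E →ₗ.[ℂ] E} (hA : A.IsFormalAdjoint A) (t : ℝ)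
    (x : A.domain) :
    ‖A x + ((t : ℂ) * Complex.I) • (x : E)‖ ^ 2 = ‖A x‖ ^ 2 + t ^ 2 * ‖(x : E)‖ ^ 2 := by
  rw [norm_add_sq (𝕜 := ℂ), norm_smul, inner_smul_right]
  have him : (inner ℂ (A x) (x : E)).im = 0 := by
    have h : inner ℂ (A x) (x : E) = inner ℂ (x : E) (A x) := hA x x
    have h' := inner_conj_symm (𝕜 := ℂ) (A x) (x : E)
    rw [← h] at h'
    exact Complex.conj_eq_iff_im.1 h'
  have hre : RCLike.re ((t : ℂ) * Complex.I * inner ℂ (A x) (x : E)) = 0 := by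
    simp [him]
  rw [hre, norm_mul, Complex.norm_I, Complex.norm_real, mul_one, mul_pow, Real.norm_eq_abs,
    sq_abs]
  ring

/-- If `A` is symmetric with `A + it` onto and `V` is `A`-bounded with a relative bound which is
small at `t`, then `A + V + it` is onto: `y - V (A + it)⁻¹ y'` is a contraction in `y'`. -/
theorem surjective_add_of_relBounded [CompleteSpace E] {A V : E →ₗ.[ℂ] E} (hA : A.IsFormalAdjoint A)
    (hdom : A.domain ≤ V.domain) {a b t : ℝ} (ha : 0 ≤ a) (hb : 0 ≤ b) (ht : t ≠ 0)
    (hab : a + b / |t| < 1)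
    (hV : ∀ x : A.domain, ‖V ⟨x, hdom x.2⟩‖ ≤ a * ‖A x‖ + b * ‖(x : E)‖)
    (hsurj : ∀ y, ∃ x : A.domain, A x + ((t : ℂ) * Complex.I) • (x : E) = y) (y : E) :
    ∃ x : A.domain, A x + V ⟨x, hdom x.2⟩ + ((t : ℂ) * Complex.I) • (x : E) = y := by
  choose R hR using hsurj
  have hbd : ∀ x : A.domain, ‖V ⟨x, hdom x.2⟩‖ ≤
      (a + b / |t|) * ‖A x + ((t : ℂ) * Complex.I) • (x : E)‖ := by
    intro x
    have h := hA.norm_sq_add_smul t x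
    set w := ‖A x + ((t : ℂ) * Complex.I) • (x : E)‖
    have h1 : ‖A x‖ ≤ w := by
      refine le_of_sq_le_sq ?_ (norm_nonneg _)
      nlinarith [mul_nonneg (sq_nonneg t) (sq_nonneg ‖(x : E)‖)]
    have h2 : |t| * ‖(x : E)‖ ≤ w := by
      refine le_of_sq_le_sq ?_ (norm_nonneg _)
      rw [mul_pow, sq_abs]
      nlinarith [sq_nonneg ‖A x‖]
    have h3 : ‖(x : E)‖ ≤ w / |t| := by
      rw [le_div_iff₀ (abs_pos.2 ht)]; linarith
    calc ‖V ⟨x, hdom x.2⟩‖ ≤ a * ‖A x‖ + b * ‖(x : E)‖ := hV x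
      _ ≤ a * w + b * (w / |t|) := by gcongr
      _ = (a + b / |t|) * w := by ring
  let k : NNReal := ⟨a + b / |t|, by positivity⟩
  have hk : k < 1 := by exact_mod_cast hab
  let f : E → E := fun y' => y - V ⟨R y', hdom (R y').2⟩
  have hf : ContractingWith k f := by
    refine ⟨hk, LipschitzWith.of_dist_le_mul fun u v => ?_⟩
    rw [dist_eq_norm, dist_eq_norm]
    have e : f u - f v = V ⟨(R v - R u : A.domain), hdom (R v - R u).2⟩ := by
      have : (⟨(R v - R u : A.domain), hdom (R v - R u).2⟩ : V.domain) =
        ⟨R v, hdom (R v).2⟩ - ⟨R u, hdom (R u).2⟩ := by ext; simp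
      rw [this, map_sub]
      simp only [f]
      abel
    rw [e]
    refine (hbd _).trans ?_
    have e2 : A (R v - R u) + ((t : ℂ) * Complex.I) • ((R v - R u : A.domain) : E) = v - u := by
      rw [map_sub, Submodule.coe_sub, smul_sub, ← hR v, ← hR u, hR v, hR u]
      nth_rewrite 3 [← hR v]
      nth_rewrite 3 [← hR u]
      abel
    rw [e2, norm_sub_rev]
    rfl
  refine ⟨R (hf.fixedPoint f), ?_⟩
  have h1 : f (hf.fixedPoint f) = hf.fixedPoint f := hf.fixedPoint_isFixedPt
  have h2 := hR (hf.fixedPoint f)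
  simp only [f] at h1
  rw [add_right_comm, h2]
  nth_rewrite 1 [← h1]
  abel

/-- The **Kato–Rellich theorem**, with stability of cores. Self-adjointness of `A` enters through
symmetry and surjectivity of `A + it`. -/
theorem katoRellich [CompleteSpace E] {A V : E →ₗ.[ℂ] E} (hd : Dense (A.domain : Set E))
    (hA : A.IsFormalAdjoint A)
    (hsurj : ∀ t : ℝ, t ≠ 0 → ∀ y, ∃ x : A.domain, A x + ((t : ℂ) * Complex.I) • (x : E) = y)
    (hdom : A.domain ≤ V.domain)
    (hsymm : ∀ x y : A.domain,
      inner ℂ (V ⟨x, hdom x.2⟩) (y : E) = inner ℂ (x : E) (V ⟨y, hdom y.2⟩))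
    {a b : ℝ} (ha : 0 ≤ a) (ha1 : a < 1) (hb : 0 ≤ b)
    (hV : ∀ x : A.domain, ‖V ⟨x, hdom x.2⟩‖ ≤ a * ‖A x‖ + b * ‖(x : E)‖) :
    (A + V).domain = A.domain ∧ IsSelfAdjoint (A + V) ∧
      ∀ S : Submodule ℂ E, A.HasCore S → (A + V).HasCore S := by
  have hD : (A + V).domain = A.domain := by
    rw [add_domain]
    exact inf_eq_left.2 hdom
  have hval : ∀ x : A.domain, ∃ x' : (A + V).domain, (x' : E) = x ∧
      (A + V) x' = A x + V ⟨x, hdom x.2⟩ := by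
    intro x
    exact ⟨⟨x, hD.ge x.2⟩, rfl, rfl⟩
  have hval' : ∀ x' : (A + V).domain, ∃ x : A.domain, (x' : E) = x ∧
      (A + V) x' = A x + V ⟨x, hdom x.2⟩ := fun x' => ⟨⟨x', hD ▸ x'.2⟩, rfl, rfl⟩
  obtain ⟨t, ht0, ht⟩ : ∃ t : ℝ, 0 < t ∧ a + b / t < 1 := by
    refine ⟨(b + 1) / (1 - a), by have := sub_pos.2 ha1; positivity, ?_⟩
    have h1 : 0 < 1 - a := sub_pos.2 ha1
    have h2 : b / ((b + 1) / (1 - a)) < 1 - a := by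
      rw [div_div_eq_mul_div, div_lt_iff₀ (by positivity)]
      nlinarith
    linarith
  have hsa : IsSelfAdjoint (A + V) := by
    refine isSelfAdjoint_of_surjective (by rw [hD]; exact hd) ?_ ((t : ℂ) * Complex.I) ?_ ?_
    · intro x y
      obtain ⟨x₀, hx, hx'⟩ := hval' x
      obtain ⟨y₀, hy, hy'⟩ := hval' y
      rw [hx', hy', hx, hy, inner_add_left, inner_add_right, hsymm]
      congr 1
      exact hA x₀ y₀
    · intro y
      obtain ⟨x, hx⟩ := surjective_add_of_relBounded hA hdom ha hb ht0.ne'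
        (by rwa [abs_of_pos ht0]) hV (hsurj t ht0.ne') y
      obtain ⟨x', h1, h2⟩ := hval x
      exact ⟨x', by rw [h1, h2, hx]⟩
    · intro y
      obtain ⟨x, hx⟩ := surjective_add_of_relBounded hA hdom ha hb (neg_ne_zero.2 ht0.ne')
        (by rwa [abs_neg, abs_of_pos ht0]) hV (hsurj (-t) (neg_ne_zero.2 ht0.ne')) y
      obtain ⟨x', h1, h2⟩ := hval x
      refine ⟨x', ?_⟩
      rw [h1, h2, ← hx]
      simp
  refine ⟨hD, hsa, fun S hS => ?_⟩
  have hcl : (A + V).IsClosed := hsa.isClosed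
  have hSD : S ≤ (A + V).domain := hS.le_domain.trans hD.ge
  refine ⟨hSD, ?_⟩
  have hle : (A + V).domRestrict S ≤ A + V := domRestrict_le
  have hclos := hcl.isClosable
  have hclS : ((A + V).domRestrict S).IsClosable := hclos.leIsClosable hle
  refine le_antisymm ?_ ?_
  · refine le_of_le_graph ?_
    rw [← hclS.graph_closure_eq_closure_graph]
    exact Submodule.topologicalClosure_minimal _ (le_graph_of_le hle) hcl
  · refine le_of_le_graph fun p hp => ?_
    rw [← hclS.graph_closure_eq_closure_graph]
    obtain ⟨x', h1, h2⟩ := (mem_graph_iff _).1 hp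
    obtain ⟨x, hx, hx'⟩ := hval' x'
    -- `(x, A x)` is a limit of `(u, A u)` with `u` in the core
    have hmem : ((x : E), A x) ∈ (A.domRestrict S).graph.topologicalClosure := by
      by_cases hc : (A.domRestrict S).IsClosable
      · rw [hc.graph_closure_eq_closure_graph, hS.closure_eq]
        exact mem_graph A x
      · refine Submodule.le_topologicalClosure _ ?_
        have := hS.closure_eq
        rw [closure_def' hc] at this
        rw [this]
        exact mem_graph A x
    rw [← SetLike.mem_coe, Submodule.topologicalClosure_coe, mem_closure_iff_seq_limit] at hmem ⊢
    obtain ⟨u, hu, hlim⟩ := hmem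
    have hu' : ∀ n, ∃ w : A.domain, (w : E) ∈ S ∧ (w : E) = (u n).1 ∧ A w = (u n).2 := by
      intro n
      obtain ⟨w, hw1, hw2⟩ := (mem_graph_iff _).1 (hu n)
      exact ⟨⟨w, w.2.2⟩, w.2.1, hw1, hw2⟩
    choose w hwS hw1 hw2 using hu'
    have l1 : Tendsto (fun n => (w n : E)) atTop (𝓝 (x : E)) := by
      simp_rw [hw1]
      exact (continuous_fst.tendsto _).comp hlim
    have l2 : Tendsto (fun n => A (w n)) atTop (𝓝 (A x)) := by
      simp_rw [hw2]
      exact (continuous_snd.tendsto _).comp hlim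
    have l3 : Tendsto (fun n => V ⟨w n, hdom (w n).2⟩) atTop (𝓝 (V ⟨x, hdom x.2⟩)) := by
      rw [tendsto_iff_norm_sub_tendsto_zero]
      have l1' := tendsto_iff_norm_sub_tendsto_zero.1 l1
      have l2' := tendsto_iff_norm_sub_tendsto_zero.1 l2
      have l := (l2'.const_mul a).add (l1'.const_mul b)
      rw [mul_zero, mul_zero, add_zero] at l
      refine squeeze_zero (fun n => norm_nonneg _) (fun n => ?_) l
      have h := hV (w n - x)
      have e : (⟨(w n - x : A.domain), hdom (w n - x).2⟩ : V.domain) =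
        ⟨w n, hdom (w n).2⟩ - ⟨x, hdom x.2⟩ := by ext; simp
      rw [e, map_sub, map_sub] at h
      exact h
    refine ⟨fun n => ((w n : E), A (w n) + V ⟨w n, hdom (w n).2⟩), fun n => ?_, ?_⟩
    · obtain ⟨w', k1, k2⟩ := hval (w n)
      refine (mem_graph_iff _).2 ⟨⟨w', ⟨by rw [k1]; exact hwS n, w'.2⟩⟩, k1, ?_⟩
      exact (hle.2 rfl).trans k2
    · have hp' : p = ((x : E), A x + V ⟨x, hdom x.2⟩) := by
        refine Prod.ext ?_ ?_
        · rw [← h1, hx]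
        · rw [← h2, hx']
      rw [hp']
      exact l1.prodMk_nhds (l2.add l3)

end LinearPMap

namespace MuonDecay

/-! ### Square integrals and the Cauchy–Schwarz inequality -/

section SquareIntegrals

variable {α : Type*} [MeasurableSpace α] {μ : Measure α}

/-- The Cauchy–Schwarz inequality for a function which is pointwise bounded by the geometric
mean of two others. -/
lemma sq_lintegral_le {j a b : α → ℝ≥0∞} (ha : AEMeasurable a μ) (hb : AEMeasurable b μ)
    (h : ∀ᵐ z ∂μ, j z ^ 2 ≤ a z * b z) :
    (∫⁻ z, j z ∂μ) ^ 2 ≤ (∫⁻ z, a z ∂μ) * ∫⁻ z, b z ∂μ := by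
  have sq : ∀ x : ℝ≥0∞, (x ^ (1 / 2 : ℝ)) ^ (2 : ℝ) = x := fun x => by
    rw [← ENNReal.rpow_mul]; norm_num
  have hj : ∫⁻ z, j z ∂μ ≤
      ∫⁻ z, ((fun z => a z ^ (1 / 2 : ℝ)) * fun z => b z ^ (1 / 2 : ℝ)) z ∂μ := by
    refine lintegral_mono_ae ?_
    filter_upwards [h] with z hz
    rw [Pi.mul_apply, ← ENNReal.mul_rpow_of_nonneg _ _ (by norm_num)]
    calc j z = (j z ^ 2) ^ (1 / 2 : ℝ) := by
          rw [← ENNReal.rpow_two, ← ENNReal.rpow_mul]; norm_num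
      _ ≤ _ := ENNReal.rpow_le_rpow hz (by norm_num)
  have h2 := hj.trans (ENNReal.lintegral_mul_le_Lp_mul_Lq μ Real.HolderConjugate.two_two
    (ha.pow_const _) (hb.pow_const _))
  simp_rw [sq] at h2
  calc (∫⁻ z, j z ∂μ) ^ 2 ≤ _ := pow_le_pow_left' h2 2
    _ = _ := by
      rw [mul_pow, ← ENNReal.rpow_two, ← ENNReal.rpow_two, sq, sq]

lemma lintegral_enorm_sq_eq (f : α → ℂ) : eLpNorm f 2 μ ^ 2 = ∫⁻ x, ‖f x‖ₑ ^ 2 ∂μ := by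
  have h := eLpNorm_nnreal_pow_eq_lintegral (μ := μ) (f := f) (p := 2) two_ne_zero
  simpa using h

lemma memLp_two_of_lintegral {f : α → ℂ} (hf : AEStronglyMeasurable f μ)
    (h : ∫⁻ x, ‖f x‖ₑ ^ 2 ∂μ ≠ ∞) : MemLp f 2 μ := by
  refine ⟨hf, ?_⟩
  rw [← lintegral_enorm_sq_eq] at h
  exact lt_top_iff_ne_top.2 fun h' => h (by rw [h']; rfl)

lemma ofReal_norm_toLp_sq {f : α → ℂ} (hf : MemLp f 2 μ) :
    ENNReal.ofReal (‖hf.toLp f‖ ^ 2) = ∫⁻ x, ‖f x‖ₑ ^ 2 ∂μ := by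
  rw [Lp.norm_toLp, ← lintegral_enorm_sq_eq, ENNReal.ofReal_pow ENNReal.toReal_nonneg,
    ENNReal.ofReal_toReal hf.2.ne]

/-- Pythagoras: `f` splits orthogonally into its component along the unit vector `ḡ` and the
rest. -/
lemma lintegral_sub_add_eq {f g : α → ℂ} (hf : MemLp f 2 μ) (hg : MemLp g 2 μ)
    (hg1 : ∫⁻ x, ‖g x‖ₑ ^ 2 ∂μ = 1) :
    (∫⁻ x, ‖f x - star (g x) * ∫ y, g y * f y ∂μ‖ₑ ^ 2 ∂μ) + ‖∫ y, g y * f y ∂μ‖ₑ ^ 2 =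
      ∫⁻ x, ‖f x‖ₑ ^ 2 ∂μ := by
  set c := ∫ y, g y * f y ∂μ
  have hs : MemLp (fun x => star (g x)) 2 μ := hg.star
  have hr : MemLp (fun x => f x - star (g x) * c) 2 μ := by
    have := hf.sub (hs.const_mul c)
    refine this.congr_norm (hf.1.sub (hs.1.mul_const c)) (Eventually.of_forall fun x => ?_)
    simp only [Pi.sub_apply, mul_comm]
  have hin : inner ℂ (hs.toLp _) (hf.toLp f) = c := by
    rw [L2.inner_def]
    refine integral_congr_ae ?_
    filter_upwards [hs.coeFn_toLp, hf.coeFn_toLp] with x h1 h2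
    rw [h1, h2]
    simp [mul_comm]
  have hn : ‖hs.toLp (fun x => star (g x))‖ ^ 2 = 1 := by
    have h := ofReal_norm_toLp_sq hs
    have e : ∫⁻ x, ‖star (g x)‖ₑ ^ 2 ∂μ = 1 := by
      rw [← hg1]; simp [enorm_eq_nnnorm]
    rw [e] at h
    exact ENNReal.ofReal_eq_one.1 h
  have hsub : hr.toLp (fun x => f x - star (g x) * c) = hf.toLp f - c • hs.toLp _ := by
    refine Lp.ext ?_
    filter_upwards [hr.coeFn_toLp, hf.coeFn_toLp, hs.coeFn_toLp, Lp.coeFn_sub (hf.toLp f)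
      (c • hs.toLp _), Lp.coeFn_smul c (hs.toLp _)] with x h1 h2 h3 h4 h5
    rw [h1, h4, Pi.sub_apply, h5, Pi.smul_apply, h2, h3, smul_eq_mul, mul_comm]
  have key : ‖hr.toLp (fun x => f x - star (g x) * c)‖ ^ 2 + ‖c‖ ^ 2 = ‖hf.toLp f‖ ^ 2 := by
    have hin' : inner ℂ (hf.toLp f) (hs.toLp _) = star c := by
      rw [← inner_conj_symm, hin]; rfl
    rw [hsub, norm_sub_sq (𝕜 := ℂ), inner_smul_right, hin', norm_smul, mul_pow, hn]
    have : RCLike.re (c * star c) = ‖c‖ ^ 2 := by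
      rw [show star c = (starRingEnd ℂ) c from rfl, RCLike.mul_conj]
      norm_cast
    rw [this]
    ring
  rw [← ofReal_norm_toLp_sq hr, ← ofReal_norm_toLp_sq hf, ← key,
    ENNReal.ofReal_add (by positivity) (by positivity), ENNReal.ofReal_pow (norm_nonneg c),
    ofReal_norm]

end SquareIntegrals

/-! ### The Pauli principle -/

section Pauli

variable {X : Type} [MeasureSpace X] [SigmaFinite (volume : Measure X)]

/-- Antisymmetry of a function of `n` variables, at every point. -/
def AntisymmFn {n : ℕ} (θ : (Fin n → X) → ℂ) : Prop :=
  ∀ (σ : Equiv.Perm (Fin n)) (x : Fin n → X), θ (x ∘ σ) = ((Equiv.Perm.sign σ : ℤ) : ℂ) * θ x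

omit [MeasureSpace X] [SigmaFinite (volume : Measure X)] in
lemma AntisymmFn.cons {n : ℕ} {θ : (Fin (n + 1) → X) → ℂ} (h : AntisymmFn θ) (ξ : X) :
    AntisymmFn fun x : Fin n → X => θ (Fin.cons ξ x) := by
  intro σ x
  have e : (Fin.cons ξ (x ∘ σ) : Fin (n + 1) → X) =
      (Fin.cons ξ x : Fin (n + 1) → X) ∘ Equiv.Perm.decomposeFin.symm (0, σ) := by
    funext i
    refine Fin.cases ?_ (fun j => ?_) i
    · simp
    · simp
  have hs := Equiv.Perm.decomposeFin.symm_sign 0 σ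
  rw [if_pos rfl, one_mul] at hs
  change θ _ = _ * θ _
  rw [e, h, hs]

omit [MeasureSpace X] [SigmaFinite (volume : Measure X)] in
lemma AntisymmFn.swap {n : ℕ} {θ : (Fin (n + 2) → X) → ℂ} (h : AntisymmFn θ) (ξ η : X)
    (x : Fin n → X) : θ (Fin.cons ξ (Fin.cons η x)) = -θ (Fin.cons η (Fin.cons ξ x)) := by
  have e : (Fin.cons ξ (Fin.cons η x) : Fin (n + 2) → X) =
      (Fin.cons η (Fin.cons ξ x) : Fin (n + 2) → X) ∘ Equiv.swap 0 1 := by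
    funext i
    refine Fin.cases ?_ (fun j => Fin.cases ?_ (fun k => ?_) j) i
    · rw [Function.comp_apply, Equiv.swap_apply_left]
      rfl
    · rw [Function.comp_apply, show Fin.succ (0 : Fin (n + 1)) = 1 from rfl,
        Equiv.swap_apply_right]
      rfl
    · rw [Function.comp_apply, Equiv.swap_apply_of_ne_of_ne]
      · rfl
      · exact Fin.succ_ne_zero _
      · intro h'
        exact Fin.succ_ne_zero _ (Fin.succ_injective _ h')
  rw [e, h, Equiv.Perm.sign_swap (by simp)]
  simp

lemma measurePreserving_cons (n : ℕ) :
    MeasurePreserving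
      (fun y : X × (Fin n → X) => (Fin.cons y.1 y.2 : Fin (n + 1) → X)) volume volume := by
  have h := (volume_preserving_piFinSuccAbove (fun _ : Fin (n + 1) => X) 0).symm
  have he : (fun y : X × (Fin n → X) => (Fin.cons y.1 y.2 : Fin (n + 1) → X)) =
      (MeasurableEquiv.piFinSuccAbove (fun _ : Fin (n + 1) => X) 0).symm := by
    funext y
    exact (Fin.insertNth_zero (α := fun _ : Fin (n + 1) => X) y.1 y.2).symm
  rw [he]
  exact h

lemma measurable_contract {Y : Type*} [MeasurableSpace Y] {θ : X × Y → ℂ} (hθ : Measurable θ)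
    {g : X → ℂ} (hg : Measurable g) : Measurable fun y => ∫ ξ, g ξ * θ (ξ, y) := by
  have h : StronglyMeasurable fun p : Y × X => g p.2 * θ (p.2, p.1) :=
    ((hg.comp measurable_snd).mul (hθ.comp measurable_swap)).stronglyMeasurable
  exact h.integral_prod_right'.measurable

/-- For an antisymmetric function of two variables the contraction with `g ⊗ g` vanishes, so that
after the component along `ḡ` in the first variable has been removed, the contraction in the second
variable is still that of the original function. -/
lemma contract_antisymm {T : X × X → ℂ} (hT : Measurable T)
    (hT2 : ∫⁻ z, ‖T z‖ₑ ^ 2 ≠ ∞) (ha : ∀ ξ η, T (ξ, η) = -T (η, ξ)) {g : X → ℂ}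
    (hg : Measurable g) (hg2 : ∫⁻ x, ‖g x‖ₑ ^ 2 ≠ ∞) :
    ∀ᵐ ξ : X, ∫ η, g η * (T (ξ, η) - star (g ξ) * ∫ ζ, g ζ * T (ζ, η)) =
      -∫ ζ, g ζ * T (ζ, ξ) := by
  have hgL := memLp_two_of_lintegral hg.aestronglyMeasurable hg2
  have hgg : MemLp (fun z : X × X => g z.1 * g z.2) 2 volume := by
    refine memLp_two_of_lintegral
      ((hg.comp measurable_fst).mul (hg.comp measurable_snd)).aestronglyMeasurable ?_
    simp_rw [enorm_mul, mul_pow]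
    rw [show (volume : Measure (X × X)) = volume.prod volume from rfl,
      lintegral_prod_mul (f := fun x => ‖g x‖ₑ ^ 2) (g := fun x => ‖g x‖ₑ ^ 2)
      (by fun_prop) (by fun_prop)]
    exact ENNReal.mul_ne_top hg2 hg2
  have hTL := memLp_two_of_lintegral hT.aestronglyMeasurable hT2
  have hint : Integrable (fun z : X × X => g z.1 * g z.2 * T z) (volume.prod volume) :=
    hgg.integrable_mul hTL
  -- the double contraction changes sign under the exchange of the variables
  have hzero : ∫ η, ∫ ζ, g η * g ζ * T (ζ, η) = 0 := by
    have h1 : ∫ η, ∫ ζ, g η * g ζ * T (ζ, η) = -∫ η, ∫ ζ, g η * g ζ * T (η, ζ) := by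
      rw [← integral_neg]
      congr 1; funext η
      rw [← integral_neg]
      congr 1; funext ζ
      rw [ha ζ η]; ring
    have h2 := integral_integral_swap (f := fun η ζ => g η * g ζ * T (η, ζ)) hint
    have h3 : ∫ ζ, ∫ η, g η * g ζ * T (η, ζ) = ∫ η, ∫ ζ, g η * g ζ * T (ζ, η) := by
      congr 1; funext ζ; congr 1; funext η; ring
    rw [h2, h3] at h1
    exact self_eq_neg.1 h1
  have hint2 : Integrable (fun η => g η * ∫ ζ, g ζ * T (ζ, η)) := by
    have h := hint.integral_prod_right
    refine h.congr (Eventually.of_forall fun η => ?_)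
    change ∫ ζ, g ζ * g η * T (ζ, η) = g η * ∫ ζ, g ζ * T (ζ, η)
    rw [← integral_const_mul]
    congr 1; funext ζ; ring
  have hzero' : ∫ η, g η * ∫ ζ, g ζ * T (ζ, η) = 0 := by
    rw [← hzero]
    congr 1; funext η
    rw [← integral_const_mul]
    congr 1; funext ζ; ring
  have hfin : ∀ᵐ ξ : X, ∫⁻ η, ‖T (ξ, η)‖ₑ ^ 2 < ∞ := by
    refine ae_lt_top ?_ ?_
    · exact Measurable.lintegral_prod_right' (f := fun z : X × X => ‖T z‖ₑ ^ 2) (by fun_prop)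
    · rw [show (volume : Measure (X × X)) = volume.prod volume from rfl,
        lintegral_prod _ (by fun_prop)] at hT2
      exact hT2
  filter_upwards [hfin] with ξ hξ
  have hTξ : MemLp (fun η => T (ξ, η)) 2 volume :=
    memLp_two_of_lintegral (hT.comp measurable_prodMk_left).aestronglyMeasurable hξ.ne
  have i1 : Integrable fun η => g η * T (ξ, η) := hgL.integrable_mul hTξ
  have i2 : Integrable fun η => star (g ξ) * (g η * ∫ ζ, g ζ * T (ζ, η)) :=
    hint2.const_mul _
  calc ∫ η, g η * (T (ξ, η) - star (g ξ) * ∫ ζ, g ζ * T (ζ, η))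
      = ∫ η, (g η * T (ξ, η) - star (g ξ) * (g η * ∫ ζ, g ζ * T (ζ, η))) := by
        congr 1; funext η; ring
    _ = ∫ η, g η * T (ξ, η) := by
        rw [integral_sub i1 i2, integral_const_mul, hzero', mul_zero, sub_zero]
    _ = -∫ ζ, g ζ * T (ζ, ξ) := by
        rw [← integral_neg]
        congr 1; funext η
        rw [ha ξ η]; ring

lemma lintegral_cons {n : ℕ} {h : (Fin (n + 1) → X) → ℝ≥0∞} (hh : Measurable h) :
    ∫⁻ x, h x = ∫⁻ x : Fin n → X, ∫⁻ ξ : X, h (Fin.cons ξ x) := by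
  rw [← (measurePreserving_cons n).lintegral_comp hh]
  exact lintegral_prod_symm _ (hh.comp (measurePreserving_cons n).measurable).aemeasurable

/-- The **Pauli principle**: at most one of `n + 1` fermions is in the state `ḡ`, so that the
contraction of an antisymmetric function with the unit vector `ḡ` has at most the fraction
`1 / (n + 1)` of its square norm. The induction removes from `θ` its component along `ḡ` in the
first variable; the contraction of the remainder `θ'` in the second variable is, up to the sign,
that of `θ`. -/
theorem pauli_sector {g : X → ℂ} (hg : Measurable g) (hg1 : ∫⁻ x, ‖g x‖ₑ ^ 2 = 1) :
    ∀ (n : ℕ) (θ : (Fin (n + 1) → X) → ℂ), Measurable θ → AntisymmFn θ →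
      (n + 1 : ℝ≥0∞) * ∫⁻ x : Fin n → X, ‖∫ ξ, g ξ * θ (Fin.cons ξ x)‖ₑ ^ 2 ≤
        ∫⁻ x, ‖θ x‖ₑ ^ 2 := by
  intro n
  induction n with
  | zero =>
    intro θ hm _
    have hc := (measurePreserving_cons (X := X) 0).measurable
    rw [Nat.cast_zero, zero_add, one_mul, lintegral_cons (by fun_prop)]
    refine lintegral_mono fun x => ?_
    have hθ : Measurable fun ξ : X => θ (Fin.cons ξ x) :=
      hm.comp (hc.comp measurable_prodMk_right)
    rw [← one_mul (∫⁻ ξ : X, _), ← hg1]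
    refine (pow_le_pow_left' (enorm_integral_le_lintegral_enorm _) 2).trans ?_
    refine sq_lintegral_le (by fun_prop) (by fun_prop) (Eventually.of_forall fun z => ?_)
    rw [enorm_mul, mul_pow]
  | succ n ih =>
    intro θ hm ha
    by_cases hfin : ∫⁻ x, ‖θ x‖ₑ ^ 2 = ∞
    · rw [hfin]; exact le_top
    have hc := (measurePreserving_cons (X := X) (n + 1)).measurable
    have hc' := (measurePreserving_cons (X := X) n).measurable
    have hgL := memLp_two_of_lintegral hg.aestronglyMeasurable (hg1 ▸ ENNReal.one_ne_top)
    let u : (Fin (n + 1) → X) → ℂ := fun x => ∫ ξ, g ξ * θ (Fin.cons ξ x)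
    have hu : Measurable u := measurable_contract (hm.comp hc) hg
    let θ' : X → (Fin (n + 1) → X) → ℂ := fun ξ x => θ (Fin.cons ξ x) - star (g ξ) * u x
    have hθ' : Measurable fun y : X × (Fin (n + 1) → X) => θ' y.1 y.2 :=
      (hm.comp hc).sub ((continuous_star.measurable.comp (hg.comp measurable_fst)).mul
        (hu.comp measurable_snd))
    have hθξ : ∀ ξ, Measurable (θ' ξ) := fun ξ => hθ'.comp measurable_prodMk_left
    have hau : AntisymmFn u := by
      intro σ x
      change ∫ ξ, g ξ * θ (Fin.cons ξ (x ∘ σ)) = _ * ∫ ξ, g ξ * θ (Fin.cons ξ x)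
      rw [← integral_const_mul]
      congr 1; funext ξ
      have := ha.cons ξ σ x
      simp only at this
      rw [this]; ring
    have ha' : ∀ ξ, AntisymmFn (θ' ξ) := by
      intro ξ σ x
      have := ha.cons ξ σ x
      simp only at this
      simp only [θ', this, hau σ x]
      ring
    -- Pythagoras in the first variable
    have hpyth : (∫⁻ x : Fin (n + 1) → X, ∫⁻ ξ : X, ‖θ' ξ x‖ₑ ^ 2) + ∫⁻ x, ‖u x‖ₑ ^ 2 =
        ∫⁻ x, ‖θ x‖ₑ ^ 2 := by
      rw [lintegral_cons (h := fun x => ‖θ x‖ₑ ^ 2) (by fun_prop),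
        ← lintegral_add_right _ (by fun_prop)]
      have hae : ∀ᵐ x : Fin (n + 1) → X, ∫⁻ ξ : X, ‖θ (Fin.cons ξ x)‖ₑ ^ 2 < ∞ := by
        refine ae_lt_top ?_ ?_
        · exact Measurable.lintegral_prod_left'
            (f := fun y : X × (Fin (n + 1) → X) => ‖θ (Fin.cons y.1 y.2)‖ₑ ^ 2)
            ((hm.comp hc).enorm.pow_const 2)
        · rwa [← lintegral_cons (h := fun x => ‖θ x‖ₑ ^ 2) (by fun_prop)]
      refine lintegral_congr_ae ?_
      filter_upwards [hae] with x hx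
      exact lintegral_sub_add_eq (memLp_two_of_lintegral
        (hm.comp (hc.comp measurable_prodMk_right)).aestronglyMeasurable hx.ne) hgL hg1
    -- the contraction of `θ'` in the second variable
    have hcontr : ∀ᵐ x : Fin n → X, ∀ᵐ ξ : X,
        ∫ η, g η * θ' ξ (Fin.cons η x) = -u (Fin.cons ξ x) := by
      have hae : ∀ᵐ x : Fin n → X,
          ∫⁻ η : X, ∫⁻ ξ : X, ‖θ (Fin.cons ξ (Fin.cons η x))‖ₑ ^ 2 < ∞ := by
        have hm2 : Measurable fun y : X × (Fin (n + 1) → X) => ‖θ (Fin.cons y.1 y.2)‖ₑ ^ 2 :=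
          (hm.comp hc).enorm.pow_const 2
        have hm3 := hm2.lintegral_prod_left' (μ := volume)
        refine ae_lt_top ?_ ?_
        · exact Measurable.lintegral_prod_left' (f := fun y : X × (Fin n → X) =>
            ∫⁻ ξ : X, ‖θ (Fin.cons ξ (Fin.cons y.1 y.2))‖ₑ ^ 2) (hm3.comp hc')
        · rwa [lintegral_cons (h := fun x => ‖θ x‖ₑ ^ 2) (by fun_prop),
            lintegral_cons hm3] at hfin
      filter_upwards [hae] with x hx
      have hT : Measurable fun z : X × X => θ (Fin.cons z.1 (Fin.cons z.2 x)) :=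
        hm.comp (hc.comp (measurable_fst.prodMk
          (hc'.comp (measurable_snd.prodMk measurable_const))))
      refine contract_antisymm hT ?_ (fun ξ η => ha.swap ξ η x) hg (hg1 ▸ ENNReal.one_ne_top)
      rw [show (volume : Measure (X × X)) = volume.prod volume from rfl,
        lintegral_prod_symm _ (hT.enorm.pow_const 2).aemeasurable]
      exact hx.ne
    have hsecond : (n + 1 : ℝ≥0∞) * ∫⁻ x, ‖u x‖ₑ ^ 2 ≤
        ∫⁻ x : Fin (n + 1) → X, ∫⁻ ξ : X, ‖θ' ξ x‖ₑ ^ 2 := by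
      have hm3 : Measurable fun y : X × (Fin n → X) =>
          ∫ η, g η * θ' y.1 (Fin.cons η y.2) := by
        refine measurable_contract (Y := X × (Fin n → X))
          (θ := fun z => θ' z.2.1 (Fin.cons z.1 z.2.2)) ?_ hg
        exact hθ'.comp ((measurable_fst.comp measurable_snd).prodMk (hc'.comp
          (measurable_fst.prodMk (measurable_snd.comp measurable_snd))))
      calc (n + 1 : ℝ≥0∞) * ∫⁻ x, ‖u x‖ₑ ^ 2
          = (n + 1 : ℝ≥0∞) * ∫⁻ ξ : X, ∫⁻ x : Fin n → X,
              ‖∫ η, g η * θ' ξ (Fin.cons η x)‖ₑ ^ 2 := by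
            congr 1
            rw [lintegral_cons (h := fun x => ‖u x‖ₑ ^ 2) (by fun_prop),
              lintegral_lintegral_swap (f := fun ξ (x : Fin n → X) =>
                ‖∫ η, g η * θ' ξ (Fin.cons η x)‖ₑ ^ 2) (hm3.enorm.pow_const 2).aemeasurable]
            refine lintegral_congr_ae ?_
            filter_upwards [hcontr] with x hx
            refine lintegral_congr_ae ?_
            filter_upwards [hx] with ξ hξ
            rw [hξ, enorm_neg]
        _ = ∫⁻ ξ : X, (n + 1 : ℝ≥0∞) * ∫⁻ x : Fin n → X,
              ‖∫ η, g η * θ' ξ (Fin.cons η x)‖ₑ ^ 2 := by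
            rw [lintegral_const_mul]
            exact (hm3.enorm.pow_const 2).lintegral_prod_right'
        _ ≤ ∫⁻ ξ : X, ∫⁻ x : Fin (n + 1) → X, ‖θ' ξ x‖ₑ ^ 2 :=
            lintegral_mono fun ξ => ih (θ' ξ) (hθξ ξ) (ha' ξ)
        _ = _ := lintegral_lintegral_swap (hθ'.enorm.pow_const 2).aemeasurable
    rw [← hpyth]
    push_cast
    rw [add_mul, one_mul]
    exact add_le_add_left hsecond _

end Pauli

/-! ### Annihilation of fermions in normalizable states -/

section Annihilation

variable {X : Type} [MeasureSpace X] [SigmaFinite (volume : Measure X)]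

/-- Antisymmetry of a function of configurations of one species, at every point. -/
def AntisymmConf (θ : Conf X → ℂ) : Prop :=
  ∀ n : ℕ, AntisymmFn fun x : Fin n → X => θ ⟨n, x⟩

omit [SigmaFinite (volume : Measure X)] in
lemma lintegral_conf {h : Conf X → ℝ≥0∞} (hh : Measurable h) :
    ∫⁻ c, h c = ∑' n : ℕ, ∫⁻ x : Fin n → X, h ⟨n, x⟩ := by
  change ∫⁻ c, h c ∂(Measure.sum fun n =>
    (volume : Measure (Fin n → X)).map fun x => (⟨n, x⟩ : Conf X)) = _
  rw [lintegral_sum_measure]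
  congr 1; funext n
  rw [lintegral_map hh (measurable_sector n)]

lemma measurable_insert : Measurable fun y : X × Conf X => Conf.insert y.1 y.2 :=
  quasiMeasurePreserving_insert.measurable

lemma measurable_fst_conf {X : Type} [MeasurableSpace X] : Measurable fun c : Conf X => c.1 :=
  measurable_of_sectors fun _ => measurable_const

lemma lintegral_prod_conf {Y : Type*} [MeasurableSpace Y] (μ : Measure Y) [SFinite μ]
    {h : Y × Conf X → ℝ≥0∞} (hh : Measurable h) :
    ∫⁻ y, h y ∂(μ.prod volume) = ∑' n : ℕ, ∫⁻ x : Fin n → X, ∫⁻ y, h (y, ⟨n, x⟩) ∂μ := by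
  rw [lintegral_prod_symm _ hh.aemeasurable, lintegral_conf]
  exact hh.lintegral_prod_left'

/-- The image of the product measure under the insertion of a particle is the restriction of the
measure on configurations to those with at least one particle. -/
lemma map_insert_le :
    (volume : Measure (X × Conf X)).map (fun y => Conf.insert y.1 y.2) ≤ volume := by
  refine Measure.le_intro fun s hs _ => ?_
  rw [← lintegral_indicator_one hs, ← lintegral_indicator_one hs,
    lintegral_map (measurable_one.indicator hs) measurable_insert]
  set h : Conf X → ℝ≥0∞ := s.indicator 1
  have hh : Measurable h := measurable_one.indicator hs
  rw [show (volume : Measure (X × Conf X)) = volume.prod volume from rfl,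
    lintegral_prod_conf volume (h := fun y : X × Conf X => h (y.2.insert y.1))
      (hh.comp measurable_insert), lintegral_conf hh]
  refine le_trans (le_of_eq ?_) (ENNReal.tsum_comp_le_tsum_of_injective Nat.succ_injective _)
  congr 1; funext n
  exact (lintegral_cons (h := fun x : Fin (n + 1) → X => h ⟨n + 1, x⟩)
    (hh.comp (measurable_sector _))).symm

/-- The Pauli principle for a state `ḡ` which need not be normalized. -/
lemma pauli_sector' {g : X → ℂ} (hg : Measurable g) (hg2 : ∫⁻ x, ‖g x‖ₑ ^ 2 ≠ ∞) (n : ℕ)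
    {θ : (Fin (n + 1) → X) → ℂ} (hm : Measurable θ) (ha : AntisymmFn θ) :
    (n + 1 : ℝ≥0∞) * ∫⁻ x : Fin n → X, ‖∫ ξ, g ξ * θ (Fin.cons ξ x)‖ₑ ^ 2 ≤
      (∫⁻ x, ‖g x‖ₑ ^ 2) * ∫⁻ x, ‖θ x‖ₑ ^ 2 := by
  by_cases h0 : ∫⁻ x, ‖g x‖ₑ ^ 2 = 0
  · have hz : ∀ᵐ ξ, g ξ = 0 := by
      rw [lintegral_eq_zero_iff (by fun_prop)] at h0
      filter_upwards [h0] with ξ hξ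
      simpa using hξ
    have : ∀ x : Fin n → X, ∫ ξ, g ξ * θ (Fin.cons ξ x) = 0 := by
      intro x
      refine integral_eq_zero_of_ae ?_
      filter_upwards [hz] with ξ hξ
      simp [hξ]
    simp [this]
  · set r := ∫⁻ x, ‖g x‖ₑ ^ 2 with hr
    have hr0 : 0 < r.toReal := ENNReal.toReal_pos h0 hg2
    set t : ℝ := Real.sqrt r.toReal with ht
    have ht0 : 0 < t := Real.sqrt_pos.2 hr0
    have ht2 : ‖(t : ℂ)‖ₑ ^ 2 = r := by
      rw [← ofReal_norm, ← ENNReal.ofReal_pow (norm_nonneg _), Complex.norm_real,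
        Real.norm_eq_abs, sq_abs, ht, Real.sq_sqrt hr0.le, ENNReal.ofReal_toReal hg2]
    have htC : (t : ℂ) ≠ 0 := by exact_mod_cast ht0.ne'
    have hg' : ∫⁻ x, ‖(t : ℂ)⁻¹ * g x‖ₑ ^ 2 = 1 := by
      simp_rw [enorm_mul, mul_pow]
      rw [lintegral_const_mul _ (by fun_prop), ← hr, enorm_inv htC, ← ENNReal.inv_pow, ht2,
        ENNReal.inv_mul_cancel h0 hg2]
    have h := pauli_sector (g := fun x => (t : ℂ)⁻¹ * g x) (by fun_prop) hg' n θ hm ha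
    have e : ∀ x : Fin n → X, ‖∫ ξ, g ξ * θ (Fin.cons ξ x)‖ₑ ^ 2 =
        r * ‖∫ ξ, (t : ℂ)⁻¹ * g ξ * θ (Fin.cons ξ x)‖ₑ ^ 2 := by
      intro x
      rw [← ht2, ← mul_pow, ← enorm_mul, ← integral_const_mul]
      congr 3; funext ξ
      field_simp
    simp_rw [e]
    rw [lintegral_const_mul, mul_left_comm]
    · gcongr
    · exact (measurable_contract (θ := fun y : X × (Fin n → X) => θ (Fin.cons y.1 y.2))
        (hm.comp (measurePreserving_cons n).measurable) (by fun_prop)).enorm.pow_const 2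

lemma enorm_sqrt_sq (n : ℕ) : ‖(Real.sqrt (n + 1) : ℂ)‖ₑ ^ 2 = (n + 1 : ℝ≥0∞) := by
  rw [← ofReal_norm, ← ENNReal.ofReal_pow (norm_nonneg _), Complex.norm_real, Real.norm_eq_abs,
    sq_abs, Real.sq_sqrt (by positivity), ENNReal.ofReal_add (by positivity) zero_le_one,
    ENNReal.ofReal_natCast, ENNReal.ofReal_one]

omit [SigmaFinite (volume : Measure X)] in
lemma measurable_sqrt_card :
    Measurable fun c : Conf X => (Real.sqrt (c.1 + 1) : ℂ) :=
  (measurable_of_countable fun n : ℕ => (Real.sqrt (n + 1) : ℂ)).comp measurable_fst_conf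

/-- `‖b(ḡ) θ‖ ≤ ‖g‖ ‖θ‖` for the fermionic annihilation operator of a normalizable state. -/
lemma lintegral_annihilate_le {g : X → ℂ} (hg : Measurable g) (hg2 : ∫⁻ x, ‖g x‖ₑ ^ 2 ≠ ∞)
    {θ : Conf X → ℂ} (hm : Measurable θ) (ha : AntisymmConf θ) :
    ∫⁻ c : Conf X, ‖(Real.sqrt (c.1 + 1) : ℂ) * ∫ ξ, g ξ * θ (c.insert ξ)‖ₑ ^ 2 ≤
      (∫⁻ x, ‖g x‖ₑ ^ 2) * ∫⁻ c, ‖θ c‖ₑ ^ 2 := by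
  have hmc : Measurable fun c : Conf X => ∫ ξ, g ξ * θ (c.insert ξ) :=
    measurable_contract (θ := fun y : X × Conf X => θ (y.2.insert y.1))
      (hm.comp measurable_insert) hg
  rw [lintegral_conf (h := fun c : Conf X =>
      ‖(Real.sqrt (c.1 + 1) : ℂ) * ∫ ξ, g ξ * θ (c.insert ξ)‖ₑ ^ 2)
      ((measurable_sqrt_card.mul hmc).enorm.pow_const 2),
    lintegral_conf (by fun_prop), ← ENNReal.tsum_mul_left]
  refine le_trans (ENNReal.tsum_le_tsum fun n => ?_)
    (ENNReal.tsum_comp_le_tsum_of_injective Nat.succ_injective _)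
  have h := pauli_sector' hg hg2 n (θ := fun x => θ ⟨n + 1, x⟩)
    (hm.comp (measurable_sector _)) (ha (n + 1))
  refine le_trans (le_of_eq ?_) h
  simp_rw [enorm_mul, mul_pow]
  simp only [enorm_sqrt_sq]
  rw [lintegral_const_mul]
  · rfl
  · exact (hmc.comp (measurable_sector n)).enorm.pow_const 2

omit [SigmaFinite (volume : Measure X)] in
lemma lintegral_star (μ : Measure X) (h : X → ℂ) :
    ∫⁻ x, ‖star (h x)‖ₑ ^ 2 ∂μ = ∫⁻ x, ‖h x‖ₑ ^ 2 ∂μ := by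
  simp [enorm_eq_nnnorm]

/-- The function `c ↦ √(n + 1) ∫ ḡ(p) θ(p, c) dp`, that is `b(g) θ`. -/
def annihilate (g : X → ℂ) (θ : Conf X → ℂ) (c : Conf X) : ℂ :=
  (Real.sqrt (c.1 + 1) : ℂ) * ∫ p, star (g p) * θ (c.insert p)

lemma lintegral_annihilate_le' {g : X → ℂ} (hg : Measurable g)
    (hg2 : ∫⁻ x, ‖g x‖ₑ ^ 2 ≠ ∞) {θ : Conf X → ℂ} (hm : Measurable θ) (ha : AntisymmConf θ) :
    ∫⁻ c : Conf X, ‖annihilate g θ c‖ₑ ^ 2 ≤ (∫⁻ x, ‖g x‖ₑ ^ 2) * ∫⁻ c, ‖θ c‖ₑ ^ 2 := by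
  have h := lintegral_annihilate_le (g := fun x => star (g x))
    (continuous_star.measurable.comp hg) (by rwa [lintegral_star]) hm ha
  rwa [lintegral_star] at h

lemma measurable_annihilate {Y : Type*} [MeasurableSpace Y] {g : X → ℂ} (hg : Measurable g)
    {θ : Y → Conf X → ℂ} (hm : Measurable fun y : Y × Conf X => θ y.1 y.2) :
    Measurable fun y : Y × Conf X => annihilate g (θ y.1) y.2 := by
  refine (measurable_sqrt_card.comp measurable_snd).mul (measurable_contract
    (θ := fun y : X × Y × Conf X => θ y.2.1 (y.2.2.insert y.1)) ?_
    (continuous_star.measurable.comp hg))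
  exact hm.comp (f := fun y : X × Y × Conf X => (y.2.1, y.2.2.insert y.1))
    (Measurable.prodMk (by fun_prop) (measurable_insert.comp
      (f := fun y : X × Y × Conf X => (y.1, y.2.2)) (by fun_prop)))

lemma AntisymmConf.annihilate {X Y : Type} [MeasureSpace Y] {g : Y → ℂ} {θ : Conf Y → Conf X → ℂ}
    (ha : ∀ d, AntisymmConf (θ d)) (d : Conf Y) :
    AntisymmConf fun c => annihilate g (fun d => θ d c) d := by
  intro n σ x
  have h := fun p => ha (d.insert p) n σ x
  simp only at h
  simp only [MuonDecay.annihilate, h]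
  rw [← integral_const_mul, ← integral_const_mul, ← integral_const_mul]
  congr 1; funext p; ring

/-- `b(p₃) b(p₄) θ` for a function `θ` of the configurations of two species, `b(p₄)` acting on the
first and `b(p₃)` on the second species, without the signs. -/
def annPair (θ : Conf X × Conf X → ℂ) (p₃ p₄ : X) (c : Conf X × Conf X) : ℂ :=
  (Real.sqrt (c.2.1 + 1) : ℂ) * (Real.sqrt (c.1.1 + 1) : ℂ) *
    θ (c.1.insert p₄, c.2.insert p₃)

/-- Antisymmetry in the particles of each of two species, at every point. -/
def AntisymmPair (θ : Conf X × Conf X → ℂ) : Prop :=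
  (∀ c, AntisymmConf fun c' => θ (c', c)) ∧ ∀ c, AntisymmConf fun c' => θ (c, c')

lemma measurable_insert_pair : Measurable fun y : X × X × Conf X × Conf X =>
    (y.2.2.1.insert y.2.1, y.2.2.2.insert y.1) := by
  refine Measurable.prodMk ?_ ?_
  · exact measurable_insert.comp (f := fun y : X × X × Conf X × Conf X => (y.2.1, y.2.2.1))
      (by fun_prop)
  · exact measurable_insert.comp (f := fun y : X × X × Conf X × Conf X => (y.1, y.2.2.2))
      (by fun_prop)

omit [SigmaFinite (volume : Measure X)] in
lemma measurable_weight_pair : Measurable fun c : Conf X × Conf X =>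
    (Real.sqrt (c.2.1 + 1) : ℂ) * (Real.sqrt (c.1.1 + 1) : ℂ) :=
  (measurable_sqrt_card.comp measurable_snd).mul (measurable_sqrt_card.comp measurable_fst)

lemma measurable_annPair {θ : Conf X × Conf X → ℂ} (hθ : Measurable θ) :
    Measurable fun y : X × X × Conf X × Conf X => annPair θ y.1 y.2.1 y.2.2 :=
  (measurable_weight_pair.comp (by fun_prop)).mul (hθ.comp measurable_insert_pair)

/-- Fubini's theorem for the two neutrino momenta. -/
lemma integral_annPair_eq {f g : X → ℂ} {θ η : Conf X × Conf X → ℂ}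
    (hint : Integrable fun y : X × X × Conf X × Conf X =>
      f y.2.1 * g y.1 * (star (annPair θ y.1 y.2.1 y.2.2) * η y.2.2)) :
    ∫ y : X × X × Conf X × Conf X,
      f y.2.1 * g y.1 * (star (annPair θ y.1 y.2.1 y.2.2) * η y.2.2) =
      ∫ c : Conf X × Conf X,
        star (annihilate f (fun c₁ => annihilate g (fun c₂ => θ (c₁, c₂)) c.2) c.1) * η c := by
  rw [show (volume : Measure (X × X × Conf X × Conf X)) = volume.prod volume from rfl,
    integral_prod_symm _ hint]
  have hint' := hint.integral_prod_right
  rw [show (volume : Measure (X × Conf X × Conf X)) = volume.prod volume from rfl] at hint' ⊢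
  rw [integral_prod_symm _ hint']
  congr 1; funext c
  have e : ∀ p₄, ∫ p₃, f p₄ * g p₃ * (star (annPair θ p₃ p₄ c) * η c) =
      star (star (f p₄) * annihilate g (fun c' => θ (c.1.insert p₄, c')) c.2) *
        (star (Real.sqrt (c.1.1 + 1) : ℂ) * η c) := by
    intro p₄
    simp only [annihilate]
    rw [star_mul', star_star, star_mul', show star (∫ p, star (g p) * θ (c.1.insert p₄,
      c.2.insert p)) = ∫ p, star (star (g p) * θ (c.1.insert p₄, c.2.insert p)) from
      integral_conj.symm]
    rw [mul_assoc, mul_assoc, ← integral_mul_const, ← integral_const_mul, ← integral_const_mul]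
    congr 1; funext p
    simp only [annPair, star_mul', star_star]
    ring
  simp only
  simp_rw [e]
  rw [integral_mul_const,
    show ∫ p, star (star (f p) * annihilate g (fun c' => θ (c.1.insert p, c')) c.2) =
    star (∫ p, star (f p) * annihilate g (fun c' => θ (c.1.insert p, c')) c.2) from integral_conj]
  simp only [annihilate, star_mul']
  ring

lemma measurable_uncurry_swap {A B C : Type*} [MeasurableSpace A] [MeasurableSpace B]
    [MeasurableSpace C] (F : A → B → C) (h : Measurable fun c : A × B => F c.1 c.2) :
    Measurable fun c : B × A => F c.2 c.1 :=
  h.comp measurable_swap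

lemma measurable_section {A B C : Type*} [MeasurableSpace A] [MeasurableSpace B]
    [MeasurableSpace C] (F : A → B → C) (h : Measurable fun c : A × B => F c.1 c.2) (b : B) :
    Measurable fun a => F a b :=
  h.comp measurable_prodMk_right

lemma lintegral_uncurry_swap {A B : Type*} [MeasureSpace A] [MeasureSpace B]
    [SFinite (volume : Measure A)] [SFinite (volume : Measure B)] (F : A → B → ℂ)
    (h : Measurable fun c : A × B => F c.1 c.2) :
    ∫⁻ c : B × A, ‖F c.2 c.1‖ₑ ^ 2 = ∫⁻ a, ∫⁻ b, ‖F a b‖ₑ ^ 2 :=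
  lintegral_prod_symm _ ((measurable_uncurry_swap F h).enorm.pow_const 2).aemeasurable

lemma measurable_annihilate_pair {f g : X → ℂ} (hf : Measurable f) (hg : Measurable g)
    {θ : Conf X × Conf X → ℂ} (hθ : Measurable θ) :
    Measurable fun c : Conf X × Conf X =>
      annihilate f (fun c₁ => annihilate g (fun c₂ => θ (c₁, c₂)) c.1) c.2 :=
  measurable_annihilate (θ := fun c₂ c₁ => annihilate g (fun c' => θ (c₁, c')) c₂) hf
    (measurable_uncurry_swap (fun c₁ c₂ => annihilate g (fun c' => θ (c₁, c')) c₂)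
      (measurable_annihilate (θ := fun c₁ c₂ => θ (c₁, c₂)) hg hθ))

lemma lintegral_annihilate_pair_le {f g : X → ℂ} (hf : Measurable f)
    (hf2 : ∫⁻ x, ‖f x‖ₑ ^ 2 ≠ ∞) (hg : Measurable g) (hg2 : ∫⁻ x, ‖g x‖ₑ ^ 2 ≠ ∞)
    {θ : Conf X × Conf X → ℂ} (hθ : Measurable θ) (ha : AntisymmPair θ) :
    ∫⁻ c : Conf X × Conf X,
      ‖annihilate f (fun c₁ => annihilate g (fun c₂ => θ (c₁, c₂)) c.2) c.1‖ₑ ^ 2 ≤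
      (∫⁻ x, ‖f x‖ₑ ^ 2) * ((∫⁻ x, ‖g x‖ₑ ^ 2) * ∫⁻ c, ‖θ c‖ₑ ^ 2) := by
  have hθ₁ : Measurable fun c : Conf X × Conf X => annihilate g (fun c' => θ (c.1, c')) c.2 :=
    measurable_annihilate (θ := fun c₁ c₂ => θ (c₁, c₂)) hg hθ
  have hn₁ : ∫⁻ c₁, ∫⁻ c₂, ‖annihilate g (fun c' => θ (c₁, c')) c₂‖ₑ ^ 2 ≤
      (∫⁻ x, ‖g x‖ₑ ^ 2) * ∫⁻ c, ‖θ c‖ₑ ^ 2 := by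
    have e : ∫⁻ c, ‖θ c‖ₑ ^ 2 = ∫⁻ c₁, ∫⁻ c₂, ‖θ (c₁, c₂)‖ₑ ^ 2 :=
      lintegral_prod _ (hθ.enorm.pow_const 2).aemeasurable
    rw [e, ← lintegral_const_mul _ (hθ.enorm.pow_const 2).lintegral_prod_right']
    exact lintegral_mono fun c₁ => lintegral_annihilate_le' hg hg2
      (hθ.comp measurable_prodMk_left) (ha.2 c₁)
  have hn₂ : ∫⁻ c₂, ∫⁻ c₁,
      ‖annihilate f (fun c => annihilate g (fun c' => θ (c, c')) c₂) c₁‖ₑ ^ 2 ≤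
      (∫⁻ x, ‖f x‖ₑ ^ 2) *
        ∫⁻ c₁, ∫⁻ c₂, ‖annihilate g (fun c' => θ (c₁, c')) c₂‖ₑ ^ 2 := by
    rw [lintegral_lintegral_swap
      (f := fun c₁ c₂ => ‖annihilate g (fun c' => θ (c₁, c')) c₂‖ₑ ^ 2)
      (hθ₁.enorm.pow_const 2).aemeasurable, ← lintegral_const_mul _
      (hθ₁.enorm.pow_const 2).lintegral_prod_left']
    exact lintegral_mono fun c₂ => lintegral_annihilate_le' hf hf2
      (measurable_section (fun c₁ c₂ => annihilate g (fun c' => θ (c₁, c')) c₂) hθ₁ c₂)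
      (AntisymmConf.annihilate (θ := fun c₂ c₁ => θ (c₁, c₂)) ha.1 c₂)
  have e := lintegral_uncurry_swap
    (fun c₂ c₁ => annihilate f (fun c => annihilate g (fun c' => θ (c, c')) c₂) c₁)
    (measurable_annihilate_pair hf hg hθ)
  exact e.le.trans (hn₂.trans (mul_le_mul_right hn₁ _))

/-- `|(b(f̄) b(ḡ) θ, η)| ≤ ‖f‖ ‖g‖ ‖θ‖ ‖η‖`. -/
lemma enorm_integral_annPair_le {f g : X → ℂ} (hf : Measurable f) (hf2 : ∫⁻ x, ‖f x‖ₑ ^ 2 ≠ ∞)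
    (hg : Measurable g) (hg2 : ∫⁻ x, ‖g x‖ₑ ^ 2 ≠ ∞) {θ η : Conf X × Conf X → ℂ}
    (hθ : Measurable θ) (ha : AntisymmPair θ) (hη : Measurable η)
    (hint : Integrable fun y : X × X × Conf X × Conf X =>
      f y.2.1 * g y.1 * (star (annPair θ y.1 y.2.1 y.2.2) * η y.2.2)) :
    ‖∫ y : X × X × Conf X × Conf X,
      f y.2.1 * g y.1 * (star (annPair θ y.1 y.2.1 y.2.2) * η y.2.2)‖ₑ ^ 2 ≤
      (∫⁻ x, ‖f x‖ₑ ^ 2) * ((∫⁻ x, ‖g x‖ₑ ^ 2) * ∫⁻ c, ‖θ c‖ₑ ^ 2) * ∫⁻ c, ‖η c‖ₑ ^ 2 := by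
  rw [integral_annPair_eq hint]
  have hm := measurable_uncurry_swap
    (fun c₂ c₁ => annihilate f (fun c => annihilate g (fun c' => θ (c, c')) c₂) c₁)
    (measurable_annihilate_pair hf hg hθ)
  have hb := lintegral_annihilate_pair_le hf hf2 hg hg2 hθ ha
  refine (pow_le_pow_left' (enorm_integral_le_lintegral_enorm _) 2).trans
    (le_trans ?_ (mul_le_mul_left hb _))
  refine sq_lintegral_le (hm.enorm.pow_const 2).aemeasurable
    (hη.enorm.pow_const 2).aemeasurable (Eventually.of_forall fun c => ?_)
  rw [enorm_mul, mul_pow]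
  simp [enorm_eq_nnnorm]

end Annihilation

/-! ### Maps which do not increase integrals -/

section Submersive

variable {α β γ : Type*} [MeasurableSpace α] [MeasurableSpace β] [MeasurableSpace γ]
  {μ : Measure α} {ν : Measure β} {ρ : Measure γ}

/-- A measurable map `f` whose image measure is at most the given measure on the target, expressed
by integrals. Insertions of particles have this property: they miss the configurations without
particles. -/
structure Subpreserving (f : α → β) (μ : Measure α) (ν : Measure β) : Prop where
  measurable : Measurable f
  lintegral_le : ∀ h : β → ℝ≥0∞, Measurable h → ∫⁻ x, h (f x) ∂μ ≤ ∫⁻ y, h y ∂ν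

lemma Subpreserving.of_measurePreserving {f : α → β} (hf : MeasurePreserving f μ ν) :
    Subpreserving f μ ν :=
  ⟨hf.measurable, fun _ hh => (hf.lintegral_comp hh).le⟩

lemma Subpreserving.id (μ : Measure α) : Subpreserving (fun x => x) μ μ :=
  ⟨measurable_id, fun _ _ => le_rfl⟩

lemma Subpreserving.comp {g : β → γ} {f : α → β} (hg : Subpreserving g ν ρ)
    (hf : Subpreserving f μ ν) : Subpreserving (fun x => g (f x)) μ ρ :=
  ⟨hg.measurable.comp hf.measurable, fun h hh =>
    (hf.lintegral_le (fun y => h (g y)) (hh.comp hg.measurable)).trans (hg.lintegral_le h hh)⟩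

lemma Subpreserving.prodMap {δ : Type*} [MeasurableSpace δ] {τ : Measure δ} [SFinite μ]
    [SFinite ν] [SFinite ρ] [SFinite τ] {f : α → β} {g : γ → δ} (hf : Subpreserving f μ ν)
    (hg : Subpreserving g ρ τ) :
    Subpreserving (fun z : α × γ => (f z.1, g z.2)) (μ.prod ρ) (ν.prod τ) := by
  have hm : Measurable fun z : α × γ => (f z.1, g z.2) :=
    (hf.measurable.comp measurable_fst).prodMk (hg.measurable.comp measurable_snd)
  refine ⟨hm, fun h hh => ?_⟩
  rw [lintegral_prod (fun z : α × γ => h (f z.1, g z.2)) (hh.comp hm).aemeasurable,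
    lintegral_prod _ hh.aemeasurable]
  calc ∫⁻ x, ∫⁻ y, h (f x, g y) ∂ρ ∂μ ≤ ∫⁻ x, ∫⁻ y, h (f x, y) ∂τ ∂μ :=
        lintegral_mono fun x => hg.lintegral_le (fun y => h (f x, y))
          (hh.comp measurable_prodMk_left)
    _ ≤ ∫⁻ x, ∫⁻ y, h (x, y) ∂τ ∂ν :=
        hf.lintegral_le (fun x => ∫⁻ y, h (x, y) ∂τ) hh.lintegral_prod_right'

variable {X : Type} [MeasureSpace X] [SigmaFinite (volume : Measure X)]

lemma subpreserving_insert :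
    Subpreserving (fun y : X × Conf X => y.2.insert y.1) volume volume :=
  ⟨measurable_insert, fun h hh => by
    rw [← lintegral_map hh measurable_insert]
    exact lintegral_mono' map_insert_le le_rfl⟩

lemma subpreserving_insert_fst {R : Type*} [MeasureSpace R] [SFinite (volume : Measure R)] :
    Subpreserving (fun y : X × (Conf X × R) => (y.2.1.insert y.1, y.2.2)) volume volume := by
  have h := (measurePreserving_prodAssoc (volume : Measure X) (volume : Measure (Conf X))
    (volume : Measure R)).symm
  exact ((subpreserving_insert (X := X)).prodMap (Subpreserving.id (volume : Measure R))).comp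
    (Subpreserving.of_measurePreserving h)

lemma measurePreserving_leftComm {X A R : Type*} [MeasureSpace X] [MeasureSpace A]
    [MeasureSpace R] [SFinite (volume : Measure X)] [SFinite (volume : Measure A)]
    [SFinite (volume : Measure R)] :
    MeasurePreserving (fun y : X × (A × R) => (y.2.1, (y.1, y.2.2))) volume volume := by
  have h₁ := (measurePreserving_prodAssoc (volume : Measure X) (volume : Measure A)
    (volume : Measure R)).symm
  have h₂ := (Measure.measurePreserving_swap (μ := (volume : Measure X))
    (ν := (volume : Measure A))).prod (MeasurePreserving.id (volume : Measure R))
  have h₃ := measurePreserving_prodAssoc (volume : Measure A) (volume : Measure X)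
    (volume : Measure R)
  exact h₃.comp (h₂.comp h₁)

lemma subpreserving_skip {X A R R' : Type*} [MeasureSpace X] [MeasureSpace A]
    [MeasureSpace R] [MeasureSpace R'] [SFinite (volume : Measure X)]
    [SFinite (volume : Measure A)] [SFinite (volume : Measure R)] [SFinite (volume : Measure R')]
    {t : X × R → R'} (ht : Subpreserving t volume volume) :
    Subpreserving (fun y : X × (A × R) => (y.2.1, t (y.1, y.2.2))) volume volume :=
  ((Subpreserving.id (volume : Measure A)).prodMap ht).comp
    (Subpreserving.of_measurePreserving measurePreserving_leftComm)

lemma subpreserving_insert_pair :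
    Subpreserving (fun y : X × X × Conf X × Conf X => (y.2.2.1.insert y.2.1, y.2.2.2.insert y.1))
      volume volume :=
  (subpreserving_skip (A := Conf X) (subpreserving_insert (X := X))).comp
    ((Subpreserving.id (volume : Measure X)).prodMap
      (subpreserving_insert_fst (X := X) (R := Conf X)))

end Submersive

/-! ### Superpositions of factorized kernels -/

section Superposition

variable {X : Type} [MeasureSpace X] [SigmaFinite (volume : Measure X)]

/-- The kernel `∫ dx ∑_α a_α(x, p₄) b_α(x, p₃)`. -/
def superposition (a b : Fin 4 → ℝ → X → ℂ) (p₃ p₄ : X) : ℂ :=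
  ∫ x, ∑ α, a α x p₄ * b α x p₃

variable {a b : Fin 4 → ℝ → X → ℂ} {A B : Fin 4 → ℝ≥0∞} {u v : ℝ → ℝ≥0∞}

lemma lintegral_mul_le_one (hu : Measurable u) (hv : Measurable v) (hu1 : ∫⁻ x, u x ^ 2 ≤ 1)
    (hv1 : ∫⁻ x, v x ^ 2 ≤ 1) : ∫⁻ x, u x * v x ≤ 1 := by
  have h := sq_lintegral_le (μ := volume) (j := fun x => u x * v x) (hu.pow_const 2).aemeasurable
    (hv.pow_const 2).aemeasurable (Eventually.of_forall fun x => (mul_pow _ _ _).le)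
  have h1 : (∫⁻ x, u x * v x) ^ 2 ≤ 1 ^ 2 := by
    rw [one_pow]
    exact h.trans (mul_le_one' hu1 hv1)
  exact (ENNReal.pow_le_pow_left_iff two_ne_zero).1 h1

omit [MeasureSpace X] [SigmaFinite (volume : Measure X)] in
lemma enorm_sum_mul_le (ha : ∀ α x p, ‖a α x p‖ₑ ≤ A α * u x)
    (hb : ∀ α x p, ‖b α x p‖ₑ ≤ B α * v x) (x : ℝ) (p₃ p₄ : X) :
    ‖∑ α, a α x p₄ * b α x p₃‖ₑ ≤ (∑ α, A α * B α) * (u x * v x) := by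
  refine (enorm_sum_le _ _).trans ?_
  rw [Finset.sum_mul]
  refine Finset.sum_le_sum fun α _ => ?_
  rw [enorm_mul]
  calc _ ≤ A α * u x * (B α * v x) := mul_le_mul' (ha α x p₄) (hb α x p₃)
    _ = _ := by ring

omit [MeasureSpace X] [SigmaFinite (volume : Measure X)] in
lemma enorm_superposition_le (ha : ∀ α x p, ‖a α x p‖ₑ ≤ A α * u x)
    (hb : ∀ α x p, ‖b α x p‖ₑ ≤ B α * v x) (hu : Measurable u) (hv : Measurable v)
    (hu1 : ∫⁻ x, u x ^ 2 ≤ 1) (hv1 : ∫⁻ x, v x ^ 2 ≤ 1) (p₃ p₄ : X) :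
    ‖superposition a b p₃ p₄‖ₑ ≤ ∑ α, A α * B α := by
  calc ‖superposition a b p₃ p₄‖ₑ ≤ ∫⁻ x, (∑ α, A α * B α) * (u x * v x) :=
        (enorm_integral_le_lintegral_enorm _).trans
          (lintegral_mono fun x => enorm_sum_mul_le ha hb x p₃ p₄)
    _ = (∑ α, A α * B α) * ∫⁻ x, u x * v x := lintegral_const_mul _ (hu.mul hv)
    _ ≤ (∑ α, A α * B α) * 1 := by gcongr; exact lintegral_mul_le_one hu hv hu1 hv1
    _ = _ := mul_one _

/-- A superposition of factorized kernels is estimated at each `x` by the Pauli principle; the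
integral over `x` costs nothing, as the factors depend on `x` through vectors of norm at
most one in `L²(ℝ)`. -/
lemma enorm_integral_superposition_le
    (ham : ∀ α, Measurable fun z : ℝ × X => a α z.1 z.2)
    (hbm : ∀ α, Measurable fun z : ℝ × X => b α z.1 z.2)
    (ha : ∀ α x p, ‖a α x p‖ₑ ≤ A α * u x) (hb : ∀ α x p, ‖b α x p‖ₑ ≤ B α * v x)
    (hA : ∀ α, A α ≠ ∞) (hB : ∀ α, B α ≠ ∞) (hu : Measurable u) (hv : Measurable v)
    (hu1 : ∫⁻ x, u x ^ 2 ≤ 1) (hv1 : ∫⁻ x, v x ^ 2 ≤ 1)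
    {f g : X → ℂ} (hf : Measurable f) (hf2 : ∫⁻ x, ‖f x‖ₑ ^ 2 ≠ ∞)
    (hg : Measurable g) (hg2 : ∫⁻ x, ‖g x‖ₑ ^ 2 ≠ ∞) {θ η : Conf X × Conf X → ℂ}
    (hθ : Measurable θ) (hanti : AntisymmPair θ) (hη : Measurable η)
    (hint : ∫⁻ y : X × X × Conf X × Conf X,
      ‖f y.2.1 * g y.1 * (star (annPair θ y.1 y.2.1 y.2.2) * η y.2.2)‖ₑ ≠ ∞) :
    ‖∫ y : X × X × Conf X × Conf X, superposition a b y.1 y.2.1 *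
      (f y.2.1 * g y.1 * (star (annPair θ y.1 y.2.1 y.2.2) * η y.2.2))‖ₑ ^ 2 ≤
      (∑ α, A α * B α) ^ 2 *
        ((∫⁻ x, ‖f x‖ₑ ^ 2) * ((∫⁻ x, ‖g x‖ₑ ^ 2) * ∫⁻ c, ‖θ c‖ₑ ^ 2) *
          ∫⁻ c, ‖η c‖ₑ ^ 2) := by
  set K : ℝ≥0∞ := ∑ α, A α * B α with hK
  have hKtop : K ≠ ∞ := ENNReal.sum_ne_top.2 fun α _ => ENNReal.mul_ne_top (hA α) (hB α)
  set T : ℝ≥0∞ := (∫⁻ x, ‖f x‖ₑ ^ 2) * ((∫⁻ x, ‖g x‖ₑ ^ 2) * ∫⁻ c, ‖θ c‖ₑ ^ 2) *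
    ∫⁻ c, ‖η c‖ₑ ^ 2 with hT
  set S : ℝ≥0∞ := T ^ (1 / 2 : ℝ) with hS
  have hS2 : S ^ 2 = T := by
    rw [hS, ← ENNReal.rpow_two, ← ENNReal.rpow_mul]; norm_num
  let w : X × X × Conf X × Conf X → ℂ := fun y =>
    f y.2.1 * g y.1 * (star (annPair θ y.1 y.2.1 y.2.2) * η y.2.2)
  have hw : Measurable w :=
    ((hf.comp (by fun_prop)).mul (hg.comp (by fun_prop))).mul
      ((continuous_star.measurable.comp (measurable_annPair hθ)).mul (hη.comp (by fun_prop)))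
  have hwint : Integrable w := ⟨hw.aestronglyMeasurable, lt_top_iff_ne_top.2 hint⟩
  let k : ℝ → X × X × Conf X × Conf X → ℂ := fun x y => ∑ α, a α x y.2.1 * b α x y.1
  have hk : Measurable fun z : ℝ × (X × X × Conf X × Conf X) => k z.1 z.2 := by
    refine Finset.measurable_sum _ fun α _ => Measurable.mul ?_ ?_
    · exact (ham α).comp (f := fun z : ℝ × (X × X × Conf X × Conf X) => (z.1, z.2.2.1))
        (by fun_prop)
    · exact (hbm α).comp (f := fun z : ℝ × (X × X × Conf X × Conf X) => (z.1, z.2.1))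
        (by fun_prop)
  have huv := lintegral_mul_le_one hu hv hu1 hv1
  have huvm : Measurable fun x => u x * v x := hu.mul hv
  have hH : Integrable (fun z : ℝ × (X × X × Conf X × Conf X) => k z.1 z.2 * w z.2)
      (volume.prod volume) := by
    have hm : Measurable fun z : ℝ × (X × X × Conf X × Conf X) => k z.1 z.2 * w z.2 :=
      hk.mul (hw.comp measurable_snd)
    refine ⟨hm.aestronglyMeasurable, ?_⟩
    have hle : ∫⁻ z : ℝ × (X × X × Conf X × Conf X), ‖k z.1 z.2 * w z.2‖ₑ ∂(volume.prod volume) ≤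
        ∫⁻ z : ℝ × (X × X × Conf X × Conf X), (K * (u z.1 * v z.1)) * ‖w z.2‖ₑ
          ∂(volume.prod volume) := by
      refine lintegral_mono fun z => ?_
      rw [enorm_mul]
      gcongr
      exact enorm_sum_mul_le ha hb z.1 z.2.1 z.2.2.1
    refine lt_of_le_of_lt hle ?_
    rw [lintegral_prod_mul (f := fun x => K * (u x * v x)) (g := fun y => ‖w y‖ₑ)
      (huvm.const_mul K).aemeasurable hw.enorm.aemeasurable,
      lintegral_const_mul K huvm]
    exact ENNReal.mul_lt_top (ENNReal.mul_lt_top hKtop.lt_top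
      (lt_of_le_of_lt huv ENNReal.one_lt_top)) (lt_top_iff_ne_top.2 hint)
  have hswap : ∫ y, superposition a b y.1 y.2.1 * w y = ∫ x, ∫ y, k x y * w y := by
    rw [integral_integral_swap hH]
    congr 1; funext y
    rw [integral_mul_const]
    rfl
  have hfin : ∀ {t : ℝ → ℝ≥0∞}, Measurable t → ∫⁻ x, t x ^ 2 ≤ 1 → ∀ᵐ x, t x ≠ ∞ := by
    intro t ht ht1
    filter_upwards [ae_lt_top (ht.pow_const 2) (ne_top_of_le_ne_top ENNReal.one_ne_top ht1)]
      with x hx hx'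
    rw [hx'] at hx
    simp at hx
  have hx : ∀ᵐ x, ‖∫ y, k x y * w y‖ₑ ≤ K * (u x * v x) * S := by
    filter_upwards [hfin hu hu1, hfin hv hv1] with x hux hvx
    have hterm : ∀ α, Integrable (fun y : X × X × Conf X × Conf X =>
        (a α x y.2.1 * f y.2.1) * (b α x y.1 * g y.1) *
          (star (annPair θ y.1 y.2.1 y.2.2) * η y.2.2)) := by
      intro α
      have hma : Measurable fun y : X × X × Conf X × Conf X => a α x y.2.1 :=
        ((ham α).comp measurable_prodMk_left).comp (g := fun p => a α x p) (by fun_prop)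
      have hmb : Measurable fun y : X × X × Conf X × Conf X => b α x y.1 :=
        ((hbm α).comp measurable_prodMk_left).comp (g := fun p => b α x p) (by fun_prop)
      have e : (fun y : X × X × Conf X × Conf X =>
          (a α x y.2.1 * f y.2.1) * (b α x y.1 * g y.1) *
            (star (annPair θ y.1 y.2.1 y.2.2) * η y.2.2)) =
          fun y => (a α x y.2.1 * b α x y.1) * w y := by
        funext y; simp only [w]; ring
      rw [e]
      refine ⟨((hma.mul hmb).mul hw).aestronglyMeasurable, ?_⟩
      have hle : ∫⁻ y, ‖(a α x y.2.1 * b α x y.1) * w y‖ₑ ≤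
          ∫⁻ y, (A α * u x * (B α * v x)) * ‖w y‖ₑ := by
        refine lintegral_mono fun y => ?_
        rw [enorm_mul, enorm_mul]
        gcongr
        · exact ha α x _
        · exact hb α x _
      refine lt_of_le_of_lt hle ?_
      rw [lintegral_const_mul _ hw.enorm]
      exact ENNReal.mul_lt_top (ENNReal.mul_ne_top (ENNReal.mul_ne_top (hA α) hux)
        (ENNReal.mul_ne_top (hB α) hvx)).lt_top (lt_top_iff_ne_top.2 hint)
    have hsum : ∫ y, k x y * w y = ∑ α, ∫ y : X × X × Conf X × Conf X,
        (a α x y.2.1 * f y.2.1) * (b α x y.1 * g y.1) *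
          (star (annPair θ y.1 y.2.1 y.2.2) * η y.2.2) := by
      rw [← integral_finsetSum _ fun α _ => hterm α]
      congr 1; funext y
      simp only [k, w, Finset.sum_mul]
      refine Finset.sum_congr rfl fun α _ => ?_
      ring
    rw [hsum, hK, Finset.sum_mul, Finset.sum_mul]
    refine (enorm_sum_le _ _).trans (Finset.sum_le_sum fun α _ => ?_)
    have hbound : ∀ {h t : X → ℂ} {M : ℝ≥0∞}, Measurable h → (∀ p, ‖t p‖ₑ ≤ M) →
        ∫⁻ p, ‖t p * h p‖ₑ ^ 2 ≤ M ^ 2 * ∫⁻ p, ‖h p‖ₑ ^ 2 := by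
      intro h t M hh ht
      rw [← lintegral_const_mul _ (hh.enorm.pow_const 2)]
      refine lintegral_mono fun p => ?_
      rw [enorm_mul, mul_pow]
      gcongr
      exact ht p
    have hfa := hbound hf (ha α x)
    have hgb := hbound hg (hb α x)
    have hfa' : ∫⁻ p, ‖a α x p * f p‖ₑ ^ 2 ≠ ∞ := ne_top_of_le_ne_top
      (ENNReal.mul_ne_top (ENNReal.pow_ne_top (ENNReal.mul_ne_top (hA α) hux)) hf2) hfa
    have hgb' : ∫⁻ p, ‖b α x p * g p‖ₑ ^ 2 ≠ ∞ := ne_top_of_le_ne_top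
      (ENNReal.mul_ne_top (ENNReal.pow_ne_top (ENNReal.mul_ne_top (hB α) hvx)) hg2) hgb
    have hP := enorm_integral_annPair_le (f := fun p => a α x p * f p)
      (g := fun p => b α x p * g p)
      (((ham α).comp measurable_prodMk_left).mul hf) hfa'
      (((hbm α).comp measurable_prodMk_left).mul hg) hgb' hθ hanti hη (hterm α)
    refine (ENNReal.pow_le_pow_left_iff two_ne_zero).1 (hP.trans ?_)
    calc _ ≤ ((A α * u x) ^ 2 * ∫⁻ x, ‖f x‖ₑ ^ 2) *
          (((B α * v x) ^ 2 * ∫⁻ x, ‖g x‖ₑ ^ 2) * ∫⁻ c, ‖θ c‖ₑ ^ 2) *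
          ∫⁻ c, ‖η c‖ₑ ^ 2 := by gcongr
      _ = (A α * u x) ^ 2 * (B α * v x) ^ 2 * S ^ 2 := by rw [hS2, hT]; ring
      _ = _ := by ring
  rw [hswap, ← hS2, ← mul_pow]
  refine (pow_le_pow_left' ((enorm_integral_le_lintegral_enorm _).trans
    (lintegral_mono_ae hx)) 2).trans ?_
  rw [lintegral_mul_const _ (huvm.const_mul K), lintegral_const_mul K huvm]
  calc (K * (∫⁻ x, u x * v x) * S) ^ 2 ≤ (K * 1 * S) ^ 2 := by gcongr
    _ = (K * S) ^ 2 := by rw [mul_one]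

/-- With boundedly many particles the integrals converge absolutely: the annihilation operators
at sharp momenta only bring in bounded factors. -/
lemma lintegral_annPair_le {f g : X → ℂ} (hf : Measurable f) (hg : Measurable g)
    {θ η : Conf X × Conf X → ℂ} (hθ : Measurable θ) (hη : Measurable η) {N : ℝ≥0∞}
    (hN : ∀ p₃ p₄ : X, ∀ c : Conf X × Conf X, θ (c.1.insert p₄, c.2.insert p₃) * η c ≠ 0 →
      ((c.2.1 : ℝ≥0∞) + 1) * (c.1.1 + 1) ≤ N) :
    (∫⁻ y : X × X × Conf X × Conf X,
      ‖f y.2.1 * g y.1 * (star (annPair θ y.1 y.2.1 y.2.2) * η y.2.2)‖ₑ) ^ 2 ≤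
      N * ((∫⁻ x, ‖f x‖ₑ ^ 2) * ((∫⁻ x, ‖g x‖ₑ ^ 2) * ∫⁻ c, ‖θ c‖ₑ ^ 2) *
          ∫⁻ c, ‖η c‖ₑ ^ 2) := by
  have hins : ∫⁻ y : X × X × Conf X × Conf X,
      ‖θ (y.2.2.1.insert y.2.1, y.2.2.2.insert y.1)‖ₑ ^ 2 ≤ ∫⁻ c, ‖θ c‖ₑ ^ 2 :=
    subpreserving_insert_pair.lintegral_le (fun c => ‖θ c‖ₑ ^ 2) (hθ.enorm.pow_const 2)
  have hprod : ∫⁻ y : X × X × Conf X × Conf X,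
      N * (‖g y.1‖ₑ ^ 2 * (‖f y.2.1‖ₑ ^ 2 * ‖η y.2.2‖ₑ ^ 2)) =
      N * ((∫⁻ x, ‖g x‖ₑ ^ 2) * ((∫⁻ x, ‖f x‖ₑ ^ 2) * ∫⁻ c, ‖η c‖ₑ ^ 2)) := by
    have hf' : Measurable fun p => ‖f p‖ₑ ^ 2 := hf.enorm.pow_const 2
    have hg' : Measurable fun p => ‖g p‖ₑ ^ 2 := hg.enorm.pow_const 2
    have hη' : Measurable fun c => ‖η c‖ₑ ^ 2 := hη.enorm.pow_const 2
    have hfη : Measurable fun y : X × Conf X × Conf X => ‖f y.1‖ₑ ^ 2 * ‖η y.2‖ₑ ^ 2 := by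
      fun_prop
    rw [lintegral_const_mul _ (by fun_prop)]
    congr 1
    refine (lintegral_prod_mul (f := fun p => ‖g p‖ₑ ^ 2)
      (g := fun y : X × Conf X × Conf X => ‖f y.1‖ₑ ^ 2 * ‖η y.2‖ₑ ^ 2) hg'.aemeasurable
      hfη.aemeasurable).trans ?_
    congr 1
    exact lintegral_prod_mul (f := fun p => ‖f p‖ₑ ^ 2)
      (g := fun c : Conf X × Conf X => ‖η c‖ₑ ^ 2) hf'.aemeasurable hη'.aemeasurable
  refine (sq_lintegral_le (a := fun y : X × X × Conf X × Conf X =>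
      N * (‖g y.1‖ₑ ^ 2 * (‖f y.2.1‖ₑ ^ 2 * ‖η y.2.2‖ₑ ^ 2)))
    (b := fun y : X × X × Conf X × Conf X =>
      ‖θ (y.2.2.1.insert y.2.1, y.2.2.2.insert y.1)‖ₑ ^ 2) ?_ ?_
    (Eventually.of_forall fun y => ?_)).trans ?_
  · have hf' : Measurable fun p => ‖f p‖ₑ ^ 2 := hf.enorm.pow_const 2
    have hg' : Measurable fun p => ‖g p‖ₑ ^ 2 := hg.enorm.pow_const 2
    have hη' : Measurable fun c => ‖η c‖ₑ ^ 2 := hη.enorm.pow_const 2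
    exact Measurable.aemeasurable (by fun_prop)
  · exact ((hθ.comp measurable_insert_pair).enorm.pow_const 2).aemeasurable
  · by_cases h0 : θ (y.2.2.1.insert y.2.1, y.2.2.2.insert y.1) * η y.2.2 = 0
    · have : ‖f y.2.1 * g y.1 * (star (annPair θ y.1 y.2.1 y.2.2) * η y.2.2)‖ₑ = 0 := by
        rcases mul_eq_zero.1 h0 with h | h
        · simp [annPair, h]
        · simp [h]
      rw [this]
      simp
    · have h1 := hN y.1 y.2.1 y.2.2 h0
      have hs : ∀ z : ℂ, ‖star z‖ₑ = ‖z‖ₑ := fun z => by simp [enorm_eq_nnnorm]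
      simp only [annPair, enorm_mul, hs, mul_pow, enorm_sqrt_sq]
      calc _ = ((y.2.2.2.1 : ℝ≥0∞) + 1) * (y.2.2.1.1 + 1) *
            (‖g y.1‖ₑ ^ 2 * (‖f y.2.1‖ₑ ^ 2 * ‖η y.2.2‖ₑ ^ 2)) *
            ‖θ (y.2.2.1.insert y.2.1, y.2.2.2.insert y.1)‖ₑ ^ 2 := by ring
        _ ≤ _ := by gcongr
  · rw [hprod]
    calc _ ≤ N * ((∫⁻ x, ‖g x‖ₑ ^ 2) * ((∫⁻ x, ‖f x‖ₑ ^ 2) * ∫⁻ c, ‖η c‖ₑ ^ 2)) *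
          ∫⁻ c, ‖θ c‖ₑ ^ 2 := by gcongr
      _ = _ := by ring

end Superposition

/-! ### Normalization of the Landau functions -/

section Landau

lemma derivative_physHermite (n : ℕ) :
    Polynomial.derivative (physHermite (n + 1)) = 2 * ((n : Polynomial ℝ) + 1) * physHermite n := by
  induction n with
  | zero => simp [physHermite]
  | succ n ih =>
    rw [physHermite, Polynomial.derivative_sub, Polynomial.derivative_mul,
      Polynomial.derivative_mul, Polynomial.derivative_ofNat, Polynomial.derivative_X, ih]
    have h2 : Polynomial.derivative (2 * ((n : Polynomial ℝ) + 1) * physHermite n) =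
        2 * ((n : Polynomial ℝ) + 1) * Polynomial.derivative (physHermite n) := by
      rw [show (2 * ((n : Polynomial ℝ) + 1)) = ((2 * (n + 1) : ℕ) : Polynomial ℝ) by
        push_cast; ring, Polynomial.derivative_mul, Polynomial.derivative_natCast]
      ring
    rw [h2, physHermite]
    push_cast
    ring

lemma integrable_polynomial_mul_gaussian (p : Polynomial ℝ) :
    Integrable fun x : ℝ => p.eval x * Real.exp (-x ^ 2) := by
  induction p using Polynomial.induction_on' with
  | add p q hp hq =>
    simp only [Polynomial.eval_add, add_mul]
    exact hp.add hq
  | monomial n a =>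
    have h := (integrable_rpow_mul_exp_neg_mul_sq one_pos
      (s := n) (by have : (0 : ℝ) ≤ n := n.cast_nonneg; linarith)).const_mul a
    refine h.congr (Eventually.of_forall fun x => ?_)
    simp only [Polynomial.eval_monomial, Real.rpow_natCast]
    rw [neg_one_mul, mul_assoc]

/-- Integration by parts, with `H_{n+1} e^{-x²} = -(H_n e^{-x²})'` and `H_{n+1}' = 2 (n + 1) H_n`. -/
lemma integral_physHermite_sq_succ (n : ℕ) :
    ∫ x : ℝ, (physHermite (n + 1)).eval x ^ 2 * Real.exp (-x ^ 2) =
      2 * (n + 1) * ∫ x : ℝ, (physHermite n).eval x ^ 2 * Real.exp (-x ^ 2) := by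
  let p := physHermite n
  let q := physHermite (n + 1)
  have hu : ∀ x, HasDerivAt (fun x => q.eval x) ((Polynomial.derivative q).eval x) x :=
    fun x => q.hasDerivAt x
  have hg : ∀ x : ℝ, HasDerivAt (fun x : ℝ => Real.exp (-x ^ 2))
      (Real.exp (-x ^ 2) * (-(2 * x))) x := by
    intro x
    have := ((hasDerivAt_pow 2 x).neg).exp
    simpa using this
  have hv : ∀ x, HasDerivAt (fun x : ℝ => p.eval x * Real.exp (-x ^ 2))
      (-(q.eval x * Real.exp (-x ^ 2))) x := by
    intro x
    have h := (p.hasDerivAt x).mul (hg x)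
    have e : -(q.eval x * Real.exp (-x ^ 2)) =
        (Polynomial.derivative p).eval x * Real.exp (-x ^ 2) +
          p.eval x * (Real.exp (-x ^ 2) * (-(2 * x))) := by
      simp only [q, p, physHermite, Polynomial.eval_sub, Polynomial.eval_mul, Polynomial.eval_X,
        Polynomial.eval_ofNat]
      ring
    rw [e]
    exact h
  have hint : ∀ r s : Polynomial ℝ, Integrable fun x : ℝ =>
      r.eval x * (s.eval x * Real.exp (-x ^ 2)) := by
    intro r s
    simpa only [Polynomial.eval_mul, mul_assoc] using integrable_polynomial_mul_gaussian (r * s)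
  have h := integral_mul_deriv_eq_deriv_mul_of_integrable (fun x _ => hu x) (fun x _ => hv x)
    ((hint q q).neg.congr (Eventually.of_forall fun x => by
      simp only [Pi.neg_apply, Pi.mul_apply]; ring))
    (hint (Polynomial.derivative q) p) (hint q p)
  have e₁ : ∫ x : ℝ, q.eval x ^ 2 * Real.exp (-x ^ 2) =
      -∫ x : ℝ, q.eval x * -(q.eval x * Real.exp (-x ^ 2)) := by
    rw [← integral_neg]
    congr 1; funext x; ring
  rw [e₁, h, neg_neg, ← integral_const_mul]
  congr 1; funext x
  simp only [q, p, derivative_physHermite, Polynomial.eval_mul, Polynomial.eval_add,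
    Polynomial.eval_ofNat, Polynomial.eval_natCast, Polynomial.eval_one]
  ring

lemma integral_physHermite_sq (n : ℕ) :
    ∫ x : ℝ, (physHermite n).eval x ^ 2 * Real.exp (-x ^ 2) =
      n.factorial * 2 ^ n * Real.sqrt Real.pi := by
  induction n with
  | zero =>
    have h := integral_gaussian 1
    simp only [neg_one_mul, div_one] at h
    simp [physHermite, h]
  | succ n ih =>
    rw [integral_physHermite_sq_succ, ih, Nat.factorial_succ]
    push_cast
    ring

variable {e B : ℝ}

lemma landauI_sq (he : 0 < e) (hB : 0 < B) (n : ℕ) (x p₁ : ℝ) :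
    landauI e B n x p₁ ^ 2 = Real.sqrt (e * B) / (n.factorial * 2 ^ n * Real.sqrt Real.pi) *
      ((physHermite n).eval (Real.sqrt (e * B) * (x - p₁ / (e * B))) ^ 2 *
        Real.exp (-(Real.sqrt (e * B) * (x - p₁ / (e * B))) ^ 2)) := by
  simp only [landauI]
  rw [mul_pow, mul_pow, Real.sq_sqrt (by positivity), ← Real.exp_nat_mul]
  rw [show ((2 : ℕ) : ℝ) * (-(Real.sqrt (e * B) * (x - p₁ / (e * B))) ^ 2 / 2) =
    -(Real.sqrt (e * B) * (x - p₁ / (e * B))) ^ 2 by push_cast; ring]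
  ring

lemma integrable_landauI_sq (he : 0 < e) (hB : 0 < B) (n : ℕ) (p₁ : ℝ) :
    Integrable fun x => landauI e B n x p₁ ^ 2 := by
  simp_rw [landauI_sq he hB]
  have hs : Real.sqrt (e * B) ≠ 0 := (Real.sqrt_pos.2 (mul_pos he hB)).ne'
  have h := integrable_polynomial_mul_gaussian (physHermite n ^ 2)
  simp only [Polynomial.eval_pow] at h
  exact ((h.comp_mul_left' hs).comp_sub_right (p₁ / (e * B))).const_mul _

lemma integral_landauI_sq (he : 0 < e) (hB : 0 < B) (n : ℕ) (p₁ : ℝ) :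
    ∫ x, landauI e B n x p₁ ^ 2 = 1 := by
  simp_rw [landauI_sq he hB]
  have hs : 0 < Real.sqrt (e * B) := Real.sqrt_pos.2 (mul_pos he hB)
  rw [integral_const_mul, integral_sub_right_eq_self (fun x : ℝ =>
      (physHermite n).eval (Real.sqrt (e * B) * x) ^ 2 *
        Real.exp (-(Real.sqrt (e * B) * x) ^ 2)) (p₁ / (e * B)),
    Measure.integral_comp_mul_left (fun x : ℝ =>
      (physHermite n).eval x ^ 2 * Real.exp (-x ^ 2)), integral_physHermite_sq,
    abs_of_pos (inv_pos.2 hs), smul_eq_mul]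
  have : 0 < Real.sqrt Real.pi := Real.sqrt_pos.2 Real.pi_pos
  field_simp

lemma integrable_landauIPred_sq (he : 0 < e) (hB : 0 < B) (n : ℕ) (p₁ : ℝ) :
    Integrable fun x => landauIPred e B n x p₁ ^ 2 := by
  cases n with
  | zero => simp [landauIPred]
  | succ n => exact integrable_landauI_sq he hB n p₁

lemma integral_landauIPred_sq_le (he : 0 < e) (hB : 0 < B) (n : ℕ) (p₁ : ℝ) :
    ∫ x, landauIPred e B n x p₁ ^ 2 ≤ 1 := by
  cases n with
  | zero => simp [landauIPred]
  | succ n => exact (integral_landauI_sq he hB n p₁).le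

lemma measurable_landauI (e B : ℝ) :
    Measurable fun z : ℕ × ℝ × ℝ => landauI e B z.1 z.2.1 z.2.2 := by
  refine measurable_from_prod_countable_right fun n => ?_
  have h : Continuous fun z : ℝ × ℝ => landauI e B n z.1 z.2 := by
    unfold landauI
    have := (physHermite n).continuous
    fun_prop
  exact h.measurable

lemma measurable_landauIPred (e B : ℝ) :
    Measurable fun z : ℕ × ℝ × ℝ => landauIPred e B z.1 z.2.1 z.2.2 := by
  refine measurable_from_prod_countable_right fun n => ?_
  cases n with
  | zero => exact measurable_const
  | succ n =>
    change Measurable fun z : ℝ × ℝ => landauI e B n z.1 z.2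
    exact (measurable_landauI e B).comp (f := fun z : ℝ × ℝ => (n, z.1, z.2)) (by fun_prop)

end Landau

/-! ### Norms of the spinors -/

section Spinors

/-- The Hermitian norm of a spinor. -/
def spinorNorm (U : Fin 4 → ℂ) : ℝ≥0∞ := ‖(WithLp.toLp 2 U : EuclideanSpace ℂ (Fin 4))‖ₑ

lemma spinorNorm_sq (U : Fin 4 → ℂ) : spinorNorm U ^ 2 = ENNReal.ofReal (∑ i, ‖U i‖ ^ 2) := by
  rw [spinorNorm, ← ofReal_norm, ← ENNReal.ofReal_pow (norm_nonneg _),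
    EuclideanSpace.norm_sq_eq]

lemma spinorNorm_sq_real (f : Fin 4 → ℝ) :
    spinorNorm (fun i => (f i : ℂ)) ^ 2 =
      ENNReal.ofReal (f 0 ^ 2 + f 1 ^ 2 + f 2 ^ 2 + f 3 ^ 2) := by
  rw [spinorNorm_sq]
  simp [Fin.sum_univ_four]

lemma measurable_spinorNorm {α : Type*} [MeasurableSpace α] {U : α → Fin 4 → ℂ}
    (h : ∀ i, Measurable fun z => U z i) : Measurable fun z => spinorNorm (U z) := by
  have hU : Measurable U := measurable_pi_lambda _ h
  exact ((WithLp.measurable_toLp 2 (Fin 4 → ℂ)).comp hU).enorm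

lemma enorm_bracket_le (U V : Fin 4 → ℂ) (Γ : Matrix (Fin 4) (Fin 4) ℂ) :
    ‖bracket U Γ V‖ₑ ≤
      ENNReal.ofReal (opNorm (gammaUp 0 * Γ * (1 - gamma5))) * spinorNorm U * spinorNorm V := by
  set A := gammaUp 0 * Γ * (1 - gamma5) with hA
  have e : bracket U Γ V = inner ℂ (WithLp.toLp 2 U : EuclideanSpace ℂ (Fin 4))
      (Matrix.toEuclideanCLM (𝕜 := ℂ) A (WithLp.toLp 2 V)) := by
    rw [EuclideanSpace.inner_eq_star_dotProduct, Matrix.toEuclideanCLM_toLp, bracket,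
      dotProduct_comm]
  rw [e, spinorNorm, spinorNorm, opNorm, ofReal_norm]
  calc _ ≤ ‖(WithLp.toLp 2 U : EuclideanSpace ℂ (Fin 4))‖ₑ *
        ‖Matrix.toEuclideanCLM (𝕜 := ℂ) A (WithLp.toLp 2 V)‖ₑ := by
        rw [← ofReal_norm, ← ofReal_norm, ← ofReal_norm, ← ENNReal.ofReal_mul (norm_nonneg _)]
        exact ENNReal.ofReal_le_ofReal (norm_inner_le_norm _ _)
    _ ≤ ‖(WithLp.toLp 2 U : EuclideanSpace ℂ (Fin 4))‖ₑ *
        (‖Matrix.toEuclideanCLM (𝕜 := ℂ) A‖ₑ *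
          ‖(WithLp.toLp 2 V : EuclideanSpace ℂ (Fin 4))‖ₑ) := by
        gcongr
        exact ContinuousLinearMap.le_opENorm _ _
    _ = _ := by ring

lemma measurable_bracket {α : Type*} [MeasurableSpace α] {U V : α → Fin 4 → ℂ}
    (hU : ∀ i, Measurable fun z => U z i) (hV : ∀ i, Measurable fun z => V z i)
    (Γ : Matrix (Fin 4) (Fin 4) ℂ) : Measurable fun z => bracket (U z) Γ (V z) := by
  unfold bracket
  simp only [dotProduct, mulVec, Pi.star_apply]
  refine Finset.measurable_sum _ fun i _ => (continuous_star.measurable.comp (hU i)).mul ?_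
  exact Finset.measurable_sum _ fun j _ => (hV j).const_mul _

variable {m e B : ℝ}

lemma le_landauEnergy (m : ℝ) (he : 0 < e) (hB : 0 < B) (ξ : Gamma1) :
    m ≤ landauEnergy m e B ξ := by
  refine Real.le_sqrt_of_sq_le ?_
  have : 0 ≤ 2 * (ξ.2.1 : ℝ) * e * B := by positivity
  nlinarith [sq_nonneg ξ.2.2.2]

/-- The normalization `N² (1 + a² + k²) = 1`. -/
lemma normalization (hm : 0 < m) (he : 0 < e) (hB : 0 < B) (ξ : Gamma1) :
    Real.sqrt ((landauEnergy m e B ξ + m) / (2 * landauEnergy m e B ξ)) ^ 2 *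
      (1 + (ξ.2.2.2 / (landauEnergy m e B ξ + m)) ^ 2 +
        (Real.sqrt (2 * ξ.2.1 * e * B) / (landauEnergy m e B ξ + m)) ^ 2) = 1 := by
  have hE := le_landauEnergy m he hB ξ
  have hE2 : landauEnergy m e B ξ ^ 2 = m ^ 2 + ξ.2.2.2 ^ 2 + 2 * ξ.2.1 * e * B :=
    Real.sq_sqrt (by positivity)
  set E := landauEnergy m e B ξ
  have hE0 : 0 < E := hm.trans_le hE
  rw [Real.sq_sqrt (by positivity), div_pow, div_pow, Real.sq_sqrt (by positivity)]
  field_simp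
  nlinarith

/-- Square integrals of spinors built from `I_n` and `I_{n-1}`. -/
lemma lintegral_spinorNorm_sq_le (he : 0 < e) (hB : 0 < B) (n : ℕ) (p₁ : ℝ)
    {U : ℝ → Fin 4 → ℂ} {c₀ c₁ : ℝ} (h₀ : 0 ≤ c₀) (h₁ : 0 ≤ c₁) (hc : c₀ + c₁ = 1)
    (hU : ∀ x, spinorNorm (U x) ^ 2 = ENNReal.ofReal
      (c₀ * landauIPred e B n x p₁ ^ 2 + c₁ * landauI e B n x p₁ ^ 2)) :
    ∫⁻ x, spinorNorm (U x) ^ 2 ≤ 1 := by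
  have i₀ := (integrable_landauIPred_sq he hB n p₁).const_mul c₀
  have i₁ := (integrable_landauI_sq he hB n p₁).const_mul c₁
  have i : Integrable fun x =>
      c₀ * landauIPred e B n x p₁ ^ 2 + c₁ * landauI e B n x p₁ ^ 2 := i₀.add i₁
  simp_rw [hU]
  rw [← ofReal_integral_eq_lintegral_ofReal i
    (Eventually.of_forall fun x => by simp only [Pi.zero_apply]; positivity)]
  rw [integral_add i₀ i₁, integral_const_mul, integral_const_mul, integral_landauI_sq he hB]
  rw [← ENNReal.ofReal_one]
  refine ENNReal.ofReal_le_ofReal ?_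
  nlinarith [integral_landauIPred_sq_le he hB n p₁]

lemma lintegral_spinorU_le (hm : 0 < m) (he : 0 < e) (hB : 0 < B) (ξ : Gamma1) :
    ∫⁻ x, spinorNorm (spinorU m e B x ξ) ^ 2 ≤ 1 := by
  have hn := normalization hm he hB ξ
  obtain ⟨s, n, p₁, p₃⟩ := ξ
  simp only [spinorU]
  set E := landauEnergy m e B (s, n, p₁, p₃)
  set N := Real.sqrt ((E + m) / (2 * E))
  simp only at hn
  set a := p₃ / (E + m)
  set k := Real.sqrt (2 * n * e * B) / (E + m)
  by_cases hs : s = true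
  · by_cases h0 : n = 0
    · simp [hs, h0, spinorNorm]
    · simp only [hs, h0, if_true, if_false]
      refine lintegral_spinorNorm_sq_le he hB n p₁ (c₀ := N ^ 2 * (1 + a ^ 2))
        (c₁ := N ^ 2 * k ^ 2) (by positivity) (by positivity) (by linarith) fun x => ?_
      rw [spinorNorm_sq_real (fun i => N * ![landauIPred e B n x p₁, 0,
        a * landauIPred e B n x p₁, -k * landauI e B n x p₁] i)]
      congr 1
      simp only [Matrix.cons_val]
      ring
  · simp only [hs]
    refine lintegral_spinorNorm_sq_le he hB n p₁ (c₀ := N ^ 2 * k ^ 2)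
      (c₁ := N ^ 2 * (1 + a ^ 2)) (by positivity) (by positivity) (by linarith) fun x => ?_
    rw [if_neg (by simp)]
    rw [spinorNorm_sq_real (fun i => N * ![0, landauI e B n x p₁,
      -k * landauIPred e B n x p₁, -a * landauI e B n x p₁] i)]
    congr 1
    simp only [Matrix.cons_val]
    ring

lemma lintegral_spinorV_le (hm : 0 < m) (he : 0 < e) (hB : 0 < B) (ξ : Gamma1) :
    ∫⁻ x, spinorNorm (spinorV m e B x ξ) ^ 2 ≤ 1 := by
  have hn := normalization hm he hB ξ
  obtain ⟨s, n, p₁, p₃⟩ := ξ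
  simp only [spinorV]
  set E := landauEnergy m e B (s, n, p₁, p₃)
  set N := Real.sqrt ((E + m) / (2 * E))
  simp only at hn
  set a := p₃ / (E + m)
  set k := Real.sqrt (2 * n * e * B) / (E + m)
  by_cases hs : s = true
  · by_cases h0 : n = 0
    · simp [hs, h0, spinorNorm]
    · simp only [hs, h0, if_true, if_false]
      refine lintegral_spinorNorm_sq_le he hB n p₁ (c₀ := N ^ 2 * (1 + a ^ 2))
        (c₁ := N ^ 2 * k ^ 2) (by positivity) (by positivity) (by linarith) fun x => ?_
      rw [spinorNorm_sq_real (fun i => N * ![-a * landauIPred e B n x p₁,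
        k * landauI e B n x p₁, landauIPred e B n x p₁, 0] i)]
      congr 1
      simp only [Matrix.cons_val]
      ring
  · simp only [hs]
    refine lintegral_spinorNorm_sq_le he hB n p₁ (c₀ := N ^ 2 * k ^ 2)
      (c₁ := N ^ 2 * (1 + a ^ 2)) (by positivity) (by positivity) (by linarith) fun x => ?_
    rw [if_neg (by simp)]
    rw [spinorNorm_sq_real (fun i => N * ![k * landauIPred e B n x p₁,
      a * landauI e B n x p₁, 0, landauI e B n x p₁] i)]
    congr 1
    simp only [Matrix.cons_val]
    ring

lemma lintegral_spinorW_le (hm : 0 < m) (he : 0 < e) (hB : 0 < B) (ξ : Gamma1) :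
    ∫⁻ x, spinorNorm (spinorW m e B x ξ) ^ 2 ≤ 1 :=
  lintegral_spinorV_le hm he hB _

lemma measurable_landauEnergy (m e B : ℝ) : Measurable (landauEnergy m e B) := by
  have : Measurable fun ξ : Gamma1 => ((ξ.2.1 : ℕ) : ℝ) :=
    (measurable_of_countable (fun n : ℕ => (n : ℝ))).comp (by fun_prop)
  unfold landauEnergy
  fun_prop

lemma measurable_spinorU (m e B : ℝ) (i : Fin 4) :
    Measurable fun z : ℝ × Gamma1 => spinorU m e B z.1 z.2 i := by
  have hn : Measurable fun z : ℝ × Gamma1 => ((z.2.2.1 : ℕ) : ℝ) :=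
    (measurable_of_countable (fun n : ℕ => (n : ℝ))).comp
      (f := fun z : ℝ × Gamma1 => z.2.2.1) (by fun_prop)
  have hE : Measurable fun z : ℝ × Gamma1 => landauEnergy m e B z.2 :=
    (measurable_landauEnergy m e B).comp measurable_snd
  have h₁ : Measurable fun z : ℝ × Gamma1 => landauI e B z.2.2.1 z.1 z.2.2.2.1 :=
    (measurable_landauI e B).comp (f := fun z : ℝ × Gamma1 => (z.2.2.1, z.1, z.2.2.2.1))
      (by fun_prop)
  have h₀ : Measurable fun z : ℝ × Gamma1 => landauIPred e B z.2.2.1 z.1 z.2.2.2.1 :=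
    (measurable_landauIPred e B).comp (f := fun z : ℝ × Gamma1 => (z.2.2.1, z.1, z.2.2.2.1))
      (by fun_prop)
  have hs : MeasurableSet {z : ℝ × Gamma1 | z.2.1 = true} :=
    (measurableSet_singleton true).preimage (f := fun z : ℝ × Gamma1 => z.2.1) (by fun_prop)
  have h0 : MeasurableSet {z : ℝ × Gamma1 | z.2.2.1 = 0} :=
    (measurableSet_singleton 0).preimage (f := fun z : ℝ × Gamma1 => z.2.2.1) (by fun_prop)
  simp only [spinorU, ite_apply]
  refine Measurable.ite hs (Measurable.ite h0 measurable_const ?_) ?_ <;>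
  · refine Complex.measurable_ofReal.comp ?_
    fin_cases i <;> simp <;> fun_prop

lemma measurable_spinorV (m e B : ℝ) (i : Fin 4) :
    Measurable fun z : ℝ × Gamma1 => spinorV m e B z.1 z.2 i := by
  have hn : Measurable fun z : ℝ × Gamma1 => ((z.2.2.1 : ℕ) : ℝ) :=
    (measurable_of_countable (fun n : ℕ => (n : ℝ))).comp
      (f := fun z : ℝ × Gamma1 => z.2.2.1) (by fun_prop)
  have hE : Measurable fun z : ℝ × Gamma1 => landauEnergy m e B z.2 :=
    (measurable_landauEnergy m e B).comp measurable_snd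
  have h₁ : Measurable fun z : ℝ × Gamma1 => landauI e B z.2.2.1 z.1 z.2.2.2.1 :=
    (measurable_landauI e B).comp (f := fun z : ℝ × Gamma1 => (z.2.2.1, z.1, z.2.2.2.1))
      (by fun_prop)
  have h₀ : Measurable fun z : ℝ × Gamma1 => landauIPred e B z.2.2.1 z.1 z.2.2.2.1 :=
    (measurable_landauIPred e B).comp (f := fun z : ℝ × Gamma1 => (z.2.2.1, z.1, z.2.2.2.1))
      (by fun_prop)
  have hs : MeasurableSet {z : ℝ × Gamma1 | z.2.1 = true} :=
    (measurableSet_singleton true).preimage (f := fun z : ℝ × Gamma1 => z.2.1) (by fun_prop)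
  have h0 : MeasurableSet {z : ℝ × Gamma1 | z.2.2.1 = 0} :=
    (measurableSet_singleton 0).preimage (f := fun z : ℝ × Gamma1 => z.2.2.1) (by fun_prop)
  simp only [spinorV, ite_apply]
  refine Measurable.ite hs (Measurable.ite h0 measurable_const ?_) ?_ <;>
  · refine Complex.measurable_ofReal.comp ?_
    fin_cases i <;> simp <;> fun_prop

lemma measurable_spinorW (m e B : ℝ) (i : Fin 4) :
    Measurable fun z : ℝ × Gamma1 => spinorW m e B z.1 z.2 i :=
  (measurable_spinorV m e B i).comp
    (f := fun z : ℝ × Gamma1 => (z.1, (!z.2.1, z.2.2.1, -z.2.2.2.1, -z.2.2.2.2)))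
    (measurable_fst.prodMk (((measurable_of_countable not).comp (by fun_prop)).prodMk
      (by fun_prop)))

lemma norm_sq_momentum (p : Momentum) : ‖p‖ ^ 2 = p 0 ^ 2 + p 1 ^ 2 + p 2 ^ 2 := by
  rw [EuclideanSpace.real_norm_sq_eq, Fin.sum_univ_three]

lemma abs_le_norm_momentum (p : Momentum) : |p 2| ≤ ‖p‖ := by
  refine abs_le_of_sq_le_sq ?_ (norm_nonneg _)
  rw [norm_sq_momentum]
  nlinarith [sq_nonneg (p 0), sq_nonneg (p 1)]

/-- The eigenvectors of the helicity are normalized: here `r = |p|`, and `d = |p| ∓ p³`, so that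
`(p¹)² + (p²)² = (|p| - p³) (|p| + p³) = d (2 r - d)`. -/
lemma norm_sq_helicity {r d : ℝ} (x y : ℝ) (hr : 0 < 2 * r * d)
    (h : x ^ 2 + y ^ 2 = d * (2 * r - d))
    (z : ℂ) (hz : Complex.normSq z = x ^ 2 + y ^ 2) (w : ℝ) (hw : w ^ 2 = d ^ 2) :
    ‖((1 / Real.sqrt (2 * r * d) : ℝ) : ℂ) * (w : ℂ)‖ ^ 2 +
      ‖((1 / Real.sqrt (2 * r * d) : ℝ) : ℂ) * z‖ ^ 2 = 1 := by
  have hr0 : r ≠ 0 := by rintro rfl; simp at hr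
  have hd0 : d ≠ 0 := by rintro rfl; simp at hr
  rw [norm_mul, norm_mul, mul_pow, mul_pow, Complex.norm_real, Complex.norm_real,
    Complex.sq_norm z, hz, Real.norm_eq_abs, sq_abs, Real.norm_eq_abs, sq_abs, hw, h, div_pow,
    one_pow, Real.sq_sqrt hr.le, ← mul_add]
  field_simp
  ring

lemma norm_sq_hMinus (p : Momentum) : ‖hMinus p 0‖ ^ 2 + ‖hMinus p 1‖ ^ 2 = 1 := by
  unfold hMinus
  split_ifs with h
  · simp
  · have hle := (le_abs_self _).trans (abs_le_norm_momentum p)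
    have hd : 0 < ‖p‖ - p 2 := sub_pos.2 (lt_of_le_of_ne hle (Ne.symm h))
    have hr : 0 < ‖p‖ := by
      have := (neg_le_abs _).trans (abs_le_norm_momentum p)
      linarith
    have := norm_sq_helicity (r := ‖p‖) (d := ‖p‖ - p 2) (p 0) (p 1) (by positivity)
      (by nlinarith [norm_sq_momentum p]) ((p 0 : ℂ) + Complex.I * (p 1 : ℂ))
      (by simp [Complex.normSq_apply]; ring) (p 2 - ‖p‖) (by ring)
    simpa using this

lemma norm_sq_hPlusNeg (p : Momentum) : ‖hPlusNeg p 0‖ ^ 2 + ‖hPlusNeg p 1‖ ^ 2 = 1 := by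
  unfold hPlusNeg
  split_ifs with h
  · simp
  · have hle := (neg_le_abs _).trans (abs_le_norm_momentum p)
    have hd : 0 < ‖p‖ + p 2 := by
      have := lt_of_le_of_ne hle (Ne.symm h)
      linarith
    have hr : 0 < ‖p‖ := by
      have := (le_abs_self _).trans (abs_le_norm_momentum p)
      linarith
    have := norm_sq_helicity (r := ‖p‖) (d := ‖p‖ + p 2) (p 0) (p 1) (by positivity)
      (by nlinarith [norm_sq_momentum p]) (-(p 0 : ℂ) + Complex.I * (p 1 : ℂ))
      (by simp [Complex.normSq_apply]; ring) (‖p‖ + p 2) (by ring)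
    rw [add_comm] at this
    simpa using this

lemma spinorNorm_doubled {h : Fin 2 → ℂ} (hh : ‖h 0‖ ^ 2 + ‖h 1‖ ^ 2 = 1) {U : Fin 4 → ℂ}
    (h0 : ‖U 0‖ = ‖h 0‖) (h1 : ‖U 1‖ = ‖h 1‖) (h2 : ‖U 2‖ = ‖h 0‖) (h3 : ‖U 3‖ = ‖h 1‖) :
    spinorNorm (((1 / Real.sqrt 2 : ℝ) : ℂ) • U) = 1 := by
  have : spinorNorm (((1 / Real.sqrt 2 : ℝ) : ℂ) • U) ^ 2 = 1 ^ 2 := by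
    rw [spinorNorm_sq]
    simp only [Pi.smul_apply, smul_eq_mul, norm_mul, mul_pow, Complex.norm_real,
      Real.norm_eq_abs, sq_abs, div_pow, Real.sq_sqrt zero_le_two, Fin.sum_univ_four, h0, h1, h2,
      h3]
    rw [show (1 : ℝ) ^ 2 / 2 * ‖h 0‖ ^ 2 + 1 ^ 2 / 2 * ‖h 1‖ ^ 2 + 1 ^ 2 / 2 * ‖h 0‖ ^ 2 +
      1 ^ 2 / 2 * ‖h 1‖ ^ 2 = 1 by linarith]
    simp
  exact le_antisymm ((ENNReal.pow_le_pow_left_iff two_ne_zero).1 this.le)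
    ((ENNReal.pow_le_pow_left_iff two_ne_zero).1 this.ge)

lemma spinorNorm_spinorNu (p : Momentum) : spinorNorm (spinorNu p) = 1 :=
  spinorNorm_doubled (norm_sq_hMinus p) rfl rfl (norm_neg _) (norm_neg _)

lemma spinorNorm_spinorAntiNu (p : Momentum) : spinorNorm (spinorAntiNu p) = 1 :=
  spinorNorm_doubled (norm_sq_hPlusNeg p) (norm_neg _) (norm_neg _) rfl rfl

lemma measurable_coord (i : Fin 3) : Measurable fun p : Momentum => p i := by fun_prop

lemma measurable_hMinus (i : Fin 2) : Measurable fun p : Momentum => hMinus p i := by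
  have hs : MeasurableSet {p : Momentum | ‖p‖ = p 2} :=
    measurableSet_eq_fun measurable_norm (measurable_coord 2)
  simp only [hMinus, ite_apply]
  refine Measurable.ite hs measurable_const ?_
  simp only [Pi.smul_apply, smul_eq_mul]
  refine Measurable.mul (by fun_prop) ?_
  fin_cases i <;> simp <;> fun_prop

lemma measurable_hPlusNeg (i : Fin 2) : Measurable fun p : Momentum => hPlusNeg p i := by
  have hs : MeasurableSet {p : Momentum | ‖p‖ = -p 2} :=
    measurableSet_eq_fun measurable_norm (measurable_coord 2).neg
  simp only [hPlusNeg, ite_apply]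
  refine Measurable.ite hs measurable_const ?_
  simp only [Pi.smul_apply, smul_eq_mul]
  refine Measurable.mul (by fun_prop) ?_
  fin_cases i <;> simp <;> fun_prop

lemma measurable_spinorNu (i : Fin 4) : Measurable fun p : Momentum => spinorNu p i := by
  simp only [spinorNu, Pi.smul_apply, smul_eq_mul]
  refine Measurable.const_mul ?_ _
  have h0 := measurable_hMinus 0
  have h1 := measurable_hMinus 1
  fin_cases i
  · exact h0
  · exact h1
  · exact h0.neg
  · exact h1.neg

lemma measurable_spinorAntiNu (i : Fin 4) : Measurable fun p : Momentum => spinorAntiNu p i := by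
  simp only [spinorAntiNu, Pi.smul_apply, smul_eq_mul]
  refine Measurable.const_mul ?_ _
  have h0 := measurable_hPlusNeg 0
  have h1 := measurable_hPlusNeg 1
  fin_cases i
  · exact h0.neg
  · exact h1.neg
  · exact h0
  · exact h1

end Spinors

/-! ### Charged leptons as parameters -/

section Parameters

variable {X : Type} [MeasureSpace X] [SigmaFinite (volume : Measure X)]
  {Z : Type} [MeasureSpace Z] [SFinite (volume : Measure Z)]

/-- The estimate for fixed quantum numbers of the charged leptons, integrated over these quantum
numbers `z` by the Cauchy–Schwarz inequality. The functions `s` and `t` divide the four norms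
between the two factors of that inequality. -/
lemma integrable_superposition_annPair {a b : Z → Fin 4 → ℝ → X → ℂ} {A B : Fin 4 → ℝ≥0∞}
    {u v : Z → ℝ → ℝ≥0∞}
    (ham : ∀ α, Measurable fun w : Z × ℝ × X => a w.1 α w.2.1 w.2.2)
    (hbm : ∀ α, Measurable fun w : Z × ℝ × X => b w.1 α w.2.1 w.2.2)
    (ha : ∀ z α x p, ‖a z α x p‖ₑ ≤ A α * u z x) (hb : ∀ z α x p, ‖b z α x p‖ₑ ≤ B α * v z x)
    (hA : ∀ α, A α ≠ ∞) (hB : ∀ α, B α ≠ ∞) (hu : ∀ z, Measurable (u z))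
    (hv : ∀ z, Measurable (v z)) (hu1 : ∀ z, ∫⁻ x, u z x ^ 2 ≤ 1)
    (hv1 : ∀ z, ∫⁻ x, v z x ^ 2 ≤ 1)
    {f g : Z → X → ℂ} (hf : Measurable fun w : Z × X => f w.1 w.2)
    (hg : Measurable fun w : Z × X => g w.1 w.2)
    (hf2 : ∀ᵐ z, ∫⁻ x, ‖f z x‖ₑ ^ 2 ≠ ∞) (hg2 : ∀ᵐ z, ∫⁻ x, ‖g z x‖ₑ ^ 2 ≠ ∞)
    {θ η : Z → Conf X × Conf X → ℂ}
    (hθ : Measurable fun w : Z × Conf X × Conf X => θ w.1 w.2)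
    (hη : Measurable fun w : Z × Conf X × Conf X => η w.1 w.2)
    (hanti : ∀ z, AntisymmPair (θ z)) {N : ℝ≥0∞} (hNtop : N ≠ ∞)
    (hN : ∀ z, ∀ p₃ p₄ : X, ∀ c : Conf X × Conf X,
      θ z (c.1.insert p₄, c.2.insert p₃) * η z c ≠ 0 → ((c.2.1 : ℝ≥0∞) + 1) * (c.1.1 + 1) ≤ N)
    {s t : Z → ℝ≥0∞} (hs : Measurable s) (ht : Measurable t)
    (hst : ∀ z, (∫⁻ x, ‖f z x‖ₑ ^ 2) * ((∫⁻ x, ‖g z x‖ₑ ^ 2) * ∫⁻ c, ‖θ z c‖ₑ ^ 2) *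
      ∫⁻ c, ‖η z c‖ₑ ^ 2 = s z * t z)
    (hs1 : ∫⁻ z, s z ≠ ∞) (ht1 : ∫⁻ z, t z ≠ ∞) :
    Integrable (fun w : Z × (X × X × Conf X × Conf X) =>
      superposition (a w.1) (b w.1) w.2.1 w.2.2.1 * (f w.1 w.2.2.1 * g w.1 w.2.1 *
        (star (annPair (θ w.1) w.2.1 w.2.2.1 w.2.2.2) * η w.1 w.2.2.2))) ∧
    ‖∫ w : Z × (X × X × Conf X × Conf X),
      superposition (a w.1) (b w.1) w.2.1 w.2.2.1 * (f w.1 w.2.2.1 * g w.1 w.2.1 *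
        (star (annPair (θ w.1) w.2.1 w.2.2.1 w.2.2.2) * η w.1 w.2.2.2))‖ₑ ^ 2 ≤
      (∑ α, A α * B α) ^ 2 * ((∫⁻ z, s z) * ∫⁻ z, t z) := by
  set K : ℝ≥0∞ := ∑ α, A α * B α with hK
  have hKtop : K ≠ ∞ := ENNReal.sum_ne_top.2 fun α _ => ENNReal.mul_ne_top (hA α) (hB α)
  let m : Z × (X × X × Conf X × Conf X) → ℂ := fun w => f w.1 w.2.2.1 * g w.1 w.2.1 *
    (star (annPair (θ w.1) w.2.1 w.2.2.1 w.2.2.2) * η w.1 w.2.2.2)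
  let k : Z × (X × X × Conf X × Conf X) → ℂ := fun w => superposition (a w.1) (b w.1) w.2.1 w.2.2.1
  have hm : Measurable m := by
    refine Measurable.mul (Measurable.mul ?_ ?_) (Measurable.mul ?_ ?_)
    · exact hf.comp (f := fun w : Z × (X × X × Conf X × Conf X) => (w.1, w.2.2.1)) (by fun_prop)
    · exact hg.comp (f := fun w : Z × (X × X × Conf X × Conf X) => (w.1, w.2.1)) (by fun_prop)
    · refine continuous_star.measurable.comp (Measurable.mul ?_ ?_)
      · exact measurable_weight_pair.comp
          (f := fun w : Z × (X × X × Conf X × Conf X) => w.2.2.2) (by fun_prop)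
      · exact hθ.comp (f := fun w : Z × (X × X × Conf X × Conf X) =>
          (w.1, (w.2.2.2.1.insert w.2.2.1, w.2.2.2.2.insert w.2.1))) (measurable_fst.prodMk
            (measurable_insert_pair.comp measurable_snd))
    · exact hη.comp (f := fun w : Z × (X × X × Conf X × Conf X) => (w.1, w.2.2.2)) (by fun_prop)
  have hk : Measurable k := by
    have h : StronglyMeasurable fun p : (Z × (X × X × Conf X × Conf X)) × ℝ =>
        ∑ α, a p.1.1 α p.2 p.1.2.2.1 * b p.1.1 α p.2 p.1.2.1 := by
      refine Measurable.stronglyMeasurable (Finset.measurable_sum _ fun α _ => Measurable.mul ?_ ?_)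
      · exact (ham α).comp (f := fun p : (Z × (X × X × Conf X × Conf X)) × ℝ =>
          (p.1.1, p.2, p.1.2.2.1)) (by fun_prop)
      · exact (hbm α).comp (f := fun p : (Z × (X × X × Conf X × Conf X)) × ℝ =>
          (p.1.1, p.2, p.1.2.1)) (by fun_prop)
    exact h.integral_prod_right'.measurable
  have hle : ∀ w, ‖k w‖ₑ ≤ K := fun w =>
    enorm_superposition_le (ha w.1) (hb w.1) (hu w.1) (hv w.1) (hu1 w.1) (hv1 w.1) _ _
  have hθz : ∀ z, Measurable (θ z) := fun z => hθ.comp measurable_prodMk_left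
  have hηz : ∀ z, Measurable (η z) := fun z => hη.comp measurable_prodMk_left
  have hfz : ∀ z, Measurable (f z) := fun z => hf.comp measurable_prodMk_left
  have hgz : ∀ z, Measurable (g z) := fun z => hg.comp measurable_prodMk_left
  have hinner : Measurable fun z => ∫⁻ q, ‖m (z, q)‖ₑ := hm.enorm.lintegral_prod_right'
  have hmfin : ∫⁻ w, ‖m w‖ₑ ≠ ∞ := by
    have e : ∫⁻ w, ‖m w‖ₑ = ∫⁻ z, ∫⁻ q, ‖m (z, q)‖ₑ := lintegral_prod _ hm.enorm.aemeasurable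
    have h := sq_lintegral_le (μ := (volume : Measure Z)) (j := fun z => ∫⁻ q, ‖m (z, q)‖ₑ)
      (a := fun z => N * s z) (b := t) (hs.const_mul N).aemeasurable ht.aemeasurable
      (Eventually.of_forall fun z => by
        have h1 := lintegral_annPair_le (hfz z) (hgz z) (hθz z) (hηz z) (hN z)
        rw [hst z, ← mul_assoc] at h1
        exact h1)
    rw [← e, lintegral_const_mul _ hs] at h
    intro h'
    rw [h'] at h
    exact ENNReal.mul_ne_top (ENNReal.mul_ne_top hNtop hs1) ht1 (top_le_iff.1 (by simpa using h))
  have hmae : ∀ᵐ z, ∫⁻ q, ‖m (z, q)‖ₑ ≠ ∞ := by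
    have e : ∫⁻ w, ‖m w‖ₑ = ∫⁻ z, ∫⁻ q, ‖m (z, q)‖ₑ := lintegral_prod _ hm.enorm.aemeasurable
    rw [e] at hmfin
    filter_upwards [ae_lt_top hinner hmfin] with z hz using hz.ne
  have hint : Integrable fun w => k w * m w := by
    refine ⟨(hk.mul hm).aestronglyMeasurable, ?_⟩
    have h1 : ∫⁻ w, ‖k w * m w‖ₑ ≤ ∫⁻ w, K * ‖m w‖ₑ := by
      refine lintegral_mono fun w => ?_
      rw [enorm_mul]
      gcongr
      exact hle w
    refine lt_of_le_of_lt h1 ?_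
    rw [lintegral_const_mul _ hm.enorm]
    exact ENNReal.mul_lt_top hKtop.lt_top (lt_top_iff_ne_top.2 hmfin)
  refine ⟨hint, ?_⟩
  have e : ∫ w, k w * m w = ∫ z, ∫ q, k (z, q) * m (z, q) := integral_prod _ hint
  change ‖∫ w, k w * m w‖ₑ ^ 2 ≤ _
  rw [e]
  refine (pow_le_pow_left' (enorm_integral_le_lintegral_enorm _) 2).trans ?_
  refine (sq_lintegral_le (a := fun z => K ^ 2 * s z) (b := t) (hs.const_mul _).aemeasurable
    ht.aemeasurable ?_).trans ?_
  · filter_upwards [hf2, hg2, hmae] with z h1 h2 h3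
    have h := enorm_integral_superposition_le (a := a z) (b := b z) (A := A) (B := B)
      (u := u z) (v := v z)
      (fun α => (ham α).comp (f := fun p : ℝ × X => (z, p.1, p.2)) (by fun_prop))
      (fun α => (hbm α).comp (f := fun p : ℝ × X => (z, p.1, p.2)) (by fun_prop))
      (ha z) (hb z) hA hB (hu z) (hv z) (hu1 z) (hv1 z) (hfz z) h1 (hgz z) h2 (hθz z)
      (hanti z) (hηz z) h3
    rw [hst z, ← mul_assoc] at h
    exact h
  · rw [lintegral_const_mul _ hs, mul_assoc]

end Parameters

/-! ### Separation of the charged leptons from the neutrinos -/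

section Arrange

variable {A B R P C D : Type*} [MeasureSpace A] [MeasureSpace B] [MeasureSpace R]
  [MeasureSpace P] [MeasureSpace C] [MeasureSpace D] [SFinite (volume : Measure A)]
  [SFinite (volume : Measure B)] [SFinite (volume : Measure R)] [SFinite (volume : Measure P)]
  [SFinite (volume : Measure C)]

omit [SFinite (volume : Measure A)] in
lemma measurePreserving_assoc :
    MeasurePreserving (fun w : (A × B) × C => (w.1.1, (w.1.2, w.2))) volume volume :=
  measurePreserving_prodAssoc (volume : Measure A) (volume : Measure B) (volume : Measure C)

omit [SFinite (volume : Measure C)] in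
lemma measurePreserving_map_right {f : B → C} (hf : MeasurePreserving f volume volume) :
    MeasurePreserving (fun w : A × B => (w.1, f w.2)) volume volume :=
  (MeasurePreserving.id (volume : Measure A)).prod hf

lemma measurePreserving_arrange {j : R × C → D} (hj : MeasurePreserving j volume volume) :
    MeasurePreserving (fun w : (A × B × R) × (P × P × C) =>
      (w.1.1, (w.1.2.1, (w.2.1, (w.2.2.1, j (w.1.2.2, w.2.2.2)))))) volume volume := by
  have h₁ : MeasurePreserving (fun w : R × (P × P × C) => (w.2.1, (w.2.2.1, j (w.1, w.2.2.2))))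
      volume volume :=
    (measurePreserving_map_right ((measurePreserving_map_right hj).comp
      (measurePreserving_leftComm (X := R) (A := P) (R := C)))).comp
      (measurePreserving_leftComm (X := R) (A := P) (R := P × C))
  have h₂ : MeasurePreserving (fun w : (B × R) × (P × P × C) =>
      (w.1.1, (w.2.1, (w.2.2.1, j (w.1.2, w.2.2.2))))) volume volume :=
    (measurePreserving_map_right h₁).comp
      (measurePreserving_assoc (A := B) (B := R) (C := P × P × C))
  exact (measurePreserving_map_right h₂).comp
    (measurePreserving_assoc (A := A) (B := B × R) (C := P × P × C))

end Arrange

/-- Configurations of electrons, muons and antimuons. -/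
abbrev Charged : Type := Conf Gamma1 × Conf Gamma1 × Conf Gamma1

/-- Configurations of neutrinos and antineutrinos. -/
abbrev Neutral : Type := Conf Momentum × Conf Momentum

/-- The configuration with the given charged leptons and neutrinos. -/
def join (w : Charged × Neutral) : State := (w.1.1, w.1.2.1, w.1.2.2, w.2.1, w.2.2)

set_option synthInstance.maxSize 1000 in
instance instSFiniteCharged : SFinite (volume : Measure Charged) :=
  inferInstanceAs (SFinite (Measure.prod _ _))

instance instSFiniteNeutral : SFinite (volume : Measure Neutral) :=
  inferInstanceAs (SFinite (Measure.prod _ _))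

set_option synthInstance.maxSize 1000 in
lemma measurePreserving_join : MeasurePreserving join volume volume :=
  (measurePreserving_map_right (A := Conf Gamma1) (measurePreserving_assoc (A := Conf Gamma1)
    (B := Conf Gamma1) (C := Neutral))).comp
    (measurePreserving_assoc (A := Conf Gamma1) (B := Conf Gamma1 × Conf Gamma1) (C := Neutral))

/-- The quantum numbers of the charged leptons in the form integrals: those of the electron and
the muon or antimuon which take part in the interaction and those of the spectators. -/
abbrev Outer : Type := Gamma1 × Gamma1 × Charged

/-- The quantum numbers of the neutrinos and antineutrinos in the form integrals. -/
abbrev Inner : Type := Momentum × Momentum × Neutral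

set_option synthInstance.maxSize 1000 in
instance instMeasureSpaceOuter : MeasureSpace Outer := Measure.prod.measureSpace

set_option synthInstance.maxSize 1000 in
instance instSFiniteOuter : SFinite (volume : Measure Outer) :=
  inferInstanceAs (SFinite (Measure.prod _ _))

/-- The separation of the integration variables into those of the charged leptons and those of
the neutrinos. -/
def arrange (w : Outer × Inner) : FormVar :=
  (w.1.1, w.1.2.1, w.2.1, w.2.2.1, join (w.1.2.2, w.2.2.2))

set_option synthInstance.maxSize 1000 in
lemma measurePreserving_arrange_formVar : MeasurePreserving arrange volume volume :=
  measurePreserving_arrange (A := Gamma1) (B := Gamma1) (P := Momentum) measurePreserving_join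

/-! ### Factorization of the kernels -/

/-- The factor of the kernels which depends on the momentum of the neutrino `ν_μ`, with its share
of the phase `e^{-i x² r²}`. -/
def neutrinoFactor (Γ : Fin 4 → Matrix (Fin 4) (Fin 4) ℂ) (S : ℝ → Fin 4 → ℂ) (α : Fin 4) (x : ℝ)
    (p : Momentum) : ℂ :=
  Complex.exp (-(Complex.I * ((x * p 1 : ℝ) : ℂ))) * bracket (spinorNu p) (Γ α) (S x)

/-- The factor of the kernels which depends on the momentum of the antineutrino `ν̄_e`, with its
share of the phase `e^{-i x² r²}`. -/
def antineutrinoFactor (Γ : Fin 4 → Matrix (Fin 4) (Fin 4) ℂ) (T : ℝ → Fin 4 → ℂ) (α : Fin 4)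
    (x : ℝ) (p : Momentum) : ℂ :=
  Complex.exp (-(Complex.I * ((x * p 1 : ℝ) : ℂ))) * bracket (T x) (Γ α) (spinorAntiNu p)

/-- `‖γ^0 Γ (1 - γ₅)‖`. -/
def vertexNorm (Γ : Matrix (Fin 4) (Fin 4) ℂ) : ℝ≥0∞ :=
  ENNReal.ofReal (opNorm (gammaUp 0 * Γ * (1 - gamma5)))

lemma enorm_phase (t : ℝ) : ‖Complex.exp (-(Complex.I * (t : ℂ)))‖ₑ = 1 := by
  rw [← ofReal_norm, Complex.norm_exp]
  simp

lemma enorm_neutrinoFactor_le (Γ : Fin 4 → Matrix (Fin 4) (Fin 4) ℂ) (S : ℝ → Fin 4 → ℂ)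
    (α : Fin 4) (x : ℝ) (p : Momentum) :
    ‖neutrinoFactor Γ S α x p‖ₑ ≤ vertexNorm (Γ α) * spinorNorm (S x) := by
  rw [neutrinoFactor, enorm_mul, enorm_phase, one_mul]
  refine (enorm_bracket_le _ _ _).trans (le_of_eq ?_)
  rw [spinorNorm_spinorNu, mul_one, vertexNorm]

lemma enorm_antineutrinoFactor_le (Γ : Fin 4 → Matrix (Fin 4) (Fin 4) ℂ) (T : ℝ → Fin 4 → ℂ)
    (α : Fin 4) (x : ℝ) (p : Momentum) :
    ‖antineutrinoFactor Γ T α x p‖ₑ ≤ vertexNorm (Γ α) * spinorNorm (T x) := by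
  rw [antineutrinoFactor, enorm_mul, enorm_phase, one_mul]
  refine (enorm_bracket_le _ _ _).trans (le_of_eq ?_)
  rw [spinorNorm_spinorAntiNu, mul_one, vertexNorm]

lemma measurable_phase : Measurable fun w : ℝ × Momentum =>
    Complex.exp (-(Complex.I * ((w.1 * w.2 1 : ℝ) : ℂ))) := by
  fun_prop

lemma measurable_neutrinoFactor {Y : Type*} [MeasurableSpace Y]
    (Γ : Fin 4 → Matrix (Fin 4) (Fin 4) ℂ) {S : ℝ → Y → Fin 4 → ℂ}
    (hS : ∀ i, Measurable fun w : ℝ × Y => S w.1 w.2 i) (α : Fin 4) :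
    Measurable fun w : Y × ℝ × Momentum => neutrinoFactor Γ (fun x => S x w.1) α w.2.1 w.2.2 := by
  refine (measurable_phase.comp measurable_snd).mul (measurable_bracket (fun i => ?_)
    (fun i => ?_) (Γ α))
  · exact (measurable_spinorNu i).comp (measurable_snd.comp measurable_snd)
  · exact (hS i).comp (f := fun w : Y × ℝ × Momentum => (w.2.1, w.1)) (by fun_prop)

lemma measurable_antineutrinoFactor {Y : Type*} [MeasurableSpace Y]
    (Γ : Fin 4 → Matrix (Fin 4) (Fin 4) ℂ) {T : ℝ → Y → Fin 4 → ℂ}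
    (hT : ∀ i, Measurable fun w : ℝ × Y => T w.1 w.2 i) (α : Fin 4) :
    Measurable fun w : Y × ℝ × Momentum =>
      antineutrinoFactor Γ (fun x => T x w.1) α w.2.1 w.2.2 := by
  refine (measurable_phase.comp measurable_snd).mul (measurable_bracket (fun i => ?_)
    (fun i => ?_) (Γ α))
  · exact (hT i).comp (f := fun w : Y × ℝ × Momentum => (w.2.1, w.1)) (by fun_prop)
  · exact (measurable_spinorAntiNu i).comp (measurable_snd.comp measurable_snd)

/-- Both kernels are superpositions of products, since the phase factorizes. -/
lemma superposition_factor_eq (Γ Γ' : Fin 4 → Matrix (Fin 4) (Fin 4) ℂ) (S T : ℝ → Fin 4 → ℂ)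
    (p₃ p₄ : Momentum) :
    superposition (neutrinoFactor Γ S) (antineutrinoFactor Γ' T) p₃ p₄ =
      ∫ x : ℝ, Complex.exp (-(Complex.I * ((x * (p₃ 1 + p₄ 1) : ℝ) : ℂ))) *
        ∑ α : Fin 4, bracket (spinorNu p₄) (Γ α) (S x) *
          bracket (T x) (Γ' α) (spinorAntiNu p₃) := by
  unfold superposition
  congr 1; funext x
  have h : Complex.exp (-(Complex.I * ((x * (p₃ 1 + p₄ 1) : ℝ) : ℂ))) =
      Complex.exp (-(Complex.I * ((x * p₄ 1 : ℝ) : ℂ))) *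
        Complex.exp (-(Complex.I * ((x * p₃ 1 : ℝ) : ℂ))) := by
    rw [← Complex.exp_add]
    congr 1
    push_cast
    ring
  rw [h, Finset.mul_sum]
  refine Finset.sum_congr rfl fun α _ => ?_
  simp only [neutrinoFactor, antineutrinoFactor]
  ring

lemma vertexNorm_ne_top (Γ : Matrix (Fin 4) (Fin 4) ℂ) : vertexNorm Γ ≠ ∞ := ENNReal.ofReal_ne_top

lemma opNorm_nonneg (A : Matrix (Fin 4) (Fin 4) ℂ) : 0 ≤ opNorm A := norm_nonneg _

lemma constC_nonneg : 0 ≤ constC :=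
  Finset.sum_nonneg fun _ _ => mul_nonneg (opNorm_nonneg _) (opNorm_nonneg _)

lemma sum_vertexNorm : ∑ α, vertexNorm (gammaDown α) * vertexNorm (gammaUp α) =
    ENNReal.ofReal constC := by
  rw [constC, ENNReal.ofReal_sum_of_nonneg fun _ _ => mul_nonneg (opNorm_nonneg _)
    (opNorm_nonneg _)]
  refine Finset.sum_congr rfl fun α _ => ?_
  rw [vertexNorm, vertexNorm, ← ENNReal.ofReal_mul (opNorm_nonneg _)]

lemma sum_vertexNorm' : ∑ α, vertexNorm (gammaUp α) * vertexNorm (gammaDown α) =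
    ENNReal.ofReal constC := by
  rw [← sum_vertexNorm]
  exact Finset.sum_congr rfl fun α _ => mul_comm _ _

/-! ### Square norms over the neutrino configurations -/

/-- The square norm of a wave function for fixed charged leptons. -/
def fiberNorm (Ψ : State → ℂ) (r : Charged) : ℝ≥0∞ := ∫⁻ c : Neutral, ‖Ψ (join (r, c))‖ₑ ^ 2

lemma measurable_fiberNorm {Ψ : State → ℂ} (hΨ : Measurable Ψ) : Measurable (fiberNorm Ψ) := by
  have h : Measurable fun w : Charged × Neutral => ‖Ψ (join w)‖ₑ ^ 2 :=
    (hΨ.comp measurePreserving_join.measurable).enorm.pow_const 2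
  exact h.lintegral_prod_right'

lemma lintegral_fiberNorm {Ψ : State → ℂ} (hΨ : Measurable Ψ) :
    ∫⁻ r, fiberNorm Ψ r = ∫⁻ c, ‖Ψ c‖ₑ ^ 2 := by
  have h : Measurable fun w : Charged × Neutral => ‖Ψ (join w)‖ₑ ^ 2 :=
    (hΨ.comp measurePreserving_join.measurable).enorm.pow_const 2
  rw [← measurePreserving_join.lintegral_comp (hΨ.enorm.pow_const 2)]
  exact (lintegral_prod _ h.aemeasurable).symm

/-- The square norm of a coefficient function in the neutrino momentum. -/
def cutoffNorm (F : Cutoff) (ξ : Gamma1) : ℝ≥0∞ := ∫⁻ p : Momentum, ‖F (ξ, p)‖ₑ ^ 2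

lemma measurable_cutoff (F : Cutoff) : Measurable F := (Lp.stronglyMeasurable F).measurable

lemma measurable_cutoffNorm (F : Cutoff) : Measurable (cutoffNorm F) :=
  ((measurable_cutoff F).enorm.pow_const 2).lintegral_prod_right'

lemma lintegral_cutoffNorm (F : Cutoff) : ∫⁻ ξ, cutoffNorm F ξ = ENNReal.ofReal (‖F‖ ^ 2) := by
  have h := ofReal_norm_toLp_sq (Lp.memLp F)
  rw [Lp.toLp_coeFn] at h
  rw [h]
  exact (lintegral_prod _ ((measurable_cutoff F).enorm.pow_const 2).aemeasurable).symm

/-! ### Estimates of the form integrals -/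

/-- The map `arrange` as an isomorphism of measurable spaces. -/
def arrangeEquiv : Outer × Inner ≃ᵐ FormVar where
  toFun := arrange
  invFun y := ((y.1, y.2.1, y.2.2.2.2.1, y.2.2.2.2.2.1, y.2.2.2.2.2.2.1),
    (y.2.2.1, y.2.2.2.1, y.2.2.2.2.2.2.2.1, y.2.2.2.2.2.2.2.2))
  left_inv _ := rfl
  right_inv _ := rfl
  measurable_toFun := measurePreserving_arrange_formVar.measurable
  measurable_invFun := by
    refine Measurable.prodMk (Measurable.prodMk ?_ (Measurable.prodMk ?_ (Measurable.prodMk ?_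
      (Measurable.prodMk ?_ ?_)))) (Measurable.prodMk ?_ (Measurable.prodMk ?_
      (Measurable.prodMk ?_ ?_))) <;> fun_prop

lemma particleNumber_join (r : Charged) (c : Neutral) :
    c.1.1 + c.2.1 ≤ particleNumber (join (r, c)) := by
  simp only [particleNumber, join]
  omega

set_option synthInstance.maxSize 1000 in
/-- The estimate common to the form integrals of both kernels. The maps `e₁` and `e₂` give the
charged leptons at which `Ψ₁` and `Ψ₂` are evaluated, and `σ` collects the signs of the
annihilation operators. -/
lemma formIntegral_estimate {Γ Γ' : Fin 4 → Matrix (Fin 4) (Fin 4) ℂ}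
    {S T : ℝ → Gamma1 → Fin 4 → ℂ} (hS : ∀ i, Measurable fun w : ℝ × Gamma1 => S w.1 w.2 i)
    (hT : ∀ i, Measurable fun w : ℝ × Gamma1 => T w.1 w.2 i)
    (hS1 : ∀ ξ, ∫⁻ x, spinorNorm (S x ξ) ^ 2 ≤ 1) (hT1 : ∀ ξ, ∫⁻ x, spinorNorm (T x ξ) ^ 2 ≤ 1)
    (F G : Cutoff) {Ψ₁ Ψ₂ : State → ℂ} (h₁ : Measurable Ψ₁) (h₂ : Measurable Ψ₂)
    (hanti : ∀ r, AntisymmPair fun c => Ψ₁ (join (r, c))) {n : ℕ}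
    (hn : (∀ c, n < particleNumber c → Ψ₁ c = 0) ∨ ∀ c, n < particleNumber c → Ψ₂ c = 0)
    {e₁ e₂ : Outer → Charged} (he₁ : Measurable e₁) (he₂ : Measurable e₂)
    {σ : Outer → Neutral → ℂ} (hσ : Measurable fun w : Outer × Neutral => σ w.1 w.2)
    (hσ1 : ∀ z c, ‖σ z c‖ₑ = 1) {s t : Outer → ℝ≥0∞} (hs : Measurable s) (ht : Measurable t)
    (hst : ∀ z, cutoffNorm F z.2.1 * (cutoffNorm G z.1 * fiberNorm Ψ₁ (e₁ z)) *
      fiberNorm Ψ₂ (e₂ z) = s z * t z) {a b : ℝ≥0∞} (ha : a ≠ ∞) (hb : b ≠ ∞)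
    (hs1 : ∫⁻ z, s z ≤ a) (ht1 : ∫⁻ z, t z ≤ b) {J : FormVar → ℂ}
    (hJ : ∀ w : Outer × Inner, J (arrange w) =
      superposition (neutrinoFactor Γ fun x => S x w.1.2.1)
        (antineutrinoFactor Γ' fun x => T x w.1.1) w.2.1 w.2.2.1 *
        (F (w.1.2.1, w.2.2.1) * G (w.1.1, w.2.1) *
          (star (annPair (fun c => Ψ₁ (join (e₁ w.1, c))) w.2.1 w.2.2.1 w.2.2.2) *
            (σ w.1 w.2.2.2 * Ψ₂ (join (e₂ w.1, w.2.2.2)))))) :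
    Integrable J ∧
      ‖∫ y, J y‖ₑ ^ 2 ≤ (∑ α, vertexNorm (Γ α) * vertexNorm (Γ' α)) ^ 2 * (a * b) := by
  have hj : Measurable join := measurePreserving_join.measurable
  have hFfin : ∀ᵐ ξ, cutoffNorm F ξ ≠ ∞ := by
    filter_upwards [ae_lt_top (measurable_cutoffNorm F)
      (by rw [lintegral_cutoffNorm]; exact ENNReal.ofReal_ne_top)] with ξ h using h.ne
  have hGfin : ∀ᵐ ξ, cutoffNorm G ξ ≠ ∞ := by
    filter_upwards [ae_lt_top (measurable_cutoffNorm G)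
      (by rw [lintegral_cutoffNorm]; exact ENNReal.ofReal_ne_top)] with ξ h using h.ne
  have hsnd : Measure.QuasiMeasurePreserving (fun z : Outer => z.2.1) volume volume :=
    (Measure.quasiMeasurePreserving_fst (μ := (volume : Measure Gamma1))
      (ν := (volume : Measure Charged))).comp Measure.quasiMeasurePreserving_snd
  have key := integrable_superposition_annPair (X := Momentum) (Z := Outer)
    (a := fun z => neutrinoFactor Γ fun x => S x z.2.1)
    (b := fun z => antineutrinoFactor Γ' fun x => T x z.1)
    (A := fun α => vertexNorm (Γ α)) (B := fun α => vertexNorm (Γ' α))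
    (u := fun z x => spinorNorm (S x z.2.1)) (v := fun z x => spinorNorm (T x z.1))
    (fun α => (measurable_neutrinoFactor Γ hS α).comp
      (f := fun w : Outer × ℝ × Momentum => (w.1.2.1, w.2)) (by fun_prop))
    (fun α => (measurable_antineutrinoFactor Γ' hT α).comp
      (f := fun w : Outer × ℝ × Momentum => (w.1.1, w.2)) (by fun_prop))
    (fun z α x p => enorm_neutrinoFactor_le Γ (fun x => S x z.2.1) α x p)
    (fun z α x p => enorm_antineutrinoFactor_le Γ' (fun x => T x z.1) α x p)
    (fun α => vertexNorm_ne_top _) (fun α => vertexNorm_ne_top _)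
    (fun z => measurable_spinorNorm fun i => (hS i).comp measurable_prodMk_right)
    (fun z => measurable_spinorNorm fun i => (hT i).comp measurable_prodMk_right)
    (fun z => hS1 z.2.1) (fun z => hT1 z.1)
    (f := fun z p => F (z.2.1, p)) (g := fun z p => G (z.1, p))
    ((measurable_cutoff F).comp (f := fun w : Outer × Momentum => (w.1.2.1, w.2)) (by fun_prop))
    ((measurable_cutoff G).comp (f := fun w : Outer × Momentum => (w.1.1, w.2)) (by fun_prop))
    (hsnd.ae hFfin)
    ((Measure.quasiMeasurePreserving_fst (μ := (volume : Measure Gamma1))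
      (ν := (volume : Measure (Gamma1 × Charged)))).ae hGfin)
    (θ := fun z c => Ψ₁ (join (e₁ z, c))) (η := fun z c => σ z c * Ψ₂ (join (e₂ z, c)))
    (h₁.comp (hj.comp ((he₁.comp measurable_fst).prodMk measurable_snd)))
    (hσ.mul (h₂.comp (hj.comp ((he₂.comp measurable_fst).prodMk measurable_snd))))
    (fun z => hanti (e₁ z)) (N := ((n : ℝ≥0∞) + 1) * (n + 1))
    (ENNReal.mul_ne_top (by simp) (by simp)) ?_ hs ht ?_
    (ne_top_of_le_ne_top ha hs1) (ne_top_of_le_ne_top hb ht1)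
  · obtain ⟨k₁, k₂⟩ := key
    have hmp : MeasurePreserving arrangeEquiv volume volume := measurePreserving_arrange_formVar
    have hJ' : J ∘ arrangeEquiv = fun w => J (arrange w) := rfl
    simp_rw [← hJ] at k₁ k₂
    refine ⟨?_, ?_⟩
    · rw [← hmp.integrable_comp_emb arrangeEquiv.measurableEmbedding]
      exact k₁
    · rw [← hmp.integral_comp arrangeEquiv.measurableEmbedding]
      refine k₂.trans ?_
      gcongr
  · intro z p₃ p₄ c hc
    have hle : c.1.1 ≤ n ∧ c.2.1 ≤ n := by
      by_contra hcon
      refine hc ?_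
      rcases hn with hn | hn
      · have h := particleNumber_join (e₁ z) (c.1.insert p₄, c.2.insert p₃)
        rw [hn _ (lt_of_lt_of_le _ h), zero_mul]
        simp only [Conf.insert]
        omega
      · have h := particleNumber_join (e₂ z) c
        rw [hn _ (lt_of_lt_of_le _ h), mul_zero, mul_zero]
        omega
    gcongr
    · exact hle.2
    · exact hle.1
  · intro z
    rw [← hst z]
    simp only [fiberNorm, cutoffNorm, enorm_mul, hσ1, one_mul]

/-! ### Weights in the numbers of charged leptons -/

/-- Multiplication of a wave function by a function of the charged leptons. -/
def weighted (w : Charged → ℝ) (ψ : State → ℂ) (c : State) : ℂ :=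
  (w (c.1, c.2.1, c.2.2.1) : ℂ) * ψ c

lemma measurable_weighted {w : Charged → ℝ} (hw : Measurable w) {ψ : State → ℂ}
    (hψ : Measurable ψ) : Measurable (weighted w ψ) :=
  (Complex.measurable_ofReal.comp (hw.comp (f := fun c : State => (c.1, c.2.1, c.2.2.1))
    (by fun_prop))).mul hψ

lemma antisymmPair_weighted (w : Charged → ℝ) {ψ : State → ℂ}
    (h : ∀ r, AntisymmPair fun c => ψ (join (r, c))) (r : Charged) :
    AntisymmPair fun c => weighted w ψ (join (r, c)) := by
  refine ⟨fun c n σ x => ?_, fun c n σ x => ?_⟩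
  · have := (h r).1 c n σ x
    simp only at this
    simp only [weighted, this]
    exact mul_left_comm _ _ _
  · have := (h r).2 c n σ x
    simp only at this
    simp only [weighted, this]
    exact mul_left_comm _ _ _

lemma weighted_eq_zero {w : Charged → ℝ} {ψ : State → ℂ} {n : ℕ}
    (h : ∀ c, n < particleNumber c → ψ c = 0) (c : State) (hc : n < particleNumber c) :
    weighted w ψ c = 0 := by
  rw [weighted, h c hc, mul_zero]

/-- The charged leptons together with the electron `ξ₁`. -/
def addElectron (z : Outer) : Charged := (z.2.2.1.insert z.1, z.2.2.2)

/-- The charged leptons together with the muon `ξ₂`. -/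
def addMuon (z : Outer) : Charged := (z.2.2.1, z.2.2.2.1.insert z.2.1, z.2.2.2.2)

/-- The charged leptons together with the electron `ξ₁` and the antimuon `ξ₂`. -/
def addElectronAntimuon (z : Outer) : Charged :=
  (z.2.2.1.insert z.1, z.2.2.2.1, z.2.2.2.2.insert z.2.1)

set_option synthInstance.maxSize 1000 in
lemma subpreserving_addElectron :
    Subpreserving (fun z : Outer => (z.2.1, addElectron z)) volume volume :=
  subpreserving_skip (X := Gamma1) (A := Gamma1) (R := Charged) (R' := Charged)
    (subpreserving_insert_fst (X := Gamma1) (R := Conf Gamma1 × Conf Gamma1))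

set_option synthInstance.maxSize 1000 in
lemma subpreserving_addMuon :
    Subpreserving (fun z : Outer => (z.1, addMuon z)) volume volume :=
  (Subpreserving.id (volume : Measure Gamma1)).prodMap
    (subpreserving_skip (X := Gamma1) (A := Conf Gamma1) (R := Conf Gamma1 × Conf Gamma1)
      (R' := Conf Gamma1 × Conf Gamma1)
      (subpreserving_insert_fst (X := Gamma1) (R := Conf Gamma1)))

set_option synthInstance.maxSize 1000 in
lemma subpreserving_addElectronAntimuon :
    Subpreserving addElectronAntimuon volume volume :=
  (subpreserving_insert_fst (X := Gamma1) (R := Conf Gamma1 × Conf Gamma1)).comp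
    ((Subpreserving.id (volume : Measure Gamma1)).prodMap
      (subpreserving_skip (X := Gamma1) (A := Conf Gamma1) (R := Conf Gamma1 × Conf Gamma1)
        (R' := Conf Gamma1 × Conf Gamma1)
        (subpreserving_skip (X := Gamma1) (A := Conf Gamma1) (R := Conf Gamma1)
          (R' := Conf Gamma1) (subpreserving_insert (X := Gamma1)))))

/-- The product of the signs in `b_-(ξ₃) b_+(ξ₁) b_+(ξ₄)` and `b_+(ξ₂)`. -/
def sign₁ (z : Outer) (c : Neutral) : ℂ :=
  (-1) ^ (z.2.2.1.1 + z.2.2.2.1.1 + z.2.2.2.2.1 + c.1.1) *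
    (-1) ^ (z.2.2.1.1 + 1 + z.2.2.2.1.1 + z.2.2.2.2.1) * (-1) ^ z.2.2.1.1

/-- The product of the signs in `b_-(ξ₃) b_+(ξ₁) b_-(ξ₂) b_+(ξ₄)`. -/
def sign₂ (z : Outer) (c : Neutral) : ℂ :=
  (-1) ^ (z.2.2.1.1 + z.2.2.2.1.1 + z.2.2.2.2.1 + c.1.1) *
    (-1) ^ (z.2.2.1.1 + 1 + z.2.2.2.1.1) *
    (-1) ^ (z.2.2.1.1 + 1 + z.2.2.2.1.1 + (z.2.2.2.2.1 + 1))

lemma enorm_sign₁ (z : Outer) (c : Neutral) : ‖sign₁ z c‖ₑ = 1 := by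
  simp [sign₁, enorm_mul, enorm_pow]

lemma enorm_sign₂ (z : Outer) (c : Neutral) : ‖sign₂ z c‖ₑ = 1 := by
  simp [sign₂, enorm_mul, enorm_pow]

lemma measurable_neg_one_pow {Y : Type*} [MeasurableSpace Y] {f : Y → ℕ} (hf : Measurable f) :
    Measurable fun y => (-1 : ℂ) ^ f y :=
  (measurable_of_countable fun k : ℕ => (-1 : ℂ) ^ k).comp hf

lemma measurable_numbers :
    (Measurable fun w : Outer × Neutral => w.1.2.2.1.1) ∧
    (Measurable fun w : Outer × Neutral => w.1.2.2.2.1.1) ∧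
    (Measurable fun w : Outer × Neutral => w.1.2.2.2.2.1) ∧
    Measurable fun w : Outer × Neutral => w.2.1.1 := by
  refine ⟨measurable_fst_conf.comp ?_, measurable_fst_conf.comp ?_, measurable_fst_conf.comp ?_,
    measurable_fst_conf.comp ?_⟩ <;> fun_prop

lemma measurable_sign₁ : Measurable fun w : Outer × Neutral => sign₁ w.1 w.2 := by
  obtain ⟨h₁, h₂, h₃, h₄⟩ := measurable_numbers
  exact ((measurable_neg_one_pow (((h₁.add h₂).add h₃).add h₄)).mul
    (measurable_neg_one_pow (((h₁.add_const 1).add h₂).add h₃))).mul (measurable_neg_one_pow h₁)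

lemma measurable_sign₂ : Measurable fun w : Outer × Neutral => sign₂ w.1 w.2 := by
  obtain ⟨h₁, h₂, h₃, h₄⟩ := measurable_numbers
  exact ((measurable_neg_one_pow (((h₁.add h₂).add h₃).add h₄)).mul
    (measurable_neg_one_pow ((h₁.add_const 1).add h₂))).mul
    (measurable_neg_one_pow (((h₁.add_const 1).add h₂).add (h₃.add_const 1)))

lemma star_neg_one_pow (k : ℕ) : star ((-1 : ℂ) ^ k) = (-1) ^ k := by simp

lemma star_ofReal (x : ℝ) : star (x : ℂ) = x := Complex.conj_ofReal x

/-- The factors `√n` of the charged leptons in `(ψ₁, H_I^{(1)} ψ₂)` may be distributed over `ψ₁`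
and `ψ₂`. -/
lemma integrand₁_arrange (mₑ mμ e B : ℝ) (F G : Cutoff) (ψ₁ ψ₂ : State → ℂ)
    {w₁ w₂ : Charged → ℝ} (hw : ∀ z : Outer, w₁ (addElectron z) * w₂ (addMuon z) =
      Real.sqrt (z.2.2.1.1 + 1) * Real.sqrt (z.2.2.2.1.1 + 1)) (w : Outer × Inner) :
    integrand₁ mₑ mμ e B F G ψ₁ ψ₂ (arrange w) =
      superposition (neutrinoFactor gammaUp fun x => spinorU mμ e B x w.1.2.1)
        (antineutrinoFactor gammaDown fun x => spinorU mₑ e B x w.1.1) w.2.1 w.2.2.1 *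
        (F (w.1.2.1, w.2.2.1) * G (w.1.1, w.2.1) *
          (star (annPair (fun c => weighted w₁ ψ₁ (join (addElectron w.1, c)))
            w.2.1 w.2.2.1 w.2.2.2) *
            (sign₁ w.1 w.2.2.2 * weighted w₂ ψ₂ (join (addMuon w.1, w.2.2.2))))) := by
  obtain ⟨⟨ξ₁, ξ₂, r⟩, p₃, p₄, c⟩ := w
  have hw' := congrArg (fun x : ℝ => (x : ℂ)) (hw (ξ₁, ξ₂, r))
  simp only [Complex.ofReal_mul] at hw'
  rw [superposition_factor_eq]
  simp only [integrand₁, kernel₁, arrange, join, annA, annE, annN, annM, addA, addE, addN, addM,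
    annPair, weighted, sign₁, addElectron, addMuon, Conf.insert, star_mul', star_neg_one_pow,
    star_ofReal] at hw' ⊢
  generalize (∫ x : ℝ, _ : ℂ) = K
  linear_combination (-(K * F (ξ₂, p₄) * G (ξ₁, p₃)) *
    ((-1) ^ (r.1.1 + r.2.1.1 + r.2.2.1 + c.1.1) *
    (-1) ^ (r.1.1 + 1 + r.2.1.1 + r.2.2.1) * (-1) ^ r.1.1) *
    (Real.sqrt (c.2.1 + 1) : ℂ) * (Real.sqrt (c.1.1 + 1) : ℂ) *
    star (ψ₁ (⟨r.1.1 + 1, Fin.cons ξ₁ r.1.2⟩, r.2.1, r.2.2, ⟨c.1.1 + 1, Fin.cons p₄ c.1.2⟩,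
      ⟨c.2.1 + 1, Fin.cons p₃ c.2.2⟩)) *
    ψ₂ (r.1, ⟨r.2.1.1 + 1, Fin.cons ξ₂ r.2.1.2⟩, r.2.2, c.1, c.2)) * hw'

/-- The factors `√n` of the charged leptons in `(ψ₁, H_I^{(2)} ψ₂)` may be distributed over `ψ₁`
and `ψ₂`. -/
lemma integrand₂_arrange (mₑ mμ e B : ℝ) (F G : Cutoff) (ψ₁ ψ₂ : State → ℂ)
    {w₁ w₂ : Charged → ℝ} (hw : ∀ z : Outer, w₁ (addElectronAntimuon z) * w₂ z.2.2 =
      Real.sqrt (z.2.2.1.1 + 1) * Real.sqrt (z.2.2.2.2.1 + 1)) (w : Outer × Inner) :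
    integrand₂ mₑ mμ e B F G ψ₁ ψ₂ (arrange w) =
      superposition (neutrinoFactor gammaDown fun x => spinorW mμ e B x w.1.2.1)
        (antineutrinoFactor gammaUp fun x => spinorU mₑ e B x w.1.1) w.2.1 w.2.2.1 *
        (F (w.1.2.1, w.2.2.1) * G (w.1.1, w.2.1) *
          (star (annPair (fun c => weighted w₁ ψ₁ (join (addElectronAntimuon w.1, c)))
            w.2.1 w.2.2.1 w.2.2.2) *
            (sign₂ w.1 w.2.2.2 * weighted w₂ ψ₂ (join (w.1.2.2, w.2.2.2))))) := by
  obtain ⟨⟨ξ₁, ξ₂, r⟩, p₃, p₄, c⟩ := w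
  have hw' := congrArg (fun x : ℝ => (x : ℂ)) (hw (ξ₁, ξ₂, r))
  simp only [Complex.ofReal_mul] at hw'
  rw [superposition_factor_eq]
  simp only [integrand₂, kernel₂, arrange, join, annA, annE, annN, annP, addA, addE, addN, addP,
    annPair, weighted, sign₂, addElectronAntimuon, Conf.insert, star_mul', star_neg_one_pow,
    star_ofReal] at hw' ⊢
  generalize (∫ x : ℝ, _ : ℂ) = K
  linear_combination (-(K * F (ξ₂, p₄) * G (ξ₁, p₃)) *
    ((-1) ^ (r.1.1 + r.2.1.1 + r.2.2.1 + c.1.1) * (-1) ^ (r.1.1 + 1 + r.2.1.1) *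
    (-1) ^ (r.1.1 + 1 + r.2.1.1 + (r.2.2.1 + 1))) *
    (Real.sqrt (c.2.1 + 1) : ℂ) * (Real.sqrt (c.1.1 + 1) : ℂ) *
    star (ψ₁ (⟨r.1.1 + 1, Fin.cons ξ₁ r.1.2⟩, r.2.1, ⟨r.2.2.1 + 1, Fin.cons ξ₂ r.2.2.2⟩,
      ⟨c.1.1 + 1, Fin.cons p₄ c.1.2⟩, ⟨c.2.1 + 1, Fin.cons p₃ c.2.2⟩)) *
    ψ₂ (r.1, r.2.1, r.2.2, c.1, c.2)) * hw'

/-! ### Estimates for the two kernels -/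

section Estimates

variable {mₑ mμ e B : ℝ} (hmₑ : 0 < mₑ) (hmμ : 0 < mμ) (he : 0 < e) (hB : 0 < B) (F G : Cutoff)
  {ψ₁ ψ₂ : State → ℂ} (h₁ : Measurable ψ₁) (h₂ : Measurable ψ₂)
  (hanti : ∀ r, AntisymmPair fun c => ψ₁ (join (r, c))) {n : ℕ}
  (hn : (∀ c, n < particleNumber c → ψ₁ c = 0) ∨ ∀ c, n < particleNumber c → ψ₂ c = 0)
  {w₁ w₂ : Charged → ℝ} (hw₁ : Measurable w₁) (hw₂ : Measurable w₂)
  (hf₁ : ∫⁻ c, ‖weighted w₁ ψ₁ c‖ₑ ^ 2 ≠ ∞) (hf₂ : ∫⁻ c, ‖weighted w₂ ψ₂ c‖ₑ ^ 2 ≠ ∞)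

lemma measurable_cutoffNorm_mul_fiberNorm (F : Cutoff) {Ψ : State → ℂ} (hΨ : Measurable Ψ) :
    Measurable fun y : Gamma1 × Charged => cutoffNorm F y.1 * fiberNorm Ψ y.2 :=
  ((measurable_cutoffNorm F).comp measurable_fst).mul
    ((measurable_fiberNorm hΨ).comp measurable_snd)

lemma lintegral_cutoffNorm_mul_fiberNorm (F : Cutoff) {Ψ : State → ℂ} (hΨ : Measurable Ψ) :
    ∫⁻ y : Gamma1 × Charged, cutoffNorm F y.1 * fiberNorm Ψ y.2 =
      ENNReal.ofReal (‖F‖ ^ 2) * ∫⁻ c, ‖Ψ c‖ₑ ^ 2 := by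
  rw [← lintegral_cutoffNorm, ← lintegral_fiberNorm hΨ]
  exact lintegral_prod_mul (measurable_cutoffNorm F).aemeasurable
    (measurable_fiberNorm hΨ).aemeasurable

include hmₑ hmμ he hB h₁ h₂ hanti hn hw₁ hw₂ hf₁ hf₂ in
/-- In the Cauchy–Schwarz inequality for the charged leptons, `F(ξ₂, ·)` goes with `ψ₁`, whose
electron `ξ₁` is annihilated, and `G(ξ₁, ·)` with `ψ₂`, whose muon `ξ₂` is annihilated, so that the
variables separate in either factor. -/
lemma integrand₁_estimate (hw : ∀ z : Outer, w₁ (addElectron z) * w₂ (addMuon z) =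
      Real.sqrt (z.2.2.1.1 + 1) * Real.sqrt (z.2.2.2.1.1 + 1)) :
    Integrable (integrand₁ mₑ mμ e B F G ψ₁ ψ₂) ∧
      ‖∫ y, integrand₁ mₑ mμ e B F G ψ₁ ψ₂ y‖ₑ ^ 2 ≤ ENNReal.ofReal constC ^ 2 *
        (ENNReal.ofReal (‖F‖ ^ 2) * ENNReal.ofReal (‖G‖ ^ 2) *
          ((∫⁻ c, ‖weighted w₁ ψ₁ c‖ₑ ^ 2) * ∫⁻ c, ‖weighted w₂ ψ₂ c‖ₑ ^ 2)) := by
  have hΨ₁ := measurable_weighted hw₁ h₁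
  have hΨ₂ := measurable_weighted hw₂ h₂
  have hs := measurable_cutoffNorm_mul_fiberNorm F hΨ₁
  have ht := measurable_cutoffNorm_mul_fiberNorm G hΨ₂
  have hs' : Measurable fun z : Outer =>
      cutoffNorm F z.2.1 * fiberNorm (weighted w₁ ψ₁) (addElectron z) :=
    hs.comp (f := fun z : Outer => (z.2.1, addElectron z)) subpreserving_addElectron.measurable
  have ht' : Measurable fun z : Outer =>
      cutoffNorm G z.1 * fiberNorm (weighted w₂ ψ₂) (addMuon z) :=
    ht.comp (f := fun z : Outer => (z.1, addMuon z)) subpreserving_addMuon.measurable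
  have hs1 : ∫⁻ z : Outer, cutoffNorm F z.2.1 * fiberNorm (weighted w₁ ψ₁) (addElectron z) ≤ _ :=
    (subpreserving_addElectron.lintegral_le _ hs).trans
      (lintegral_cutoffNorm_mul_fiberNorm F hΨ₁).le
  have ht1 : ∫⁻ z : Outer, cutoffNorm G z.1 * fiberNorm (weighted w₂ ψ₂) (addMuon z) ≤ _ :=
    (subpreserving_addMuon.lintegral_le _ ht).trans
      (lintegral_cutoffNorm_mul_fiberNorm G hΨ₂).le
  have key := formIntegral_estimate (Γ := gammaUp) (Γ' := gammaDown)
    (S := spinorU mμ e B) (T := spinorU mₑ e B) (measurable_spinorU mμ e B)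
    (measurable_spinorU mₑ e B) (lintegral_spinorU_le hmμ he hB) (lintegral_spinorU_le hmₑ he hB)
    F G hΨ₁ hΨ₂ (antisymmPair_weighted w₁ hanti) (n := n)
    (hn.imp (fun h => weighted_eq_zero h) fun h => weighted_eq_zero h)
    (e₁ := addElectron) (e₂ := addMuon)
    (measurable_snd.comp (f := fun z : Outer => (z.2.1, addElectron z))
      subpreserving_addElectron.measurable)
    (measurable_snd.comp (f := fun z : Outer => (z.1, addMuon z)) subpreserving_addMuon.measurable)
    measurable_sign₁ enorm_sign₁
    (s := fun z => cutoffNorm F z.2.1 * fiberNorm (weighted w₁ ψ₁) (addElectron z))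
    (t := fun z => cutoffNorm G z.1 * fiberNorm (weighted w₂ ψ₂) (addMuon z))
    hs' ht' (fun z => by ring)
    (ENNReal.mul_ne_top ENNReal.ofReal_ne_top hf₁) (ENNReal.mul_ne_top ENNReal.ofReal_ne_top hf₂)
    hs1 ht1
    (integrand₁_arrange mₑ mμ e B F G ψ₁ ψ₂ hw)
  refine ⟨key.1, key.2.trans (le_of_eq ?_)⟩
  rw [sum_vertexNorm']
  ring

set_option synthInstance.maxSize 1000 in
include hmₑ hmμ he hB h₁ h₂ hanti hn hw₁ hw₂ hf₁ hf₂ in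
/-- Both charged leptons `ξ₁` and `ξ₂` are annihilated in `ψ₁`, and therefore `F(ξ₂, ·)` and
`G(ξ₁, ·)` both go with `ψ₂` in the Cauchy–Schwarz inequality. -/
lemma integrand₂_estimate (hw : ∀ z : Outer, w₁ (addElectronAntimuon z) * w₂ z.2.2 =
      Real.sqrt (z.2.2.1.1 + 1) * Real.sqrt (z.2.2.2.2.1 + 1)) :
    Integrable (integrand₂ mₑ mμ e B F G ψ₁ ψ₂) ∧
      ‖∫ y, integrand₂ mₑ mμ e B F G ψ₁ ψ₂ y‖ₑ ^ 2 ≤ ENNReal.ofReal constC ^ 2 *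
        (ENNReal.ofReal (‖F‖ ^ 2) * ENNReal.ofReal (‖G‖ ^ 2) *
          ((∫⁻ c, ‖weighted w₁ ψ₁ c‖ₑ ^ 2) * ∫⁻ c, ‖weighted w₂ ψ₂ c‖ₑ ^ 2)) := by
  have hΨ₁ := measurable_weighted hw₁ h₁
  have hΨ₂ := measurable_weighted hw₂ h₂
  have hs := measurable_fiberNorm hΨ₁
  have hG := measurable_cutoffNorm_mul_fiberNorm G hΨ₂
  have hF := measurable_cutoffNorm F
  have ht : Measurable fun z : Outer => cutoffNorm F z.2.1 *
      (cutoffNorm G z.1 * fiberNorm (weighted w₂ ψ₂) z.2.2) :=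
    (hF.comp (by fun_prop)).mul (hG.comp (f := fun z : Outer => (z.1, z.2.2)) (by fun_prop))
  have ht1 : ∫⁻ z : Outer, cutoffNorm F z.2.1 *
      (cutoffNorm G z.1 * fiberNorm (weighted w₂ ψ₂) z.2.2) =
      ENNReal.ofReal (‖F‖ ^ 2) * (ENNReal.ofReal (‖G‖ ^ 2) *
        ∫⁻ c, ‖weighted w₂ ψ₂ c‖ₑ ^ 2) := by
    rw [← lintegral_cutoffNorm_mul_fiberNorm G hΨ₂, ← lintegral_cutoffNorm]
    have h := (measurePreserving_leftComm (X := Gamma1) (A := Gamma1)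
      (R := Charged)).lintegral_comp (f := fun y : Gamma1 × Gamma1 × Charged =>
        cutoffNorm F y.1 * (cutoffNorm G y.2.1 * fiberNorm (weighted w₂ ψ₂) y.2.2))
        ((hF.comp measurable_fst).mul (hG.comp measurable_snd))
    refine h.trans ?_
    exact lintegral_prod_mul (g := fun y : Gamma1 × Charged =>
      cutoffNorm G y.1 * fiberNorm (weighted w₂ ψ₂) y.2) hF.aemeasurable hG.aemeasurable
  have key := formIntegral_estimate (Γ := gammaDown) (Γ' := gammaUp)
    (S := spinorW mμ e B) (T := spinorU mₑ e B) (measurable_spinorW mμ e B)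
    (measurable_spinorU mₑ e B) (lintegral_spinorW_le hmμ he hB) (lintegral_spinorU_le hmₑ he hB)
    F G hΨ₁ hΨ₂ (antisymmPair_weighted w₁ hanti) (n := n)
    (hn.imp (fun h => weighted_eq_zero h) fun h => weighted_eq_zero h)
    (e₁ := addElectronAntimuon) (e₂ := fun z => z.2.2)
    subpreserving_addElectronAntimuon.measurable (by fun_prop)
    measurable_sign₂ enorm_sign₂
    (s := fun z => fiberNorm (weighted w₁ ψ₁) (addElectronAntimuon z))
    (t := fun z => cutoffNorm F z.2.1 * (cutoffNorm G z.1 * fiberNorm (weighted w₂ ψ₂) z.2.2))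
    (hs.comp subpreserving_addElectronAntimuon.measurable) ht
    (fun z => by ring)
    hf₁ (ENNReal.mul_ne_top ENNReal.ofReal_ne_top (ENNReal.mul_ne_top ENNReal.ofReal_ne_top hf₂))
    ((subpreserving_addElectronAntimuon.lintegral_le _ hs).trans (lintegral_fiberNorm hΨ₁).le)
    ht1.le (integrand₂_arrange mₑ mμ e B F G ψ₁ ψ₂ hw)
  refine ⟨key.1, key.2.trans (le_of_eq ?_)⟩
  rw [sum_vertexNorm]
  ring

end Estimates

/-! ### Representatives which are antisymmetric everywhere -/

/-- The family of permutations which is `p.2` in the sector `p.1` and trivial in the others. -/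
def permFamily (p : Σ n : ℕ, Equiv.Perm (Fin n)) : ∀ n : ℕ, Equiv.Perm (Fin n) :=
  Function.update (fun _ => 1) p.1 p.2

lemma permFamily_self (n : ℕ) (π : Equiv.Perm (Fin n)) : permFamily ⟨n, π⟩ n = π :=
  Function.update_self ..

lemma permState_inv_permState (σ : Fin 5 → ∀ n : ℕ, Equiv.Perm (Fin n)) (c : State) :
    permState (fun i n => (σ i n)⁻¹) (permState σ c) = c := by
  have h : ∀ {X : Type} (τ : ∀ n : ℕ, Equiv.Perm (Fin n)) (d : Conf X),
      (d.perm τ).perm (fun n => (τ n)⁻¹) = d := by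
    rintro X τ ⟨n, x⟩
    simp only [Conf.perm, Function.comp_assoc]
    congr 1
    funext i
    exact congrArg x ((τ n).apply_symm_apply i)
  simp only [permState, h]

lemma permState_permState (σ τ : Fin 5 → ∀ n : ℕ, Equiv.Perm (Fin n)) (c : State) :
    permState σ (permState τ c) = permState (fun i n => τ i n * σ i n) c := rfl

lemma signState_permState (σ τ : Fin 5 → ∀ n : ℕ, Equiv.Perm (Fin n)) (c : State) :
    signState (fun i n => τ i n * σ i n) c = signState σ (permState τ c) * signState τ c := by
  have h : ∀ a₀ a₁ a₂ a₃ a₄ b₀ b₁ b₂ b₃ b₄ : ℤˣ,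
      (((a₀ * b₀ * (a₁ * b₁) * (a₂ * b₂) * (a₃ * b₃) * (a₄ * b₄) : ℤˣ) : ℤ) : ℂ) =
        ((b₀ * b₁ * b₂ * b₃ * b₄ : ℤˣ) : ℤ) * ((a₀ * a₁ * a₂ * a₃ * a₄ : ℤˣ) : ℤ) := by
    intros
    push_cast
    ring
  simp only [signState, Equiv.Perm.sign_mul]
  exact h _ _ _ _ _ _ _ _ _ _

/-- A family indexed by the five species. -/
def tuple {A : Type*} (a₀ a₁ a₂ a₃ a₄ : A) : Fin 5 → A
  | 0 => a₀
  | 1 => a₁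
  | 2 => a₂
  | 3 => a₃
  | 4 => a₄

/-- The configurations at which a wave function is antisymmetric. -/
def antisymmSet (f : State → ℂ) : Set State :=
  {c | ∀ σ : Fin 5 → ∀ n : ℕ, Equiv.Perm (Fin n), f (permState σ c) = signState σ c * f c}

/-- Countably many families of permutations suffice, as only the permutations in the sector of the
given configuration matter. -/
lemma antisymmSet_eq (f : State → ℂ) :
    antisymmSet f = ⋂ p : Fin 5 → Σ n : ℕ, Equiv.Perm (Fin n),
      {c | f (permState (fun i => permFamily (p i)) c) =
        signState (fun i => permFamily (p i)) c * f c} := by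
  refine Set.Subset.antisymm (fun c hc => Set.mem_iInter.2 fun p => hc _) fun c hc σ => ?_
  have h := Set.mem_iInter.1 hc (tuple ⟨_, σ 0 c.1.1⟩ ⟨_, σ 1 c.2.1.1⟩ ⟨_, σ 2 c.2.2.1.1⟩
    ⟨_, σ 3 c.2.2.2.1.1⟩ ⟨_, σ 4 c.2.2.2.2.1⟩)
  simp only [Set.mem_ofPred_eq, permState, signState, Conf.perm, tuple, permFamily_self] at h
  exact h

lemma measurable_signState (σ : Fin 5 → ∀ n : ℕ, Equiv.Perm (Fin n)) :
    Measurable (signState σ) := by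
  have h : ∀ (τ : ∀ n : ℕ, Equiv.Perm (Fin n)) (X : Type) [MeasurableSpace X],
      Measurable fun c : Conf X => ((Equiv.Perm.sign (τ c.1) : ℤ) : ℂ) := fun τ X _ =>
    (measurable_of_countable fun n : ℕ => ((Equiv.Perm.sign (τ n) : ℤ) : ℂ)).comp
      measurable_fst_conf
  have e : signState σ = fun c => ((Equiv.Perm.sign (σ 0 c.1.1) : ℤ) : ℂ) *
      ((Equiv.Perm.sign (σ 1 c.2.1.1) : ℤ) : ℂ) * ((Equiv.Perm.sign (σ 2 c.2.2.1.1) : ℤ) : ℂ) *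
      ((Equiv.Perm.sign (σ 3 c.2.2.2.1.1) : ℤ) : ℂ) *
      ((Equiv.Perm.sign (σ 4 c.2.2.2.2.1) : ℤ) : ℂ) := by
    funext c
    simp only [signState]
    push_cast
    ring
  rw [e]
  exact (((((h (σ 0) _).comp measurable_fst).mul ((h (σ 1) _).comp (by fun_prop))).mul
    ((h (σ 2) _).comp (by fun_prop))).mul ((h (σ 3) _).comp (by fun_prop))).mul
    ((h (σ 4) _).comp (by fun_prop))

lemma measurableSet_antisymmSet {f : State → ℂ} (hf : Measurable f) :
    MeasurableSet (antisymmSet f) := by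
  rw [antisymmSet_eq]
  refine MeasurableSet.iInter fun p => measurableSet_eq_fun
    (hf.comp (quasiMeasurePreserving_permState _).measurable) ((measurable_signState _).mul hf)

lemma ae_mem_antisymmSet {f : State → ℂ} (hf : IsAntisymm f) : ∀ᵐ c, c ∈ antisymmSet f := by
  have h := ae_all_iff.2 fun p : Fin 5 → Σ n : ℕ, Equiv.Perm (Fin n) =>
    hf fun i => permFamily (p i)
  filter_upwards [h] with c hc
  rw [antisymmSet_eq]
  exact Set.mem_iInter.2 hc

lemma permState_mem_antisymmSet {f : State → ℂ} {c : State} (hc : c ∈ antisymmSet f)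
    (τ : Fin 5 → ∀ n : ℕ, Equiv.Perm (Fin n)) : permState τ c ∈ antisymmSet f := by
  intro σ
  rw [permState_permState, hc, signState_permState, hc τ, mul_assoc]

lemma permState_mem_antisymmSet_iff {f : State → ℂ} (c : State)
    (τ : Fin 5 → ∀ n : ℕ, Equiv.Perm (Fin n)) :
    permState τ c ∈ antisymmSet f ↔ c ∈ antisymmSet f := by
  refine ⟨fun h => ?_, fun h => permState_mem_antisymmSet h τ⟩
  have := permState_mem_antisymmSet h fun i n => (τ i n)⁻¹
  rwa [permState_inv_permState] at this

lemma antisymmPair_of_forall {f : State → ℂ}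
    (hf : ∀ (σ : Fin 5 → ∀ n : ℕ, Equiv.Perm (Fin n)) (c : State),
      f (permState σ c) = signState σ c * f c) (r : Charged) :
    AntisymmPair fun c => f (join (r, c)) := by
  refine ⟨fun c n σ x => ?_, fun c n σ x => ?_⟩
  · have h := hf (tuple (fun _ => 1) (fun _ => 1) (fun _ => 1) (permFamily ⟨n, σ⟩) fun _ => 1)
      (join (r, (⟨n, x⟩, c)))
    have e : signState (tuple (fun _ => 1) (fun _ => 1) (fun _ => 1) (permFamily ⟨n, σ⟩)
        fun _ => 1) (join (r, (⟨n, x⟩, c))) = ((Equiv.Perm.sign σ : ℤ) : ℂ) := by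
      change (((Equiv.Perm.sign (1 : Equiv.Perm (Fin r.1.1)) *
        Equiv.Perm.sign (1 : Equiv.Perm (Fin r.2.1.1)) *
        Equiv.Perm.sign (1 : Equiv.Perm (Fin r.2.2.1)) *
        Equiv.Perm.sign (permFamily ⟨n, σ⟩ n) *
        Equiv.Perm.sign (1 : Equiv.Perm (Fin c.1)) : ℤˣ) : ℤ) : ℂ) = _
      rw [permFamily_self]
      simp
    rw [e] at h
    change f (r.1, r.2.1, r.2.2, ⟨n, x ∘ permFamily ⟨n, σ⟩ n⟩, c) = _ at h
    rw [permFamily_self] at h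
    exact h
  · have h := hf (tuple (fun _ => 1) (fun _ => 1) (fun _ => 1) (fun _ => 1) (permFamily ⟨n, σ⟩))
      (join (r, (c, ⟨n, x⟩)))
    have e : signState (tuple (fun _ => 1) (fun _ => 1) (fun _ => 1) (fun _ => 1)
        (permFamily ⟨n, σ⟩)) (join (r, (c, ⟨n, x⟩))) = ((Equiv.Perm.sign σ : ℤ) : ℂ) := by
      change (((Equiv.Perm.sign (1 : Equiv.Perm (Fin r.1.1)) *
        Equiv.Perm.sign (1 : Equiv.Perm (Fin r.2.1.1)) *
        Equiv.Perm.sign (1 : Equiv.Perm (Fin r.2.2.1)) *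
        Equiv.Perm.sign (1 : Equiv.Perm (Fin c.1)) *
        Equiv.Perm.sign (permFamily ⟨n, σ⟩ n) : ℤˣ) : ℤ) : ℂ) = _
      rw [permFamily_self]
      simp
    rw [e] at h
    change f (r.1, r.2.1, r.2.2, c, ⟨n, x ∘ permFamily ⟨n, σ⟩ n⟩) = _ at h
    rw [permFamily_self] at h
    exact h

/-- A vector of `𝔉` has a measurable representative which is antisymmetric at every point, and
which vanishes at every configuration of more than `N` particles if the vector does so almost
everywhere. There is no restriction of the particle number for `N = ∞`. -/
lemma Fock.exists_representative (φ : Fock) {N : ℕ∞}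
    (hN : ∀ᵐ c, N < (particleNumber c : ℕ∞) → φ.fn c = 0) :
    ∃ f : State → ℂ, Measurable f ∧ f =ᵐ[volume] φ.fn ∧
      (∀ r, AntisymmPair fun c => f (join (r, c))) ∧
      ∀ c, N < (particleNumber c : ℕ∞) → f c = 0 := by
  have hm : Measurable φ.fn := (Lp.stronglyMeasurable φ.1).measurable
  have hT : MeasurableSet {c : State | (particleNumber c : ℕ∞) ≤ N} :=
    measurable_particleNumber (MeasurableSet.of_discrete (s := {k : ℕ | (k : ℕ∞) ≤ N}))
  set S : Set State := antisymmSet φ.fn ∩ {c : State | (particleNumber c : ℕ∞) ≤ N}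
  have hS : MeasurableSet S := (measurableSet_antisymmSet hm).inter hT
  have hinv : ∀ (σ : Fin 5 → ∀ n : ℕ, Equiv.Perm (Fin n)) (c : State),
      permState σ c ∈ S ↔ c ∈ S := fun σ c =>
    and_congr (permState_mem_antisymmSet_iff c σ) Iff.rfl
  refine ⟨S.indicator φ.fn, hm.indicator hS, ?_, antisymmPair_of_forall fun σ c => ?_,
    fun c hc => Set.indicator_of_notMem (fun h => not_le.2 hc h.2) _⟩
  · filter_upwards [ae_mem_antisymmSet φ.antisymm, hN] with c h1 h2
    by_cases hc : c ∈ S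
    · rw [Set.indicator_of_mem hc]
    · rw [Set.indicator_of_notMem hc, h2 (not_le.1 fun h => hc ⟨h1, h⟩)]
  · by_cases hc : c ∈ S
    · rw [Set.indicator_of_mem hc, Set.indicator_of_mem ((hinv σ c).2 hc), hc.1]
    · rw [Set.indicator_of_notMem hc, Set.indicator_of_notMem fun h => hc ((hinv σ c).1 h),
        mul_zero]

/-! ### Number estimates -/

section Numbers

variable {mₑ mμ e B : ℝ}

lemma card_mul_le_sum_landauEnergy (m : ℝ) (he : 0 < e) (hB : 0 < B) (c : Conf Gamma1) :
    c.1 * m ≤ ∑ i, landauEnergy m e B (c.2 i) := by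
  have h := Finset.card_nsmul_le_sum Finset.univ (fun i => landauEnergy m e B (c.2 i)) m
    fun i _ => le_landauEnergy m he hB (c.2 i)
  simpa using h

lemma mass_le_totalEnergy (he : 0 < e) (hB : 0 < B) (c : State) :
    c.1.1 * mₑ + c.2.1.1 * mμ + c.2.2.1.1 * mμ ≤ totalEnergy mₑ mμ e B c := by
  have h₁ := card_mul_le_sum_landauEnergy mₑ he hB c.1
  have h₂ := card_mul_le_sum_landauEnergy mμ he hB c.2.1
  have h₃ := card_mul_le_sum_landauEnergy mμ he hB c.2.2.1
  have h₄ : 0 ≤ ∑ i, ‖c.2.2.2.1.2 i‖ := Finset.sum_nonneg fun _ _ => norm_nonneg _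
  have h₅ : 0 ≤ ∑ i, ‖c.2.2.2.2.2 i‖ := Finset.sum_nonneg fun _ _ => norm_nonneg _
  unfold totalEnergy
  linarith

lemma totalEnergy_nonneg (hmₑ : 0 < mₑ) (hmμ : 0 < mμ) (he : 0 < e) (hB : 0 < B) (c : State) :
    0 ≤ totalEnergy mₑ mμ e B c :=
  le_trans (by positivity) (mass_le_totalEnergy he hB c)

lemma card_le_totalEnergy (hmₑ : 0 < mₑ) (hmμ : 0 < mμ) (he : 0 < e) (hB : 0 < B) (c : State) :
    (c.1.1 : ℝ) + (c.2.1.1 + c.2.2.1.1) ≤ (1 / mₑ + 1 / mμ) * totalEnergy mₑ mμ e B c := by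
  have h := mass_le_totalEnergy (mₑ := mₑ) (mμ := mμ) he hB c
  have h₁ : (c.1.1 : ℝ) ≤ 1 / mₑ * totalEnergy mₑ mμ e B c := by
    rw [one_div, ← div_eq_inv_mul, le_div_iff₀ hmₑ]
    have : 0 ≤ (c.2.1.1 : ℝ) * mμ + c.2.2.1.1 * mμ := by positivity
    linarith
  have h₂ : (c.2.1.1 : ℝ) + c.2.2.1.1 ≤ 1 / mμ * totalEnergy mₑ mμ e B c := by
    rw [one_div, ← div_eq_inv_mul, le_div_iff₀ hmμ]
    have : 0 ≤ (c.1.1 : ℝ) * mₑ := by positivity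
    linarith
  linarith

lemma sqrt_mul_sqrt_le {a b : ℝ} (ha : 0 ≤ a) (hb : 0 ≤ b) :
    Real.sqrt a * Real.sqrt b ≤ (a + b) / 2 := by
  nlinarith [Real.sq_sqrt ha, Real.sq_sqrt hb, sq_nonneg (Real.sqrt a - Real.sqrt b)]

/-- A weight which is at most the arithmetic mean of two numbers of charged leptons, up to `1`, is
dominated by the energy. -/
lemma lintegral_weighted_le (hmₑ : 0 < mₑ) (hmμ : 0 < mμ) (he : 0 < e) (hB : 0 < B)
    {φ χ : Fock} (h : (φ, χ) ∈ freeGraph mₑ mμ e B) {f : State → ℂ} (hf : f =ᵐ[volume] φ.fn)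
    {w : Charged → ℝ} (hw0 : ∀ r, 0 ≤ w r)
    (hw : ∀ r, w r ≤ r.1.1 + (r.2.1.1 + r.2.2.1) + 1) :
    ∫⁻ c, ‖weighted w f c‖ₑ ^ 2 ≤
      ENNReal.ofReal (‖((1 / mₑ + 1 / mμ : ℝ) : ℂ) • χ + φ‖ ^ 2) := by
  set μ : ℝ := 1 / mₑ + 1 / mμ
  have hnorm := ofReal_norm_toLp_sq (Fock.memLp ((μ : ℂ) • χ + φ))
  have e1 : (Fock.memLp ((μ : ℂ) • χ + φ)).toLp _ = ((μ : ℂ) • χ + φ).1 := Lp.toLp_coeFn _ _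
  rw [e1] at hnorm
  refine le_trans (lintegral_mono_ae ?_) hnorm.ge
  have h' : ∀ᵐ c : State, χ.fn c = totalEnergy mₑ mμ e B c * φ.fn c := h
  filter_upwards [hf, h', Fock.fn_add ((μ : ℂ) • χ) φ, Fock.fn_smul (μ : ℂ) χ] with c h1 h2 h3 h4
  have e2 : ((μ : ℂ) • χ + φ).fn c = ((μ * totalEnergy mₑ mμ e B c + 1 : ℝ) : ℂ) * φ.fn c := by
    rw [h3, Pi.add_apply, h4, Pi.smul_apply, smul_eq_mul, h2]
    push_cast
    ring
  rw [e2, weighted, h1, enorm_mul, enorm_mul]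
  gcongr
  rw [← ofReal_norm, ← ofReal_norm, Complex.norm_real, Complex.norm_real,
    Real.norm_of_nonneg (hw0 _), Real.norm_of_nonneg]
  · refine ENNReal.ofReal_le_ofReal ((hw _).trans ?_)
    have := card_le_totalEnergy hmₑ hmμ he hB c
    simp only [μ]
    linarith
  · have := totalEnergy_nonneg hmₑ hmμ he hB c
    positivity

end Numbers

/-! ### Relative bound of the form -/

lemma ofReal_norm_sq (φ : Fock) : ENNReal.ofReal (‖φ‖ ^ 2) = ∫⁻ c, ‖φ.fn c‖ₑ ^ 2 := by
  have h := ofReal_norm_toLp_sq φ.memLp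
  have e : φ.memLp.toLp _ = φ.1 := Lp.toLp_coeFn _ _
  rw [e] at h
  exact h

lemma norm_le_of_enorm_sq_le {z : ℂ} {C a b p q : ℝ} (hC : 0 ≤ C) (ha : 0 ≤ a) (hb : 0 ≤ b)
    (hp : 0 ≤ p) (hq : 0 ≤ q) {P Q : ℝ≥0∞} (hP : P ≤ ENNReal.ofReal (p ^ 2))
    (hQ : Q ≤ ENNReal.ofReal (q ^ 2))
    (h : ‖z‖ₑ ^ 2 ≤ ENNReal.ofReal C ^ 2 *
      (ENNReal.ofReal (a ^ 2) * ENNReal.ofReal (b ^ 2) * (P * Q))) :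
    ‖z‖ ≤ C * a * b * p * q := by
  have h1 : ENNReal.ofReal (‖z‖ ^ 2) ≤ ENNReal.ofReal ((C * a * b * p * q) ^ 2) := by
    calc ENNReal.ofReal (‖z‖ ^ 2) = ‖z‖ₑ ^ 2 := by
          rw [ENNReal.ofReal_pow (norm_nonneg _), ofReal_norm]
      _ ≤ _ := h
      _ ≤ ENNReal.ofReal C ^ 2 * (ENNReal.ofReal (a ^ 2) * ENNReal.ofReal (b ^ 2) *
          (ENNReal.ofReal (p ^ 2) * ENNReal.ofReal (q ^ 2))) := by gcongr
      _ = _ := by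
          rw [← ENNReal.ofReal_pow hC, ← ENNReal.ofReal_mul (by positivity),
            ← ENNReal.ofReal_mul (by positivity), ← ENNReal.ofReal_mul (by positivity),
            ← ENNReal.ofReal_mul (by positivity)]
          congr 1
          ring
  rw [ENNReal.ofReal_le_ofReal_iff (by positivity)] at h1
  exact (pow_le_pow_iff_left₀ (norm_nonneg _) (by positivity) two_ne_zero).1 h1

section Form

variable {mₑ mμ e B : ℝ} (hmₑ : 0 < mₑ) (hmμ : 0 < mμ) (he : 0 < e) (hB : 0 < B) (F G : Cutoff)

lemma measurable_weight {h : ℕ × ℕ × ℕ → ℝ} :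
    Measurable fun r : Charged => h (r.1.1, r.2.1.1, r.2.2.1) := by
  have hn : Measurable fun r : Charged => (r.1.1, r.2.1.1, r.2.2.1) := by
    refine Measurable.prodMk (measurable_fst_conf.comp ?_) (Measurable.prodMk
      (measurable_fst_conf.comp ?_) (measurable_fst_conf.comp ?_)) <;> fun_prop
  exact (measurable_of_countable h).comp (f := fun r : Charged => (r.1.1, r.2.1.1, r.2.2.1)) hn

include hmₑ hmμ he hB in
/-- The number estimate: in each of the four form integrals, the factors `√n` which the annihilation
operators of two charged leptons bring in are attributed to the vector in the domain of `H₀`; by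
the inequality of the arithmetic and the geometric mean and `n m ≤ E` they are dominated by
`(1 / mₑ + 1 / mμ) H₀ + 1`. -/
theorem form_estimate {φ χ ψ : Fock} (h : (φ, χ) ∈ freeGraph mₑ mμ e B)
    (hψ : IsFiniteParticle ψ.fn) :
    FormConverges mₑ mμ e B F G ψ.fn φ.fn ∧
      ‖interactionForm mₑ mμ e B F G ψ.fn φ.fn‖ ≤
        4 * (constC * ‖F‖ * ‖G‖ * ‖((1 / mₑ + 1 / mμ : ℝ) : ℂ) • χ + φ‖) * ‖ψ‖ := by
  obtain ⟨N, hN⟩ := hψ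
  obtain ⟨f, hfm, hfe, hfa, hf0⟩ := ψ.exists_representative (N := N)
    (by simpa only [Nat.cast_lt] using hN)
  obtain ⟨g, hgm, hge, hga, -⟩ := φ.exists_representative (N := ⊤)
    (Eventually.of_forall fun c hc => absurd hc not_top_lt)
  simp only [Nat.cast_lt] at hf0
  set W : Fock := ((1 / mₑ + 1 / mμ : ℝ) : ℂ) • χ + φ
  have hone : ∫⁻ c, ‖weighted (fun _ => 1) f c‖ₑ ^ 2 ≤ ENNReal.ofReal (‖ψ‖ ^ 2) := by
    rw [ofReal_norm_sq]
    refine (lintegral_congr_ae ?_).le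
    filter_upwards [hfe] with c hc
    simp [weighted, hc]
  have hone' := ne_top_of_le_ne_top ENNReal.ofReal_ne_top hone
  have hle : ∀ {w : Charged → ℝ}, (∀ r, 0 ≤ w r) →
      (∀ r, w r ≤ r.1.1 + (r.2.1.1 + r.2.2.1) + 1) →
      ∫⁻ c, ‖weighted w g c‖ₑ ^ 2 ≤ ENNReal.ofReal (‖W‖ ^ 2) := fun hw0 hw =>
    lintegral_weighted_le hmₑ hmμ he hB h hge hw0 hw
  have hw : ∀ a b k : ℝ, 0 ≤ a → 0 ≤ b → (a + b) / 2 ≤ k → Real.sqrt a * Real.sqrt b ≤ k :=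
    fun a b k ha hb hk => (sqrt_mul_sqrt_le ha hb).trans hk
  have hl₁ : ∀ r : Charged, Real.sqrt (r.1.1 + 1) * Real.sqrt r.2.1.1 ≤
      r.1.1 + (r.2.1.1 + r.2.2.1) + 1 := fun r =>
    hw _ _ _ (by positivity) (by positivity) (by
      linarith [(r.1.1 : ℕ).cast_nonneg (α := ℝ), (r.2.1.1 : ℕ).cast_nonneg (α := ℝ),
        (r.2.2.1 : ℕ).cast_nonneg (α := ℝ)])
  have hl₂ : ∀ r : Charged, Real.sqrt r.1.1 * Real.sqrt (r.2.1.1 + 1) ≤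
      r.1.1 + (r.2.1.1 + r.2.2.1) + 1 := fun r =>
    hw _ _ _ (by positivity) (by positivity) (by
      linarith [(r.1.1 : ℕ).cast_nonneg (α := ℝ), (r.2.1.1 : ℕ).cast_nonneg (α := ℝ),
        (r.2.2.1 : ℕ).cast_nonneg (α := ℝ)])
  have hl₃ : ∀ r : Charged, Real.sqrt (r.1.1 + 1) * Real.sqrt (r.2.2.1 + 1) ≤
      r.1.1 + (r.2.1.1 + r.2.2.1) + 1 := fun r =>
    hw _ _ _ (by positivity) (by positivity) (by
      linarith [(r.1.1 : ℕ).cast_nonneg (α := ℝ), (r.2.1.1 : ℕ).cast_nonneg (α := ℝ),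
        (r.2.2.1 : ℕ).cast_nonneg (α := ℝ)])
  have hl₄ : ∀ r : Charged, Real.sqrt r.1.1 * Real.sqrt r.2.2.1 ≤
      r.1.1 + (r.2.1.1 + r.2.2.1) + 1 := fun r =>
    hw _ _ _ (by positivity) (by positivity) (by
      linarith [(r.1.1 : ℕ).cast_nonneg (α := ℝ), (r.2.1.1 : ℕ).cast_nonneg (α := ℝ),
        (r.2.2.1 : ℕ).cast_nonneg (α := ℝ)])
  have hb₁ := hle (fun r => by positivity) hl₁
  have hb₂ := hle (fun r => by positivity) hl₂
  have hb₃ := hle (fun r => by positivity) hl₃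
  have hb₄ := hle (fun r => by positivity) hl₄
  obtain ⟨i₁, j₁⟩ := integrand₁_estimate hmₑ hmμ he hB F G hfm hgm hfa (Or.inl hf0)
    measurable_const (measurable_weight (h := fun k => Real.sqrt (k.1 + 1) * Real.sqrt k.2.1))
    hone' (ne_top_of_le_ne_top ENNReal.ofReal_ne_top hb₁)
    (fun z => by simp [addMuon, Conf.insert])
  obtain ⟨i₂, j₂⟩ := integrand₁_estimate hmₑ hmμ he hB F G hgm hfm hga (Or.inr hf0)
    (measurable_weight (h := fun k => Real.sqrt k.1 * Real.sqrt (k.2.1 + 1))) measurable_const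
    (ne_top_of_le_ne_top ENNReal.ofReal_ne_top hb₂) hone'
    (fun z => by simp [addElectron, Conf.insert])
  obtain ⟨i₃, j₃⟩ := integrand₂_estimate hmₑ hmμ he hB F G hfm hgm hfa (Or.inl hf0)
    measurable_const
    (measurable_weight (h := fun k => Real.sqrt (k.1 + 1) * Real.sqrt (k.2.2 + 1)))
    hone' (ne_top_of_le_ne_top ENNReal.ofReal_ne_top hb₃) (fun z => by simp)
  obtain ⟨i₄, j₄⟩ := integrand₂_estimate hmₑ hmμ he hB F G hgm hfm hga (Or.inr hf0)
    (measurable_weight (h := fun k => Real.sqrt k.1 * Real.sqrt k.2.2)) measurable_const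
    (ne_top_of_le_ne_top ENNReal.ofReal_ne_top hb₄) hone'
    (fun z => by simp [addElectronAntimuon, Conf.insert])
  have k₁ := norm_le_of_enorm_sq_le constC_nonneg (norm_nonneg F) (norm_nonneg G)
    (norm_nonneg ψ) (norm_nonneg W) hone hb₁ j₁
  have k₂ := norm_le_of_enorm_sq_le constC_nonneg (norm_nonneg F) (norm_nonneg G)
    (norm_nonneg W) (norm_nonneg ψ) hb₂ hone j₂
  have k₃ := norm_le_of_enorm_sq_le constC_nonneg (norm_nonneg F) (norm_nonneg G)
    (norm_nonneg ψ) (norm_nonneg W) hone hb₃ j₃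
  have k₄ := norm_le_of_enorm_sq_le constC_nonneg (norm_nonneg F) (norm_nonneg G)
    (norm_nonneg W) (norm_nonneg ψ) hb₄ hone j₄
  have c₁ := integrand₁_congr mₑ mμ e B F G hfe hge
  have c₂ := integrand₁_congr mₑ mμ e B F G hge hfe
  have c₃ := integrand₂_congr mₑ mμ e B F G hfe hge
  have c₄ := integrand₂_congr mₑ mμ e B F G hge hfe
  refine ⟨⟨i₁.congr c₁, i₂.congr c₂, i₃.congr c₃, i₄.congr c₄⟩, ?_⟩
  rw [interactionForm, ← integral_congr_ae c₁, ← integral_congr_ae c₂, ← integral_congr_ae c₃,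
    ← integral_congr_ae c₄]
  refine (norm_add_le _ _).trans ((add_le_add ((norm_add_le _ _).trans (add_le_add
    ((norm_add_le _ _).trans (add_le_add k₁ ((norm_star _).le.trans k₂))) k₃))
    ((norm_star _).le.trans k₄)).trans (le_of_eq ?_))
  ring

end Form

/-! ### Multiplication operators and the free Hamiltonian -/

/-- Symmetric bounded functions of the configuration act on `𝔉` by multiplication. -/
lemma Fock.exists_mul (φ : Fock) {m : State → ℂ} (hm : Measurable m)
    (hinv : ∀ (σ : Fin 5 → ∀ n : ℕ, Equiv.Perm (Fin n)) (c : State), m (permState σ c) = m c)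
    {C : ℝ} (hC : ∀ c, ‖m c‖ ≤ C) : ∃ φ' : Fock, φ'.fn =ᵐ[volume] fun c => m c * φ.fn c := by
  have hL : MemLp (fun c => m c * φ.fn c) 2 volume :=
    φ.memLp.of_le_mul (c := C) (hm.aestronglyMeasurable.mul φ.memLp.1)
      (Eventually.of_forall fun c => by rw [norm_mul]; gcongr; exact hC c)
  refine ⟨Fock.mk _ hL fun σ => ?_, Fock.fn_mk _ hL _⟩
  filter_upwards [hL.coeFn_toLp, (quasiMeasurePreserving_permState σ).ae hL.coeFn_toLp,
    φ.antisymm σ] with c h1 h2 h3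
  rw [h1, h2, h3, hinv]
  ring

section Free

variable {mₑ mμ e B : ℝ}

lemma measurable_sum_conf {X : Type} [MeasurableSpace X] {f : X → ℝ} (hf : Measurable f) :
    Measurable fun c : Conf X => ∑ i, f (c.2 i) :=
  measurable_of_sectors fun n => show Measurable fun x : Fin n → X => ∑ i, f (x i) from
    Finset.measurable_sum _ fun i _ => hf.comp (measurable_pi_apply i)

lemma measurable_totalEnergy (mₑ mμ e B : ℝ) : Measurable (totalEnergy mₑ mμ e B) := by
  have h₁ := measurable_sum_conf (measurable_landauEnergy mₑ e B)
  have h₂ := measurable_sum_conf (measurable_landauEnergy mμ e B)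
  have h₃ := measurable_sum_conf (X := Momentum) (f := fun p => ‖p‖) (by fun_prop)
  exact ((((h₁.comp measurable_fst).add (h₂.comp (by fun_prop))).add
    (h₂.comp (by fun_prop))).add (h₃.comp (by fun_prop))).add (h₃.comp (by fun_prop))

lemma totalEnergy_permState (σ : Fin 5 → ∀ n : ℕ, Equiv.Perm (Fin n)) (c : State) :
    totalEnergy mₑ mμ e B (permState σ c) = totalEnergy mₑ mμ e B c := by
  have h : ∀ {X : Type} (f : X → ℝ) (d : Conf X) (τ : ∀ n : ℕ, Equiv.Perm (Fin n)),
      ∑ i, f ((d.perm τ).2 i) = ∑ i, f (d.2 i) := fun f d τ =>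
    Equiv.sum_comp (τ d.1) fun i => f (d.2 i)
  have hadd : ∀ {a b c d : ℝ}, a = b → c = d → a + c = b + d := fun h h' => by rw [h, h']
  exact hadd (hadd (hadd (hadd (h _ c.1 (σ 0)) (h _ c.2.1 (σ 1))) (h _ c.2.2.1 (σ 2)))
    (h (fun p => ‖p‖) c.2.2.2.1 (σ 3))) (h (fun p => ‖p‖) c.2.2.2.2 (σ 4))

lemma graph_freeHamiltonian : (freeHamiltonian mₑ mμ e B).graph = freeGraph mₑ mμ e B :=
  Submodule.toLinearPMap_graph_eq _ fun y hy h0 => freeGraph_functional mₑ mμ e B y hy h0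

lemma graph_interaction (mₑ mμ e B : ℝ) (F G : Cutoff) :
    (interaction mₑ mμ e B F G).graph = interactionGraph mₑ mμ e B F G :=
  Submodule.toLinearPMap_graph_eq _ fun y hy h0 =>
    interactionGraph_functional mₑ mμ e B F G y hy h0

lemma mem_freeGraph (x : (freeHamiltonian mₑ mμ e B).domain) :
    ((x : Fock), freeHamiltonian mₑ mμ e B x) ∈ freeGraph mₑ mμ e B := by
  rw [← graph_freeHamiltonian]
  exact LinearPMap.mem_graph _ x

lemma freeHamiltonian_isFormalAdjoint :
    (freeHamiltonian mₑ mμ e B).IsFormalAdjoint (freeHamiltonian mₑ mμ e B) := by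
  intro x y
  have hx : ∀ᵐ c : State, _ = _ := mem_freeGraph x
  have hy : ∀ᵐ c : State, _ = _ := mem_freeGraph y
  rw [Fock.inner_eq, Fock.inner_eq]
  refine integral_congr_ae ?_
  filter_upwards [hx, hy] with c h1 h2
  rw [h1, h2]
  simp only [RCLike.inner_apply, map_mul, Complex.conj_ofReal]
  ring

/-- The resolvent of `H₀` at imaginary points is multiplication by a bounded function. -/
lemma freeHamiltonian_surjective (t : ℝ) (ht : t ≠ 0) (y : Fock) :
    ∃ x : (freeHamiltonian mₑ mμ e B).domain,
      freeHamiltonian mₑ mμ e B x + ((t : ℂ) * Complex.I) • (x : Fock) = y := by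
  let E : State → ℝ := totalEnergy mₑ mμ e B
  have hE : Measurable E := measurable_totalEnergy mₑ mμ e B
  let d : State → ℂ := fun c => (E c : ℂ) + t * Complex.I
  have hd : Measurable d := (Complex.measurable_ofReal.comp hE).add_const _
  have hd_im : ∀ c, (d c).im = t := fun c => by simp [d]
  have hd_re : ∀ c, (d c).re = E c := fun c => by simp [d]
  have hd0 : ∀ c, d c ≠ 0 := fun c h => ht (by rw [← hd_im c, h, Complex.zero_im])
  have ht' : 0 < |t| := abs_pos.2 ht
  have hdt : ∀ c, |t| ≤ ‖d c‖ := fun c => hd_im c ▸ Complex.abs_im_le_norm (d c)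
  have hdE : ∀ c, |E c| ≤ ‖d c‖ := fun c => hd_re c ▸ Complex.abs_re_le_norm (d c)
  obtain ⟨x, hx⟩ := y.exists_mul (m := fun c => (d c)⁻¹) hd.inv
    (fun σ c => by simp only [d, E, totalEnergy_permState]) (C := |t|⁻¹) fun c => by
      rw [norm_inv]
      exact inv_anti₀ ht' (hdt c)
  obtain ⟨χ, hχ⟩ := y.exists_mul (m := fun c => (E c : ℂ) * (d c)⁻¹)
    ((Complex.measurable_ofReal.comp hE).mul hd.inv)
    (fun σ c => by simp only [d, E, totalEnergy_permState]) (C := 1) fun c => by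
      rw [norm_mul, norm_inv, Complex.norm_real, Real.norm_eq_abs, ← div_eq_mul_inv]
      exact div_le_one_of_le₀ (hdE c) (norm_nonneg _)
  have hg : (x, χ) ∈ freeGraph mₑ mμ e B := by
    change ∀ᵐ c : State, χ.fn c = (E c : ℂ) * x.fn c
    filter_upwards [hx, hχ] with c h1 h2
    rw [h1, h2, mul_assoc]
  rw [← graph_freeHamiltonian, LinearPMap.mem_graph_iff] at hg
  obtain ⟨x', hx1, hx2⟩ := hg
  simp only at hx1 hx2
  refine ⟨x', ?_⟩
  rw [hx2, hx1]
  refine Fock.ext_ae ?_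
  filter_upwards [hx, hχ, Fock.fn_add χ (((t : ℂ) * Complex.I) • x),
    Fock.fn_smul ((t : ℂ) * Complex.I) x] with c h1 h2 h3 h4
  rw [h3, Pi.add_apply, h4, Pi.smul_apply, smul_eq_mul, h1, h2]
  have := hd0 c
  calc (E c : ℂ) * (d c)⁻¹ * y.fn c + t * Complex.I * ((d c)⁻¹ * y.fn c)
      = d c * (d c)⁻¹ * y.fn c := by simp only [d]; ring
    _ = y.fn c := by rw [mul_inv_cancel₀ this, one_mul]

/-- A symmetric operator for which `A + i` is onto is densely defined. -/
lemma dense_domain_of_surjective {E : Type*} [NormedAddCommGroup E] [InnerProductSpace ℂ E]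
    [CompleteSpace E] {A : E →ₗ.[ℂ] E} (hA : A.IsFormalAdjoint A)
    (hs : ∀ y, ∃ x : A.domain, A x + Complex.I • (x : E) = y) : Dense (A.domain : Set E) := by
  rw [Submodule.dense_iff_topologicalClosure_eq_top, Submodule.topologicalClosure_eq_top_iff,
    Submodule.eq_bot_iff]
  intro η hη
  obtain ⟨x, hx⟩ := hs η
  have h1 : inner ℂ (x : E) η = 0 := hη x x.2
  rw [← hx, inner_add_right, inner_smul_right] at h1
  have h2 : (inner ℂ (x : E) (A x) : ℂ).im = 0 := by
    have := congrArg Complex.im (inner_conj_symm (𝕜 := ℂ) (x : E) (A x))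
    rw [hA x x, Complex.conj_im] at this
    linarith
  have h3 := congrArg Complex.im h1
  rw [Complex.add_im, h2, inner_self_eq_norm_sq_to_K] at h3
  have h4 : ‖(x : E)‖ ^ 2 = 0 := by
    simpa [← Complex.ofReal_pow] using h3
  have h5 : (x : E) = 0 := by simpa using h4
  have h6 : x = 0 := Subtype.ext h5
  rw [← hx, h6]
  simp

lemma dense_domain_freeHamiltonian :
    Dense ((freeHamiltonian mₑ mμ e B).domain : Set Fock) :=
  dense_domain_of_surjective freeHamiltonian_isFormalAdjoint fun y => by
    simpa using freeHamiltonian_surjective (mₑ := mₑ) (mμ := mμ) (e := e) (B := B) 1 one_ne_zero y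

end Free

/-! ### Truncation of the particle number -/

lemma Fock.exists_truncation (n : ℕ) (φ : Fock) :
    ∃ φ' : Fock, φ'.fn =ᵐ[volume] fun c => (if particleNumber c ≤ n then 1 else 0) * φ.fn c := by
  refine φ.exists_mul (m := fun c => if particleNumber c ≤ n then 1 else 0) (C := 1) ?_ ?_ ?_
  · exact Measurable.ite (measurable_particleNumber measurableSet_Iic) measurable_const
      measurable_const
  · exact fun σ c => rfl
  · intro c
    split_ifs <;> simp

/-- The part of a vector with at most `n` particles. -/
def Fock.truncation (n : ℕ) (φ : Fock) : Fock := (φ.exists_truncation n).choose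

lemma Fock.fn_truncation (n : ℕ) (φ : Fock) : (φ.truncation n).fn =ᵐ[volume]
    fun c => (if particleNumber c ≤ n then 1 else 0) * φ.fn c :=
  (φ.exists_truncation n).choose_spec

lemma Fock.isFiniteParticle_truncation (n : ℕ) (φ : Fock) :
    IsFiniteParticle (φ.truncation n).fn := by
  refine ⟨n, ?_⟩
  filter_upwards [φ.fn_truncation n] with c h1 hc
  rw [h1, if_neg (not_le.2 hc), zero_mul]

lemma truncation_mem_freeGraph {mₑ mμ e B : ℝ} {φ χ : Fock} (h : (φ, χ) ∈ freeGraph mₑ mμ e B)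
    (n : ℕ) : (φ.truncation n, χ.truncation n) ∈ freeGraph mₑ mμ e B := by
  have h' : ∀ᵐ c : State, χ.fn c = totalEnergy mₑ mμ e B c * φ.fn c := h
  change ∀ᵐ c : State, (χ.truncation n).fn c = totalEnergy mₑ mμ e B c * (φ.truncation n).fn c
  filter_upwards [h', φ.fn_truncation n, χ.fn_truncation n] with c h1 h2 h3
  rw [h2, h3, h1]
  ring

lemma Fock.tendsto_truncation (φ : Fock) :
    Tendsto (fun n => φ.truncation n) atTop (𝓝 φ) := by
  have hfin : ∫⁻ c, ‖φ.fn c‖ₑ ^ 2 ≠ ∞ := by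
    rw [← ofReal_norm_sq]
    exact ENNReal.ofReal_ne_top
  have hm : Measurable φ.fn := (Lp.stronglyMeasurable φ.1).measurable
  have e : ∀ n : ℕ, ENNReal.ofReal (‖φ.truncation n - φ‖ ^ 2) =
      ∫⁻ c, if particleNumber c ≤ n then 0 else ‖φ.fn c‖ₑ ^ 2 := by
    intro n
    rw [ofReal_norm_sq]
    refine lintegral_congr_ae ?_
    have hs : (φ.truncation n - φ).fn =ᵐ[volume] (φ.truncation n).fn - φ.fn :=
      Lp.coeFn_sub (φ.truncation n).1 φ.1
    filter_upwards [hs, φ.fn_truncation n] with c h1 h2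
    rw [h1, Pi.sub_apply, h2]
    split_ifs <;> simp
  have h0 : Tendsto (fun n : ℕ => ∫⁻ c, if particleNumber c ≤ n then 0 else ‖φ.fn c‖ₑ ^ 2) atTop
      (𝓝 (∫⁻ _ : State, 0)) := by
    refine tendsto_lintegral_of_dominated_convergence (fun c => ‖φ.fn c‖ₑ ^ 2) (fun n => ?_)
      (fun n => Eventually.of_forall fun c => ?_) hfin (Eventually.of_forall fun c => ?_)
    · exact Measurable.ite (measurable_particleNumber measurableSet_Iic) measurable_const
        (hm.enorm.pow_const 2)
    · simp only
      split_ifs <;> simp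
    · refine tendsto_const_nhds.congr' ?_
      filter_upwards [eventually_ge_atTop (particleNumber c)] with n hn
      rw [if_pos hn]
  simp_rw [← e, lintegral_zero] at h0
  have h1 := (ENNReal.tendsto_toReal ENNReal.zero_ne_top).comp h0
  have h2 : Tendsto (fun n => ‖φ.truncation n - φ‖ ^ 2) atTop (𝓝 0) := by
    refine h1.congr fun n => ?_
    simp only [Function.comp_apply]
    exact ENNReal.toReal_ofReal (by positivity)
  have h3 : Tendsto (fun n => ‖φ.truncation n - φ‖) atTop (𝓝 0) := by
    have := h2.sqrt
    simpa [Real.sqrt_sq (norm_nonneg _)] using this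
  exact tendsto_iff_norm_sub_tendsto_zero.2 h3

/-! ### The interaction on the domain of the free Hamiltonian -/

lemma FormConverges.symm {mₑ mμ e B : ℝ} {F G : Cutoff} {ψ φ : State → ℂ}
    (h : FormConverges mₑ mμ e B F G ψ φ) : FormConverges mₑ mμ e B F G φ ψ :=
  ⟨h.2.1, h.1, h.2.2.2, h.2.2.1⟩

lemma star_interactionForm (mₑ mμ e B : ℝ) (F G : Cutoff) (ψ φ : State → ℂ) :
    star (interactionForm mₑ mμ e B F G ψ φ) = interactionForm mₑ mμ e B F G φ ψ := by
  simp only [interactionForm, star_add, star_star]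
  ring

/-- The subspace of vectors with boundedly many particles. -/
def finiteParticle : Submodule ℂ Fock where
  carrier := {ψ | IsFiniteParticle ψ.fn}
  zero_mem' := ⟨0, by filter_upwards [Fock.fn_zero] with c h _ using h⟩
  add_mem' := by
    rintro ψ ψ' ⟨N, hN⟩ ⟨N', hN'⟩
    refine ⟨max N N', ?_⟩
    filter_upwards [hN, hN', Fock.fn_add ψ ψ'] with c h1 h2 h3 hc
    rw [h3, Pi.add_apply, h1 (lt_of_le_of_lt (le_max_left _ _) hc),
      h2 (lt_of_le_of_lt (le_max_right _ _) hc), add_zero]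
  smul_mem' := by
    rintro a ψ ⟨N, hN⟩
    refine ⟨N, ?_⟩
    filter_upwards [hN, Fock.fn_smul a ψ] with c h1 h2 hc
    rw [h2, Pi.smul_apply, h1 hc, smul_zero]

section Interaction

variable {mₑ mμ e B : ℝ} (hmₑ : 0 < mₑ) (hmμ : 0 < mμ) (he : 0 < e) (hB : 0 < B) (F G : Cutoff)

include hmₑ hmμ he hB in
/-- The vector representing the form is obtained from the relative bound by the theorems of
Hahn–Banach and Riesz. -/
lemma exists_representsForm {φ χ : Fock} (h : (φ, χ) ∈ freeGraph mₑ mμ e B) :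
    ∃ η : Fock, RepresentsForm mₑ mμ e B F G φ η ∧
      ‖η‖ ≤ 4 * (constC * ‖F‖ * ‖G‖ * ‖((1 / mₑ + 1 / mμ : ℝ) : ℂ) • χ + φ‖) := by
  set K : ℝ := 4 * (constC * ‖F‖ * ‖G‖ * ‖((1 / mₑ + 1 / mμ : ℝ) : ℂ) • χ + φ‖)
  have hK : 0 ≤ K := by
    have := constC_nonneg
    positivity
  have hform := fun (ψ : Fock) (hψ : IsFiniteParticle ψ.fn) =>
    form_estimate hmₑ hmμ he hB F G h hψ
  let ℓ : finiteParticle →ₗ[ℂ] ℂ :=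
    { toFun := fun ψ => interactionForm mₑ mμ e B F G φ.fn (ψ : Fock).fn
      map_add' := fun ψ ψ' => by
        have hc : ((ψ + ψ' : finiteParticle) : Fock).fn =ᵐ[volume]
            (1 : ℂ) • (ψ : Fock).fn + (ψ' : Fock).fn := by
          rw [one_smul]
          exact Fock.fn_add (ψ : Fock) (ψ' : Fock)
        rw [(interactionForm_linear mₑ mμ e B F G φ.fn _ _ _ 1 hc (hform _ ψ.2).1.symm
          (hform _ ψ'.2).1.symm).2, one_mul]
      map_smul' := fun a ψ => by
        have hc : ((a • ψ : finiteParticle) : Fock).fn =ᵐ[volume]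
            (a - 1) • (ψ : Fock).fn + (ψ : Fock).fn := by
          filter_upwards [Fock.fn_smul a (ψ : Fock)] with c h1
          refine h1.trans ?_
          rw [Pi.smul_apply, smul_eq_mul, Pi.add_apply, Pi.smul_apply, smul_eq_mul]
          ring
        rw [(interactionForm_linear mₑ mμ e B F G φ.fn _ _ _ (a - 1) hc (hform _ ψ.2).1.symm
          (hform _ ψ.2).1.symm).2, RingHom.id_apply, smul_eq_mul]
        ring }
  have hℓ : ∀ ψ, ‖ℓ ψ‖ ≤ K * ‖ψ‖ := fun ψ => by
    have h1 := (hform (ψ : Fock) ψ.2).2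
    rw [← norm_star, star_interactionForm] at h1
    exact h1
  obtain ⟨f, hf, hfn⟩ := exists_extension_norm_eq finiteParticle (ℓ.mkContinuous K hℓ)
  refine ⟨(InnerProductSpace.toDual ℂ Fock).symm f, fun ψ hψ => ⟨(hform ψ hψ).1, ?_⟩, ?_⟩
  · have h1 : f ψ = interactionForm mₑ mμ e B F G φ.fn ψ.fn := hf ⟨ψ, hψ⟩
    rw [← star_interactionForm, ← h1, ← inner_conj_symm, InnerProductSpace.toDual_symm_apply]
    rfl
  · rw [LinearIsometryEquiv.norm_map, hfn]
    exact LinearMap.mkContinuous_norm_le _ hK _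

include hmₑ hmμ he hB in
lemma domain_freeHamiltonian_le :
    (freeHamiltonian mₑ mμ e B).domain ≤ (interaction mₑ mμ e B F G).domain := by
  intro φ hφ
  obtain ⟨η, hη, -⟩ := exists_representsForm hmₑ hmμ he hB F G (mem_freeGraph ⟨φ, hφ⟩)
  have h : (φ, η) ∈ (interaction mₑ mμ e B F G).graph := by
    rw [graph_interaction]
    exact hη
  exact LinearPMap.mem_domain_of_mem_graph h

lemma representsForm_interaction (x : (interaction mₑ mμ e B F G).domain) :
    RepresentsForm mₑ mμ e B F G x (interaction mₑ mμ e B F G x) := by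
  have h := LinearPMap.mem_graph _ x
  rw [graph_interaction] at h
  exact h

include hmₑ hmμ he hB in
lemma norm_interaction_le {φ χ : Fock} (h : (φ, χ) ∈ freeGraph mₑ mμ e B)
    (hφ : φ ∈ (interaction mₑ mμ e B F G).domain) :
    ‖interaction mₑ mμ e B F G ⟨φ, hφ⟩‖ ≤
      4 * (constC * ‖F‖ * ‖G‖ * ‖((1 / mₑ + 1 / mμ : ℝ) : ℂ) • χ + φ‖) := by
  obtain ⟨η, hη, hn⟩ := exists_representsForm hmₑ hmμ he hB F G h
  have hg : (φ, η) ∈ (interaction mₑ mμ e B F G).graph := by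
    rw [graph_interaction]
    exact hη
  have := LinearPMap.mem_graph_snd_inj _ (LinearPMap.mem_graph _ ⟨φ, hφ⟩) hg rfl
  rw [this]
  exact hn

include hmₑ hmμ he hB in
/-- `H_I` is symmetric on the domain of `H₀`: on vectors with boundedly many particles this is the
symmetry of the form, and by the relative bound these vectors suffice. -/
lemma interaction_symmetric {φ χ φ' χ' : Fock} (h : (φ, χ) ∈ freeGraph mₑ mμ e B)
    (h' : (φ', χ') ∈ freeGraph mₑ mμ e B) (hφ : φ ∈ (interaction mₑ mμ e B F G).domain)
    (hφ' : φ' ∈ (interaction mₑ mμ e B F G).domain) :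
    inner ℂ (interaction mₑ mμ e B F G ⟨φ, hφ⟩) φ' =
      inner ℂ φ (interaction mₑ mμ e B F G ⟨φ', hφ'⟩) := by
  have hdom : ∀ {α β : Fock}, (α, β) ∈ freeGraph mₑ mμ e B →
      α ∈ (interaction mₑ mμ e B F G).domain := fun {α β} hα => by
    rw [← graph_freeHamiltonian] at hα
    exact domain_freeHamiltonian_le hmₑ hmμ he hB F G (LinearPMap.mem_domain_of_mem_graph hα)
  -- `H_I` applied to the truncated vectors converges
  have hlim : ∀ {α β : Fock} (hα : (α, β) ∈ freeGraph mₑ mμ e B)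
      (hd : α ∈ (interaction mₑ mμ e B F G).domain),
      Tendsto (fun n => interaction mₑ mμ e B F G
        ⟨α.truncation n, hdom (truncation_mem_freeGraph hα n)⟩) atTop
        (𝓝 (interaction mₑ mμ e B F G ⟨α, hd⟩)) := by
    intro α β hα hd
    rw [tendsto_iff_norm_sub_tendsto_zero]
    have hb : ∀ n, ‖interaction mₑ mμ e B F G
        ⟨α.truncation n, hdom (truncation_mem_freeGraph hα n)⟩ -
        interaction mₑ mμ e B F G ⟨α, hd⟩‖ ≤ 4 * (constC * ‖F‖ * ‖G‖ *
        ‖((1 / mₑ + 1 / mμ : ℝ) : ℂ) • (β.truncation n - β) + (α.truncation n - α)‖) := by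
      intro n
      rw [← LinearPMap.map_sub]
      exact norm_interaction_le hmₑ hmμ he hB F G
        ((freeGraph mₑ mμ e B).sub_mem (truncation_mem_freeGraph hα n) hα)
        (Submodule.sub_mem _ (hdom (truncation_mem_freeGraph hα n)) hd)
    refine squeeze_zero (fun n => norm_nonneg _) hb ?_
    have hz : ∀ γ : Fock, Tendsto (fun n => γ.truncation n - γ) atTop (𝓝 0) := fun γ => by
      simpa using γ.tendsto_truncation.sub_const γ
    simpa using ((((hz β).const_smul ((1 / mₑ + 1 / mμ : ℝ) : ℂ)).add
      (hz α)).norm.const_mul (constC * ‖F‖ * ‖G‖)).const_mul 4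
  have h1 := (hlim h hφ).inner (𝕜 := ℂ) φ'.tendsto_truncation
  have h2 := φ.tendsto_truncation.inner (𝕜 := ℂ) (hlim h' hφ')
  refine tendsto_nhds_unique h1 (h2.congr fun n => ?_)
  have k1 := (representsForm_interaction F G ⟨_, hdom (truncation_mem_freeGraph h' n)⟩
    (φ.truncation n) (φ.isFiniteParticle_truncation n)).2
  have k2 := (representsForm_interaction F G ⟨_, hdom (truncation_mem_freeGraph h n)⟩
    (φ'.truncation n) (φ'.isFiniteParticle_truncation n)).2
  rw [← k1, ← inner_conj_symm, ← k2, ← star_interactionForm]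
  rfl

end Interaction

end MuonDecay

end

/-- Self-adjointness of `H = H₀ + g H_I` on the domain of `H₀`, and stability of cores. -/
theorem theorem2p2 (mₑ mμ e B : ℝ) (hmₑ : 0 < mₑ) (hmμ : 0 < mμ) (he : 0 < e) (hB : 0 < B)
    (F G : MuonDecay.Cutoff) (g₀ : ℝ) (hg₀ : 0 < g₀)
    (hsmall : 4 * g₀ * (MuonDecay.constC * (1 / mₑ + 1 / mμ)) * ‖F‖ * ‖G‖ < 1)
    (g : ℝ) (hg : |g| ≤ g₀) :
    (MuonDecay.hamiltonian mₑ mμ e B F G g).domain =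
        (MuonDecay.freeHamiltonian mₑ mμ e B).domain ∧
      IsSelfAdjoint (MuonDecay.hamiltonian mₑ mμ e B F G g) ∧
      ∀ S : Submodule ℂ MuonDecay.Fock,
        (MuonDecay.freeHamiltonian mₑ mμ e B).HasCore S →
          (MuonDecay.hamiltonian mₑ mμ e B F G g).HasCore S := by
  have hC := MuonDecay.constC_nonneg
  have hμ : 0 < 1 / mₑ + 1 / mμ := by positivity
  have hdom := MuonDecay.domain_freeHamiltonian_le hmₑ hmμ he hB F G
  refine LinearPMap.katoRellich (V := (g : ℂ) • MuonDecay.interaction mₑ mμ e B F G)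
    MuonDecay.dense_domain_freeHamiltonian MuonDecay.freeHamiltonian_isFormalAdjoint
    (fun t ht y => MuonDecay.freeHamiltonian_surjective t ht y) hdom (fun x y => ?_)
    (a := |g| * (4 * (MuonDecay.constC * ‖F‖ * ‖G‖)) * (1 / mₑ + 1 / mμ))
    (b := |g| * (4 * (MuonDecay.constC * ‖F‖ * ‖G‖))) (by positivity) ?_ (by positivity) fun x => ?_
  · have h := MuonDecay.interaction_symmetric hmₑ hmμ he hB F G (MuonDecay.mem_freeGraph x)
      (MuonDecay.mem_freeGraph y) (hdom x.2) (hdom y.2)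
    rw [LinearPMap.smul_apply, LinearPMap.smul_apply, inner_smul_left, inner_smul_right, h,
      Complex.conj_ofReal]
  · calc |g| * (4 * (MuonDecay.constC * ‖F‖ * ‖G‖)) * (1 / mₑ + 1 / mμ)
        ≤ g₀ * (4 * (MuonDecay.constC * ‖F‖ * ‖G‖)) * (1 / mₑ + 1 / mμ) := by gcongr
      _ = 4 * g₀ * (MuonDecay.constC * (1 / mₑ + 1 / mμ)) * ‖F‖ * ‖G‖ := by ring
      _ < 1 := hsmall
  · have h := MuonDecay.norm_interaction_le hmₑ hmμ he hB F G (MuonDecay.mem_freeGraph x) (hdom x.2)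
    have h2 : ‖((1 / mₑ + 1 / mμ : ℝ) : ℂ) • MuonDecay.freeHamiltonian mₑ mμ e B x +
        (x : MuonDecay.Fock)‖ ≤
        (1 / mₑ + 1 / mμ) * ‖MuonDecay.freeHamiltonian mₑ mμ e B x‖ + ‖(x : MuonDecay.Fock)‖ := by
      refine (norm_add_le _ _).trans ?_
      rw [norm_smul, Complex.norm_real, Real.norm_of_nonneg hμ.le]
    rw [LinearPMap.smul_apply, norm_smul, Complex.norm_real, Real.norm_eq_abs]
    calc _ ≤ |g| * (4 * (MuonDecay.constC * ‖F‖ * ‖G‖ *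
          ((1 / mₑ + 1 / mμ) * ‖MuonDecay.freeHamiltonian mₑ mμ e B x‖ +
            ‖(x : MuonDecay.Fock)‖))) := by
          gcongr
          exact h.trans (by gcongr)
      _ = _ := by ring
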